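/- Let $k$ be an algebraically closed field of characteristic $7$, let $G=\mathrm{GL}(14,k)$ and $\mathfrak g=\mathfrak{gl}(14,k)$, with $G$ acting on $\mathfrak g$ by conjugation and on $\mathfrak g\times\mathfrak g$ by simultaneous conjugation. Put $\mathcal N_1=\{x\in\mathfrak g : x^7=0\}$, and let $\mathcal C_1^{nil}=\{(x,y)\in\mathcal N_1\times\mathcal N_1 : [x,y]=0\}$ be the restricted nilpotent commuting variety. For $x\in\mathfrak g$ let $\mathfrak z_{\mathfrak g}(x)=\{y\in\mathfrak g:[x,y]=0\}$, and for $V\subseteq\mathfrak g$ put $G\cdot(x,V)=\{(gxg^{-1},gvg^{-1}) : g\in G,\ v\in V\}$. Closures, irreducible components and dimensions refer to the Zariski topology. A nilpotent matrix has type $\lambda$ if the sizes of its Jordan blocks are the parts of the partition $\lambda$. (1) Let $e\in\mathfrak g$ be nilpotent of type $7^2$. Then $\overline{G\cdot e}=\mathcal N_1$, and $\mathfrak z_{\mathfrak g}(e)\cap\mathcal N_1$ has exactly two irreducible components $V_1\neq V_2$, each of codimension $4$ in $\mathfrak z_{\mathfrak g}(e)$. The sets $\overline{G\cdot(e,V_1)}$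 and $\overline{G\cdot(e,V_2)}$ are distinct irreducible components of $\mathcal C_1^{nil}$, each of dimension $192$. (2) Let $e'\in\mathfrak g$ be nilpotent of type $7.5.2$. Then $\mathfrak z_{\mathfrak g}(e')\cap\mathcal N_1$ is irreducible of codimension $3$ in $\mathfrak z_{\mathfrak g}(e')$, and $Y=\overline{G\cdot(e',\mathfrak z_{\mathfrak g}(e')\cap\mathcal N_1)}$ is an irreducible subset of $\mathcal C_1^{nil}$ of dimension $193$. For every $e$ of type $7^2$ and every irreducible component $V$ of $\mathfrak z_{\mathfrak g}(e)\cap\mathcal N_1$, neither of the sets $Y$ and $\overline{G\cdot(e,V)}$ is contained in the other. (3) Consequently $\mathcal C_1^{nil}$ is not equidimensional, that is, its irreducible components do not all have the same dimension. (4) There are $x\in\mathcal N_1$ and an irreducible component $V$ of $\mathfrak z_{\mathfrak g}(x)\cap\mathcal N_1$ such that $V\subseteq\overline{G\cdot x}$ although $\overline{G\cdot x}\neq\mathcal N_1$. Thus, for $p=7$ and $n=14$, neither of the following two assertions about $\mathfrak{gl}(n,k)$ in characteristic $p$ holds, where $\mathcal N_1=\{x : x^p=0\}$: that $\mathcal C_1^{nil}$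 is equidimensional; and that, for all $x\in\mathcal N_1$ and all irreducible components $V$ of $\mathfrak z_{\mathfrak g}(x)\cap\mathcal N_1$, one has $V\subseteq\overline{G\cdot x}$ if and only if $\overline{G\cdot x}=\mathcal N_1$. -/

import Mathlib

/-! Zariski topology, dimension and irreducible components of subsets of a vector space. -/

section Zariski

variable (k : Type*) [Field k] {E : Type*} [AddCommGroup E] [Module k E]

/-- The ring `k[V]` of polynomial functions on a subset `V` of a `k`-vector space: the algebra of
functions on `V` generated by the restrictions of the linear forms. For a finite-dimensional
space `E` it is the polynomial ring on `E` modulo the ideal of polynomials vanishing on `V`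
(`k` infinite). -/
def polyFunctions (V : Set E) : Subalgebra k (V → k) :=
  Algebra.adjoin k (Set.range fun (φ : Module.Dual k E) (v : V) => φ (v : E))

/-- The polynomial functions on the whole space. -/
def polyFunctionsOn (E : Type*) [AddCommGroup E] [Module k E] : Subalgebra k (E → k) :=
  Algebra.adjoin k (Set.range fun (φ : Module.Dual k E) (v : E) => φ v)

/-- The Zariski topology on a vector space: the closed sets are the common zero sets of sets of
polynomial functions. -/
@[reducible] def zariskiTopology (E : Type*) [AddCommGroup E] [Module k E] : TopologicalSpace E :=
  TopologicalSpace.ofClosed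
    {Z | ∃ S : Set (E → k), S ⊆ polyFunctionsOn k E ∧ Z = {v | ∀ f ∈ S, f v = 0}}
    ⟨{1}, by simp, by ext; simp⟩
    (by
      intro A hA
      refine ⟨{f | f ∈ polyFunctionsOn k E ∧ ∃ Z ∈ A, ∀ v ∈ Z, f v = 0}, fun f hf => hf.1, ?_⟩
      ext v
      simp only [Set.mem_sInter, Set.mem_ofPred_eq]
      constructor
      · rintro h f ⟨-, Z, hZ, hf⟩
        exact hf v (h Z hZ)
      · intro h Z hZ
        obtain ⟨S, hS, rfl⟩ := hA hZ
        exact fun f hf => h f ⟨hS hf, _, hZ, fun w hw => hw f hf⟩)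
    (by
      rintro _ ⟨S, hS, rfl⟩ _ ⟨T, hT, rfl⟩
      refine ⟨{h | ∃ f ∈ S, ∃ g ∈ T, h = f * g}, ?_, ?_⟩
      · rintro _ ⟨f, hf, g, hg, rfl⟩
        exact (polyFunctionsOn k E).mul_mem (hS hf) (hT hg)
      · ext v
        simp only [Set.mem_union, Set.mem_ofPred_eq]
        constructor
        · rintro (h | h) _ ⟨f, hf, g, hg, rfl⟩
          · simp [h f hf]
          · simp [h g hg]
        · intro h
          by_contra! hc
          obtain ⟨⟨f, hf, hfv⟩, g, hg, hgv⟩ := hc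
          exact mul_ne_zero hfv hgv (h _ ⟨f, hf, g, hg, rfl⟩))

/-- Zariski closure. -/
def zariskiClosure (S : Set E) : Set E :=
  @closure E (zariskiTopology k E) S

/-- `S` is (non-empty and) irreducible for the Zariski topology. -/
def ZariskiIrreducible (S : Set E) : Prop :=
  @IsIrreducible E (zariskiTopology k E) S

/-- The irreducible components of a subset `X`: its maximal irreducible subsets. -/
def zariskiComponents (X : Set E) : Set (Set E) :=
  {V | Maximal (fun W => W ⊆ X ∧ ZariskiIrreducible k W) V}

/-- The dimension of a Zariski closed set `V`: the Krull dimension of its coordinate ring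
`k[V]`. -/
noncomputable def zariskiDim (V : Set E) : WithBot ℕ∞ :=
  ringKrullDim (polyFunctions k V)

/-- All irreducible components have the same dimension. -/
def Equidimensional (X : Set E) : Prop :=
  ∀ V ∈ zariskiComponents k X, ∀ W ∈ zariskiComponents k X, zariskiDim k V = zariskiDim k W

end Zariski

/-! The general linear Lie algebra and its restricted nilpotent elements. -/

section GeneralLinear

variable {k : Type*} [Field k] {n : ℕ}

/-- The nilpotent Jordan block of size `m`. -/
def nilpotentJordanBlock (k : Type*) [Field k] (m : ℕ) : Matrix (Fin m) (Fin m) k :=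
  Matrix.of fun i j => if (i : ℕ) + 1 = j then 1 else 0

/-- `x` is nilpotent of type `l`: it is conjugate under `GL(n, k)` to the block diagonal matrix
with nilpotent Jordan blocks of the sizes listed in `l`. -/
def HasJordanType (x : Matrix (Fin n) (Fin n) k) (l : List ℕ) : Prop :=
  ∃ (σ : (Σ i : Fin l.length, Fin (l.get i)) ≃ Fin n) (g : GL (Fin n) k),
    x = (g : Matrix (Fin n) (Fin n) k) *
      Matrix.reindex σ σ (Matrix.blockDiagonal' fun i => nilpotentJordanBlock k (l.get i)) *
      ((g⁻¹ : GL (Fin n) k) : Matrix (Fin n) (Fin n) k)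

/-- The orbit of `x` under conjugation by `GL(n, k)`. -/
def conjOrbit (x : Matrix (Fin n) (Fin n) k) : Set (Matrix (Fin n) (Fin n) k) :=
  {y | ∃ g : GL (Fin n) k, y = (g : Matrix (Fin n) (Fin n) k) * x *
    ((g⁻¹ : GL (Fin n) k) : Matrix (Fin n) (Fin n) k)}

/-- The set `G · (x, V)` of all pairs `(g x g⁻¹, g v g⁻¹)` with `g ∈ GL(n, k)` and `v ∈ V`. -/
def conjOrbitPairs (x : Matrix (Fin n) (Fin n) k) (V : Set (Matrix (Fin n) (Fin n) k)) :
    Set (Matrix (Fin n) (Fin n) k × Matrix (Fin n) (Fin n) k) :=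
  {y | ∃ g : GL (Fin n) k, ∃ v ∈ V,
    y = ((g : Matrix (Fin n) (Fin n) k) * x *
          ((g⁻¹ : GL (Fin n) k) : Matrix (Fin n) (Fin n) k),
        (g : Matrix (Fin n) (Fin n) k) * v *
          ((g⁻¹ : GL (Fin n) k) : Matrix (Fin n) (Fin n) k))}

/-- The restricted nullcone of `gl(n, k)`, where `p` is the characteristic of `k`. -/
def restrictedNullcone (k : Type*) [Field k] (n p : ℕ) : Set (Matrix (Fin n) (Fin n) k) :=
  {x | x ^ p = 0}

/-- The centralizer of `x` in `gl(n, k)`. -/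
def glCentralizer (x : Matrix (Fin n) (Fin n) k) : Submodule k (Matrix (Fin n) (Fin n) k) where
  carrier := {y | ⁅x, y⁆ = 0}
  zero_mem' := by simp [Ring.lie_def]
  add_mem' := by
    intro a b ha hb
    simp only [Set.mem_ofPred_eq, Ring.lie_def, sub_eq_zero] at *
    rw [mul_add, add_mul, ha, hb]
  smul_mem' := by
    intro c a ha
    simp only [Set.mem_ofPred_eq, Ring.lie_def, sub_eq_zero] at *
    rw [mul_smul_comm, smul_mul_assoc, ha]

/-- The elements `y` of the centralizer of `x` with `y ^ p = 0`. -/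
def nilCentralizer (p : ℕ) (x : Matrix (Fin n) (Fin n) k) : Set (Matrix (Fin n) (Fin n) k) :=
  (glCentralizer x : Set (Matrix (Fin n) (Fin n) k)) ∩ restrictedNullcone k n p

/-- The restricted nilpotent commuting variety of `gl(n, k)`, where `p` is the characteristic
of `k`. -/
def restrictedCommutingVariety (k : Type*) [Field k] (n p : ℕ) :
    Set (Matrix (Fin n) (Fin n) k × Matrix (Fin n) (Fin n) k) :=
  {z | z.1 ∈ restrictedNullcone k n p ∧ z.2 ∈ restrictedNullcone k n p ∧ ⁅z.1, z.2⁆ = 0}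

end GeneralLinear

/-!
All dimensions are computed from rational parametrizations. A chart (`IsChart`) of a set `S` is a
regular map from a Zariski dense subset of a vector space `F` into `S` that has dense image and a
regular inverse on it, where regular functions are quotients of polynomial functions. A set with a
chart is irreducible (`IsChart.irreducible`), and its dimension is the dimension of `F`
(`IsChart.zariskiDim_eq`), because the Krull dimension of a finitely generated domain is the
transcendence degree of its fraction field. If `V` is stable under the centralizer of `e` in
`GL(n, k)`, a chart of `V` extends to a chart of `G · (e, V)` by group elements `1 + m`, with `m` in
a linear complement of `𝔷(e)` (`exists_isChart_conjOrbitPairs`). Hence `G · (e, V)` is irreducible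
and `dim G · (e, V) = n² - dim 𝔷(e) + dim V` (`conjOrbitPairs_irreducible_and_dim`).

Type `7²`. Among the `x` with `x ^ 7 = 0`, those of type `7²` are the ones for which `x ^ 6` has
rank at least two (`hasJordanType_seven_seven_of_not_rankLeOne`), which is an open condition. Each
such `x` lies in a linear space of strictly block triangular matrices, which contains members of
type `7²`; so the orbit of type `7²` is dense in `N₁` (`zariskiClosure_conjOrbit_seven_seven`). The
centralizer of `e` is the ring of `2 × 2` matrices over `k[X] / X ^ 7`, with `X` acting as `e`
(`IsTruncatedMatrixRing`), and has dimension `28`. Write an element as `y = t + Z`, with `t` scalar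
and `Z` of trace zero, and put `D = - det Z`, so that `Z ^ 2 = D`. In characteristic `7` one has
`y ^ 7 = t ^ 7 + D ^ 3 Z` (`scalar_add_pow_seven`), so `y ^ 7 = 0` if and only
if `X ∣ t` and either `X ∣ Z` or `X ^ 3 ∣ D`. The first alternative gives the multiples of `X`
(`sixthAnnihilator`), a linear space of dimension `24`. The elements outside it
(`genericNilCentralizer`) have a chart of dimension `24` as well: where the upper right entry of `Z`
is a unit, the lower left one is determined by `D` and the other entries. The two closures are the
components of the nilpotent centralizer, and the corresponding sets of pairs have dimension
`196 - 28 + 24 = 192`. These are components of the commuting variety, because an irreducible set of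
pairs that contains a pair with first member of type `7²` has such pairs as a dense subset, and so
is contained in one of the two closures (`HasJordanType.subset_or_subset_of_fst_eq`).

Type `7.5.2`. The parts drop by at least two (`HasGaps`). Therefore every element of the centralizer
is triangular for a filtration by weights (`jordanWeight`), with one diagonal entry for each block,
and the nilpotent elements are those with zero diagonal. They form a linear space of codimension `3`
(`IsJordanBasis.nilCentralizer_eq`, `IsJordanBasis.finrank_strictCentralizer`), and the pairs above
the orbit have dimension `196 - 3 = 193`. Neither set of pairs contains the other: `193 > 192`, and
`x ^ 6` has rank at most one on the closure of the orbit of type `7.5.2`, but not for `x` of type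
`7²`. Since every irreducible closed set lies in a component, the components do not all have
dimension `192`.

Finally, `e'` itself belongs to its nilpotent centralizer, and the elements `y` of this linear space
whose chains through the generators of the Jordan blocks of `e'` are linearly independent form an
open subset of it. All of them have the Jordan type of `e'` (`hasJordanType_of_linearIndependent`).
Hence the nilpotent centralizer is contained in the closure of the orbit of `e'`, which is not `N₁`.
-/

/-! ### Krull dimension of finitely generated domains -/

/-- Krull dimension is invariant under integral extensions: chains of primes contract strictly
(incomparability) and lift (going up). -/
theorem ringKrullDim_eq_of_integral_injective {R S : Type*} [CommRing R] [CommRing S] [Algebra R S]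
    [Algebra.IsIntegral R S] [FaithfulSMul R S] : ringKrullDim R = ringKrullDim S := by
  apply le_antisymm
  · refine iSup_le fun l => ?_
    obtain ⟨⟨P, hP, hPl⟩⟩ := (inferInstance : Nonempty (l.head.asIdeal.primesOver S))
    obtain ⟨L, hL, -⟩ := Ideal.exists_ltSeries_of_hasGoingUp (S := S) l P
    rw [← hL]
    exact Order.LTSeries.length_le_krullDim L
  · exact Order.krullDim_le_of_strictMono (PrimeSpectrum.comap (algebraMap R S))
      fun I J h => Ideal.IsIntegral.comap_lt_comap h

/-- The Krull dimension of a finitely generated domain `A` is the cardinality of a transcendence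
basis of any domain that is algebraic over `A`. -/
theorem ringKrullDim_eq_of_isTranscendenceBasis {k A B : Type*} [Field k] [CommRing A]
    [IsDomain A] [Algebra k A] [Algebra.FiniteType k A] [CommRing B] [IsDomain B] [Algebra k B]
    [Algebra A B] [IsScalarTower k A B] [FaithfulSMul A B] [Algebra.IsAlgebraic A B]
    {n : ℕ} {x : Fin n → B} (hx : IsTranscendenceBasis k x) : ringKrullDim A = n := by
  obtain ⟨s, g, hg, hint⟩ := exists_integral_inj_algHom_of_fg k A
  let := g.toRingHom.toAlgebra
  have : Algebra.IsIntegral (MvPolynomial (Fin s) k) A := ⟨hint⟩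
  have : FaithfulSMul (MvPolynomial (Fin s) k) A :=
    (faithfulSMul_iff_algebraMap_injective _ _).2 hg
  have : IsScalarTower k (MvPolynomial (Fin s) k) A :=
    IsScalarTower.of_algebraMap_eq fun r => (g.commutes r).symm
  rw [← ringKrullDim_eq_of_integral_injective (R := MvPolynomial (Fin s) k) (S := A)]
  have h := ((IsTranscendenceBasis.mvPolynomial (Fin s) k).algebraMap_comp (A := A)).algebraMap_comp
    (A := B)
  have hc := hx.lift_cardinalMk_eq h
  simp only [Cardinal.mk_fin, Cardinal.lift_natCast, Nat.cast_inj] at hc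
  simp [hc]

/-! ### Polynomial functions and the Zariski topology -/

section Poly

variable {k : Type*} [Field k] {E : Type*} [AddCommGroup E] [Module k E]

theorem dual_mem_polyFunctionsOn (φ : Module.Dual k E) : (fun v => φ v) ∈ polyFunctionsOn k E :=
  Algebra.subset_adjoin ⟨φ, rfl⟩

/-- In coordinates with respect to a basis, the polynomial functions are those given by
polynomials. -/
theorem mem_polyFunctionsOn_iff {ι : Type*} [Finite ι] (b : Module.Basis ι k E) {f : E → k} :
    f ∈ polyFunctionsOn k E ↔
      ∃ p : MvPolynomial ι k, f = MvPolynomial.aeval (fun i v => b.coord i v) p := by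
  have : polyFunctionsOn k E =
      (MvPolynomial.aeval (R := k) (fun i (v : E) => b.coord i v)).range := by
    rw [← Algebra.adjoin_range_eq_range_aeval]
    apply le_antisymm
    · refine Algebra.adjoin_le ?_
      rintro _ ⟨φ, rfl⟩
      have := Fintype.ofFinite ι
      have : (fun v => φ v) = ∑ i, φ (b i) • fun v => b.coord i v := by
        ext v
        conv_lhs => rw [← b.sum_repr v]
        simp only [map_sum, map_smul, smul_eq_mul, Finset.sum_apply, Pi.smul_apply,
          Module.Basis.coord_apply, mul_comm]
      change (fun v => φ v) ∈ _
      rw [this]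
      exact Subalgebra.sum_mem _ fun i _ =>
        Subalgebra.smul_mem _ (Algebra.subset_adjoin (Set.mem_range_self i)) _
    · refine Algebra.adjoin_mono ?_
      rintro _ ⟨i, rfl⟩
      exact Set.mem_range_self (b.coord i)
  rw [this]
  simp [eq_comm]

theorem aeval_coord_apply {ι : Type*} (b : Module.Basis ι k E) (p : MvPolynomial ι k) (v : E) :
    MvPolynomial.aeval (fun i (v : E) => b.coord i v) p v =
      MvPolynomial.eval (fun i => b.repr v i) p := by
  induction p using MvPolynomial.induction_on with
  | C a => simp
  | add p q hp hq => rw [map_add, Pi.add_apply, hp, hq, map_add]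
  | mul_X p i hp => rw [map_mul, Pi.mul_apply, hp, map_mul]; simp

theorem aeval_coord_injective [Infinite k] {ι : Type*} [Finite ι] (b : Module.Basis ι k E) :
    Function.Injective (MvPolynomial.aeval (R := k) (fun i (v : E) => b.coord i v)) := by
  intro p q h
  refine MvPolynomial.funext fun x => ?_
  have := congrFun h (b.equivFun.symm x)
  have hx : (fun i => b.repr (b.equivFun.symm x) i) = x := by
    ext i
    exact congrFun (b.equivFun.apply_symm_apply x) i
  simpa only [aeval_coord_apply, hx] using this

/-- Over an infinite field the polynomial functions form a domain. -/
theorem polyFunctionsOn_eq_zero_or_eq_zero [Infinite k] [FiniteDimensional k E] {f g : E → k}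
    (hf : f ∈ polyFunctionsOn k E) (hg : g ∈ polyFunctionsOn k E) (h : f * g = 0) :
    f = 0 ∨ g = 0 := by
  let b := Module.finBasis k E
  obtain ⟨p, rfl⟩ := (mem_polyFunctionsOn_iff b).1 hf
  obtain ⟨q, rfl⟩ := (mem_polyFunctionsOn_iff b).1 hg
  rw [← map_mul, ← map_zero (MvPolynomial.aeval (R := k) (fun i (v : E) => b.coord i v))] at h
  rcases mul_eq_zero.1 (aeval_coord_injective b h) with h | h <;> simp [h]

theorem isClosed_zariski_iff {Z : Set E} : @IsClosed E (zariskiTopology k E) Z ↔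
    ∃ S : Set (E → k), S ⊆ polyFunctionsOn k E ∧ Z = {v | ∀ f ∈ S, f v = 0} := by
  rw [← @isOpen_compl_iff E _ (zariskiTopology k E)]
  change Zᶜᶜ ∈ _ ↔ _
  rw [compl_compl]
  rfl

theorem isClosed_zeroSet {f : E → k} (hf : f ∈ polyFunctionsOn k E) :
    @IsClosed E (zariskiTopology k E) {v | f v = 0} :=
  isClosed_zariski_iff.2 ⟨{f}, by simpa using hf, by simp⟩

theorem mem_zariskiClosure_iff {S : Set E} {v : E} : v ∈ zariskiClosure k S ↔
    ∀ f ∈ polyFunctionsOn k E, (∀ w ∈ S, f w = 0) → f v = 0 := by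
  let := zariskiTopology k E
  constructor
  · intro hv f hf h
    exact closure_minimal h (isClosed_zeroSet hf) hv
  · intro h
    obtain ⟨A, hA, hS⟩ := isClosed_zariski_iff.1 (isClosed_closure (s := S))
    change v ∈ closure S
    rw [hS]
    refine fun f hf => h f (hA hf) fun w hw => ?_
    have := subset_closure hw
    rw [hS] at this
    exact this f hf

theorem subset_zariskiClosure (S : Set E) : S ⊆ zariskiClosure k S :=
  @subset_closure E (zariskiTopology k E) S

theorem zariskiIrreducible_iff {S : Set E} : ZariskiIrreducible k S ↔ S.Nonempty ∧
    ∀ f ∈ polyFunctionsOn k E, ∀ g ∈ polyFunctionsOn k E, (∀ v ∈ S, f v * g v = 0) →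
      (∀ v ∈ S, f v = 0) ∨ ∀ v ∈ S, g v = 0 := by
  let := zariskiTopology k E
  refine and_congr_right fun _ => ?_
  rw [isPreirreducible_iff_isClosed_union_isClosed]
  constructor
  · intro h f hf g hg hfg
    exact h _ _ (isClosed_zeroSet hf) (isClosed_zeroSet hg) fun v hv => mul_eq_zero.1 (hfg v hv)
  · intro h Z W hZ hW hS
    by_contra! hc
    obtain ⟨A, hA, rfl⟩ := isClosed_zariski_iff.1 hZ
    obtain ⟨B, hB, rfl⟩ := isClosed_zariski_iff.1 hW
    simp only [Set.not_subset, Set.mem_ofPred_eq, not_forall] at hc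
    obtain ⟨⟨v, hv, f, hf, hfv⟩, w, hw, g, hg, hgw⟩ := hc
    rcases h f (hA hf) g (hB hg) fun u hu => by
      rcases hS hu with h | h
      · simp [h f hf]
      · simp [h g hg] with h | h
    · exact hfv (h v hv)
    · exact hgw (h w hw)

end Poly

/-! ### Regular and rational functions -/

section Regular

variable {k : Type*} [Field k] {E F W : Type*} [AddCommGroup E] [Module k E]
  [AddCommGroup F] [Module k F] [AddCommGroup W] [Module k W] {X : Type*}

/-- A map `ψ : X → E` whose coordinates (equivalently, whose composites with all linear forms) lie
in a given algebra `𝒜` of functions on `X`. -/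
def CoordsIn (𝒜 : Subalgebra k (X → k)) (ψ : X → E) : Prop :=
  ∀ φ : Module.Dual k E, (fun x => φ (ψ x)) ∈ 𝒜

/-- The algebra `𝒜` of functions contains the inverses of its nowhere vanishing members. -/
def InvClosed (𝒜 : Subalgebra k (X → k)) : Prop :=
  ∀ f ∈ 𝒜, (∀ x, f x ≠ 0) → (fun x => (f x)⁻¹) ∈ 𝒜

variable {𝒜 : Subalgebra k (X → k)}

theorem CoordsIn.polyFunction_comp {ψ : X → E} (h : CoordsIn 𝒜 ψ) {f : E → k}
    (hf : f ∈ polyFunctionsOn k E) : (fun x => f (ψ x)) ∈ 𝒜 := by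
  induction hf using Algebra.adjoin_induction with
  | mem f hf => obtain ⟨φ, rfl⟩ := hf; exact h φ
  | algebraMap r => exact 𝒜.algebraMap_mem r
  | add f g _ _ hf hg => exact 𝒜.add_mem hf hg
  | mul f g _ _ hf hg => exact 𝒜.mul_mem hf hg

theorem CoordsIn.linear {ψ : X → E} (h : CoordsIn 𝒜 ψ) (L : E →ₗ[k] F) :
    CoordsIn 𝒜 fun x => L (ψ x) :=
  fun φ => h (φ ∘ₗ L)

theorem coordsIn_const (v : E) : CoordsIn 𝒜 fun _ => v :=
  fun φ => 𝒜.algebraMap_mem (φ v)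

theorem CoordsIn.add {ψ χ : X → E} (h : CoordsIn 𝒜 ψ) (h' : CoordsIn 𝒜 χ) :
    CoordsIn 𝒜 fun x => ψ x + χ x := fun φ => by
  simp only [map_add]
  exact 𝒜.add_mem (h φ) (h' φ)

theorem CoordsIn.sub {ψ χ : X → E} (h : CoordsIn 𝒜 ψ) (h' : CoordsIn 𝒜 χ) :
    CoordsIn 𝒜 fun x => ψ x - χ x := fun φ => by
  simp only [map_sub]
  exact 𝒜.sub_mem (h φ) (h' φ)

theorem CoordsIn.smul {ψ : X → E} (h : CoordsIn 𝒜 ψ) {f : X → k} (hf : f ∈ 𝒜) :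
    CoordsIn 𝒜 fun x => f x • ψ x := fun φ => by
  simp only [map_smul]
  exact 𝒜.mul_mem hf (h φ)

theorem CoordsIn.sum {ι : Type*} (s : Finset ι) {ψ : ι → X → E} (h : ∀ i ∈ s, CoordsIn 𝒜 (ψ i)) :
    CoordsIn 𝒜 fun x => ∑ i ∈ s, ψ i x := fun φ => by
  have : (fun x => φ (∑ i ∈ s, ψ i x)) = ∑ i ∈ s, fun x => φ (ψ i x) := by
    ext x; simp
  rw [this]
  exact Subalgebra.sum_mem _ fun i hi => h i hi φ

theorem coordsIn_scalar {f : X → k} : CoordsIn 𝒜 f ↔ f ∈ 𝒜 :=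
  ⟨fun h => h LinearMap.id, fun h φ => by
    have : (fun x => φ (f x)) = φ 1 • f := by
      ext x
      rw [Pi.smul_apply, smul_eq_mul, mul_comm, ← smul_eq_mul, ← map_smul, smul_eq_mul, mul_one]
    rw [this]
    exact 𝒜.smul_mem h _⟩

/-- It is enough to check the coordinates with respect to a basis. -/
theorem coordsIn_of_basis {ι : Type*} [Fintype ι] (b : Module.Basis ι k E) {ψ : X → E}
    (h : ∀ i, (fun x => b.repr (ψ x) i) ∈ 𝒜) : CoordsIn 𝒜 ψ := by
  have : ψ = fun x => ∑ i, b.repr (ψ x) i • b i := by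
    ext x; rw [b.sum_repr]
  rw [this]
  exact CoordsIn.sum _ fun i _ => (coordsIn_const (b i)).smul (h i)

theorem CoordsIn.prodMk {ψ : X → E} {χ : X → F} (h : CoordsIn 𝒜 ψ) (h' : CoordsIn 𝒜 χ) :
    CoordsIn 𝒜 fun x => (ψ x, χ x) := by
  have : (fun x => (ψ x, χ x)) = fun x =>
      LinearMap.inl k E F (ψ x) + LinearMap.inr k E F (χ x) := by
    ext x <;> simp
  rw [this]
  exact (h.linear _).add (h'.linear _)

theorem CoordsIn.bilinear [FiniteDimensional k E] {ψ : X → E} {χ : X → F} (h : CoordsIn 𝒜 ψ)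
    (h' : CoordsIn 𝒜 χ) (B : E →ₗ[k] F →ₗ[k] W) : CoordsIn 𝒜 fun x => B (ψ x) (χ x) := by
  let b := Module.finBasis k E
  have : (fun x => B (ψ x) (χ x)) = fun x => ∑ i, b.coord i (ψ x) • B (b i) (χ x) := by
    ext x
    conv_lhs => rw [← b.sum_repr (ψ x)]
    simp only [map_sum, map_smul, LinearMap.sum_apply, LinearMap.smul_apply,
      Module.Basis.coord_apply]
  rw [this]
  exact CoordsIn.sum _ fun i _ => (h'.linear (B (b i))).smul (h (b.coord i))

theorem coordsIn_matrix {m n : Type*} [Fintype m] [Fintype n] {ψ : X → Matrix m n k} :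
    CoordsIn 𝒜 ψ ↔ ∀ i j, (fun x => ψ x i j) ∈ 𝒜 := by
  classical
  refine ⟨fun h i j => h (Matrix.entryLinearMap k k i j), fun h => ?_⟩
  refine coordsIn_of_basis (Matrix.stdBasis k m n) fun i => ?_
  simpa [Matrix.stdBasis] using h i.1 i.2

section Matrix

variable {n : Type*} [Fintype n] [DecidableEq n]

theorem CoordsIn.mul {ψ χ : X → Matrix n n k} (h : CoordsIn 𝒜 ψ) (h' : CoordsIn 𝒜 χ) :
    CoordsIn 𝒜 fun x => ψ x * χ x :=
  h.bilinear h' (LinearMap.mul k (Matrix n n k))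

theorem CoordsIn.pow {ψ : X → Matrix n n k} (h : CoordsIn 𝒜 ψ) (m : ℕ) :
    CoordsIn 𝒜 fun x => ψ x ^ m := by
  induction m with
  | zero => simpa using coordsIn_const 1
  | succ m ih => simpa only [pow_succ] using ih.mul h

theorem CoordsIn.det {ψ : X → Matrix n n k} (h : CoordsIn 𝒜 ψ) : (fun x => (ψ x).det) ∈ 𝒜 := by
  have : (fun x => (ψ x).det) = ∑ σ : Equiv.Perm n, (Equiv.Perm.sign σ : ℤ) •
      ∏ i, fun x => ψ x (σ i) i := by
    ext x
    simp [Matrix.det_apply, Units.smul_def]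
  rw [this]
  exact Subalgebra.sum_mem _ fun σ _ => 𝒜.zsmul_mem
    (Subalgebra.prod_mem _ fun i _ => coordsIn_matrix.1 h _ _) _

theorem CoordsIn.inv {ψ : X → Matrix n n k} (h𝒜 : InvClosed 𝒜) (h : CoordsIn 𝒜 ψ)
    (hdet : ∀ x, (ψ x).det ≠ 0) : CoordsIn 𝒜 fun x => (ψ x)⁻¹ := by
  simp only [Matrix.inv_def, Ring.inverse_eq_inv']
  refine CoordsIn.smul (coordsIn_matrix.2 fun i j => ?_) (h𝒜 _ h.det hdet)
  simp only [Matrix.adjugate_apply]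
  refine CoordsIn.det (coordsIn_matrix.2 fun i' j' => ?_)
  by_cases hi : i' = j
  · subst hi
    simp only [Matrix.updateRow_self]
    exact 𝒜.algebraMap_mem ((Pi.single i 1 : n → k) j')
  · simpa [Matrix.updateRow_ne hi] using coordsIn_matrix.1 h i' j'

end Matrix

/-- Cramer's rule: the solution of a linear system whose coefficients lie in an inverse-closed
algebra of functions has coordinates in this algebra. -/
theorem CoordsIn.solve [FiniteDimensional k W] (h𝒜 : InvClosed 𝒜) {T : X → W →ₗ[k] W} {w c : X → W}
    (hT : CoordsIn 𝒜 T) (hc : CoordsIn 𝒜 c) (hdet : ∀ x, LinearMap.det (T x) ≠ 0)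
    (h : ∀ x, T x (w x) = c x) : CoordsIn 𝒜 w := by
  let b := Module.finBasis k W
  have hM : CoordsIn 𝒜 fun x => (LinearMap.toMatrix b b (T x))⁻¹ :=
    (hT.linear (LinearMap.toMatrix b b).toLinearMap).inv h𝒜 fun x => by
      rw [LinearMap.det_toMatrix]; exact hdet x
  have : w = fun x => Matrix.toLin b b (LinearMap.toMatrix b b (T x))⁻¹ (c x) := by
    ext x
    rw [← h x]
    conv_rhs => enter [2]; rw [← Matrix.toLin_toMatrix b b (T x)]
    rw [← LinearMap.comp_apply, ← Matrix.toLin_mul, Matrix.nonsing_inv_mul]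
    · simp
    · rw [LinearMap.det_toMatrix]; exact (hdet x).isUnit
  rw [this]
  exact hM.bilinear hc (Matrix.toLin b b).toLinearMap

/-- The functions on `X` of the form `(p ∘ φ) / (q ∘ φ)` with polynomial functions `p` and `q`
on `E`, where `q ∘ φ` has no zero on `X`. -/
def regularIn (φ : X → E) : Subalgebra k (X → k) where
  carrier := {f | ∃ p ∈ polyFunctionsOn k E, ∃ q ∈ polyFunctionsOn k E,
    ∀ x, q (φ x) ≠ 0 ∧ f x * q (φ x) = p (φ x)}
  mul_mem' := by
    rintro f f' ⟨p, hp, q, hq, h⟩ ⟨p', hp', q', hq', h'⟩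
    refine ⟨p * p', mul_mem hp hp', q * q', mul_mem hq hq',
      fun u => ⟨mul_ne_zero (h u).1 (h' u).1, ?_⟩⟩
    simp only [Pi.mul_apply, ← (h u).2, ← (h' u).2]
    ring
  add_mem' := by
    rintro f f' ⟨p, hp, q, hq, h⟩ ⟨p', hp', q', hq', h'⟩
    refine ⟨p * q' + p' * q, add_mem (mul_mem hp hq') (mul_mem hp' hq), q * q', mul_mem hq hq',
      fun u => ⟨mul_ne_zero (h u).1 (h' u).1, ?_⟩⟩
    simp only [Pi.mul_apply, Pi.add_apply, ← (h u).2, ← (h' u).2]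
    ring
  algebraMap_mem' r := ⟨algebraMap k (E → k) r, (polyFunctionsOn k E).algebraMap_mem r, 1,
    one_mem _, fun u => by simp⟩

theorem polyFunction_comp_mem_regularIn (φ : X → E) {p : E → k} (hp : p ∈ polyFunctionsOn k E) :
    (fun x => p (φ x)) ∈ regularIn (k := k) φ :=
  ⟨p, hp, 1, one_mem _, fun u => by simp⟩

theorem coordsIn_regularIn (φ : X → E) : CoordsIn (regularIn (k := k) φ) φ :=
  fun l => polyFunction_comp_mem_regularIn φ (dual_mem_polyFunctionsOn l)

theorem invClosed_regularIn (φ : X → E) : InvClosed (regularIn (k := k) φ) := by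
  rintro f ⟨p, hp, q, hq, h⟩ hf
  refine ⟨q, hq, p, hp, fun u => ?_⟩
  have := (h u).2
  refine ⟨this ▸ mul_ne_zero (hf u) (h u).1, ?_⟩
  rw [← this, inv_mul_cancel_left₀ (hf u)]

/-- Composites with regular functions stay in an inverse-closed algebra of functions. -/
theorem CoordsIn.regular_comp {Y : Type*} {ψ : X → Y} {φ : Y → E} (h𝒜 : InvClosed 𝒜)
    (h : CoordsIn 𝒜 fun x => φ (ψ x)) {f : Y → k} (hf : f ∈ regularIn (k := k) φ) :
    (fun x => f (ψ x)) ∈ 𝒜 := by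
  obtain ⟨p, hp, q, hq, hpq⟩ := hf
  have : (fun x => f (ψ x)) = (fun x => p (φ (ψ x))) * fun x => (q (φ (ψ x)))⁻¹ := by
    ext x
    simp only [Pi.mul_apply, ← (hpq (ψ x)).2, mul_assoc, mul_inv_cancel₀ (hpq (ψ x)).1, mul_one]
  rw [this]
  exact mul_mem (h.polyFunction_comp hp) (h𝒜 _ (h.polyFunction_comp hq) fun x => (hpq (ψ x)).1)

/-- The functions on `U` of the form `p / q` with polynomial functions `p` and `q`, where `q` has
no zero on `U`. -/
abbrev regularFunctions (k : Type*) [Field k] {F : Type*} [AddCommGroup F] [Module k F]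
    (U : Set F) : Subalgebra k (U → k) :=
  regularIn (Subtype.val : U → F)

/-- A set is Zariski dense if no non-zero polynomial function vanishes on it. -/
def IsPolyDense (k : Type*) [Field k] {F : Type*} [AddCommGroup F] [Module k F]
    (U : Set F) : Prop :=
  ∀ p ∈ polyFunctionsOn k F, (∀ u ∈ U, p u = 0) → p = 0

theorem isPolyDense_univ : IsPolyDense k (Set.univ : Set F) :=
  fun _ _ h => funext fun u => h u trivial

/-- The regular functions on a dense set form a domain. -/
theorem regularFunctions_eq_zero_or_eq_zero [Infinite k] [FiniteDimensional k F]
    {U : Set F} (hU : IsPolyDense k U) {f g : U → k}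
    (hf : f ∈ regularFunctions k U) (hg : g ∈ regularFunctions k U)
    (h : ∀ u, f u * g u = 0) : (∀ u, f u = 0) ∨ ∀ u, g u = 0 := by
  obtain ⟨p, hp, q, hq, h1⟩ := hf
  obtain ⟨p', hp', q', hq', h2⟩ := hg
  have h0 : p * p' = 0 := hU _ (mul_mem hp hp') fun u hu => by
    have e1 := (h1 ⟨u, hu⟩).2
    have e2 := (h2 ⟨u, hu⟩).2
    simp only at e1 e2
    rw [Pi.mul_apply, ← e1, ← e2, mul_mul_mul_comm, h, zero_mul]
  rcases polyFunctionsOn_eq_zero_or_eq_zero hp hp' h0 with h | h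
  · exact .inl fun u => (mul_eq_zero.1 ((h1 u).2.trans (congrFun h u))).resolve_right (h1 u).1
  · exact .inr fun u => (mul_eq_zero.1 ((h2 u).2.trans (congrFun h u))).resolve_right (h2 u).1

/-- The non-vanishing locus of a non-zero regular function on a dense set is dense. -/
theorem IsPolyDense.ne_zero [Infinite k] [FiniteDimensional k F]
    {U : Set F} (hU : IsPolyDense k U) {f : U → k}
    (hf : f ∈ regularFunctions k U) (h : ∃ u, f u ≠ 0) :
    IsPolyDense k {u | ∃ hu : u ∈ U, f ⟨u, hu⟩ ≠ 0} := by
  intro p hp h0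
  refine hU p hp fun u hu => ?_
  have hmul : ∀ u : U, f u * p u = 0 := fun u => by
    by_cases hfu : f u = 0
    · simp [hfu]
    · simp [h0 u ⟨u.2, hfu⟩]
  rcases regularFunctions_eq_zero_or_eq_zero hU hf (polyFunction_comp_mem_regularIn _ hp)
    hmul with h' | h'
  · obtain ⟨u, hu⟩ := h
    exact absurd (h' u) hu
  · exact h' ⟨u, hu⟩

theorem isPolyDense_ne_zero [Infinite k] [FiniteDimensional k F] {f : F → k}
    (hf : f ∈ polyFunctionsOn k F) (h : ∃ u, f u ≠ 0) :
    IsPolyDense k {u | f u ≠ 0} := by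
  obtain ⟨u, hu⟩ := h
  have := isPolyDense_univ.ne_zero
    (polyFunction_comp_mem_regularIn (fun u : (Set.univ : Set F) => (u : F)) hf)
    ⟨⟨u, trivial⟩, hu⟩
  simpa using this

theorem IsPolyDense.prod {U : Set F} {V : Set W} (hU : IsPolyDense k U)
    (hV : IsPolyDense k V) : IsPolyDense k (U ×ˢ V) := by
  intro p hp h
  ext ⟨u, w⟩
  have key : ∀ u ∈ U, ∀ w, p (u, w) = 0 := fun u hu w => congrFun (hV (fun w => p (u, w))
    (CoordsIn.polyFunction_comp (𝒜 := polyFunctionsOn k W) (ψ := fun w => (u, w))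
      ((coordsIn_const u).prodMk fun φ => dual_mem_polyFunctionsOn φ) hp)
    fun w hw => h _ ⟨hu, hw⟩) w
  exact congrFun (hU (fun u => p (u, w)) (CoordsIn.polyFunction_comp (𝒜 := polyFunctionsOn k F)
    (ψ := fun u => (u, w))
    (CoordsIn.prodMk (fun φ => dual_mem_polyFunctionsOn φ) (coordsIn_const w))
    hp) fun u hu => key u hu w) u

end Regular

/-! ### Dimension of rationally parametrized sets -/

/-- A quotient of elements of `R` is algebraic over `R`. -/
theorem isAlgebraic_of_mul_algebraMap_eq {R B : Type*} [CommRing R] [CommRing B] [Algebra R B]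
    {f : B} {p q : R} (hq : q ≠ 0) (hf : f * algebraMap R B q = algebraMap R B p) :
    IsAlgebraic R f := by
  refine ⟨Polynomial.C q * Polynomial.X - Polynomial.C p, fun h0 => hq ?_, ?_⟩
  · simpa using congrArg (fun P => Polynomial.coeff P 1) h0
  · rw [map_sub, map_mul, Polynomial.aeval_C, Polynomial.aeval_C, Polynomial.aeval_X, ← hf]
    ring

section Chart

variable (k : Type*) [Field k] {E F W : Type*} [AddCommGroup E] [Module k E]
  [AddCommGroup F] [Module k F]

/-- `φ` is a rational parametrization of a dense part of `S` by a dense subset `U` of the vector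
space `F`: both `φ` and its inverse on the image are given by rational functions whose denominators
do not vanish. -/
structure IsChart (U : Set F) (φ : U → E) (S : Set E) : Prop where
  dense : IsPolyDense k U
  regular : CoordsIn (regularFunctions k U) φ
  regular_inv : CoordsIn (regularIn (k := k) φ) (Subtype.val : U → F)
  mem : ∀ u, φ u ∈ S
  subset_closure : S ⊆ zariskiClosure k (Set.range φ)

variable {k}

theorem IsPolyDense.nonempty {U : Set F} (hU : IsPolyDense k U) : U.Nonempty := by
  by_contra h
  rw [Set.not_nonempty_iff_eq_empty] at h
  subst h
  exact one_ne_zero (congrFun (hU 1 (one_mem _) (by simp)) 0)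

theorem IsChart.closure {U : Set F} {φ : U → E} {S : Set E} (h : IsChart k U φ S) :
    IsChart k U φ (zariskiClosure k S) where
  dense := h.dense
  regular := h.regular
  regular_inv := h.regular_inv
  mem u := subset_zariskiClosure S (h.mem u)
  subset_closure := @closure_minimal E (zariskiTopology k E) _ _ h.subset_closure
    (@isClosed_closure E (zariskiTopology k E) _)

theorem mem_polyFunctions_iff {S : Set E} {f : S → k} :
    f ∈ polyFunctions k S ↔ ∃ g ∈ polyFunctionsOn k E, f = fun v : S => g v := by
  constructor
  · intro hf
    induction hf using Algebra.adjoin_induction with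
    | mem f hf => obtain ⟨φ, rfl⟩ := hf; exact ⟨_, dual_mem_polyFunctionsOn φ, rfl⟩
    | algebraMap r => exact ⟨_, (polyFunctionsOn k E).algebraMap_mem r, rfl⟩
    | add f g _ _ hf hg =>
      obtain ⟨f', hf', rfl⟩ := hf
      obtain ⟨g', hg', rfl⟩ := hg
      exact ⟨f' + g', add_mem hf' hg', rfl⟩
    | mul f g _ _ hf hg =>
      obtain ⟨f', hf', rfl⟩ := hf
      obtain ⟨g', hg', rfl⟩ := hg
      exact ⟨f' * g', mul_mem hf' hg', rfl⟩
  · rintro ⟨g, hg, rfl⟩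
    exact CoordsIn.polyFunction_comp (fun φ => Algebra.subset_adjoin (Set.mem_range_self φ)) hg

theorem polyFunctions_eq_adjoin {ι : Type*} [Finite ι] (b : Module.Basis ι k E) (S : Set E) :
    polyFunctions k S = Algebra.adjoin k (Set.range fun i (v : S) => b.coord i (v : E)) := by
  have := Fintype.ofFinite ι
  apply le_antisymm
  · refine Algebra.adjoin_le ?_
    rintro _ ⟨φ, rfl⟩
    have h : CoordsIn (Algebra.adjoin k (Set.range fun i (v : S) => b.coord i (v : E)))
        fun v : S => (v : E) :=
      coordsIn_of_basis b fun i => Algebra.subset_adjoin (Set.mem_range_self i)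
    exact h φ
  · refine Algebra.adjoin_mono ?_
    rintro _ ⟨i, rfl⟩
    exact Set.mem_range_self (b.coord i)

instance [FiniteDimensional k E] (S : Set E) : Algebra.FiniteType k (polyFunctions k S) := by
  rw [polyFunctions_eq_adjoin (Module.finBasis k E)]
  exact (Subalgebra.fg_iff_finiteType _).1
    ((Subalgebra.fg_def).2 ⟨_, Set.finite_range _, rfl⟩)

theorem IsChart.irreducible [Infinite k] [FiniteDimensional k F] {U : Set F} {φ : U → E}
    {S : Set E} (h : IsChart k U φ S) : ZariskiIrreducible k S := by
  rw [zariskiIrreducible_iff]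
  obtain ⟨u, hu⟩ := h.dense.nonempty
  refine ⟨⟨_, h.mem ⟨u, hu⟩⟩, fun f hf g hg hfg => ?_⟩
  have aux : ∀ f ∈ polyFunctionsOn k E, (∀ u, f (φ u) = 0) → ∀ v ∈ S, f v = 0 := fun f hf h0 v hv =>
    mem_zariskiClosure_iff.1 (h.subset_closure hv) f hf (by rintro _ ⟨u, rfl⟩; exact h0 u)
  exact (regularFunctions_eq_zero_or_eq_zero h.dense (h.regular.polyFunction_comp hf)
    (h.regular.polyFunction_comp hg) fun u => hfg _ (h.mem u)).imp (aux f hf) (aux g hg)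

/-- A set with a rational parametrization has the dimension of the parameter space: its coordinate
ring and the polynomial ring on the parameter space have the same field of fractions. -/
theorem IsChart.zariskiDim_eq [Infinite k] [FiniteDimensional k E] [FiniteDimensional k F]
    {U : Set F} {φ : U → E} {S : Set E} (h : IsChart k U φ S) :
    zariskiDim k S = Module.finrank k F := by
  let A := polyFunctions k S
  let B := regularFunctions k U
  -- the pullback of functions along `φ` is injective since the image is dense in `S`
  have hmem : ∀ f : A, (fun u => f.1 ⟨φ u, h.mem u⟩) ∈ B := by
    rintro ⟨f, hf⟩
    obtain ⟨g, hg, rfl⟩ := mem_polyFunctions_iff.1 hf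
    exact h.regular.polyFunction_comp hg
  let r : A →ₐ[k] B :=
    { toFun := fun f => ⟨fun u => f.1 ⟨φ u, h.mem u⟩, hmem f⟩
      map_one' := rfl
      map_mul' := fun _ _ => rfl
      map_zero' := rfl
      map_add' := fun _ _ => rfl
      commutes' := fun _ => rfl }
  have hr : Function.Injective r := by
    rw [injective_iff_map_eq_zero]
    rintro ⟨f, hf⟩ h0
    obtain ⟨g, hg, rfl⟩ := mem_polyFunctions_iff.1 hf
    ext ⟨v, hv⟩
    refine mem_zariskiClosure_iff.1 (h.subset_closure hv) g hg ?_
    rintro _ ⟨u, rfl⟩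
    exact congrFun (congrArg Subtype.val h0) u
  have : Nontrivial B := by
    obtain ⟨u, hu⟩ := h.dense.nonempty
    exact ⟨0, 1, fun h01 => zero_ne_one (congrFun (congrArg Subtype.val h01) ⟨u, hu⟩)⟩
  have : NoZeroDivisors B := ⟨fun {f g} hfg => by
    refine (regularFunctions_eq_zero_or_eq_zero h.dense f.2 g.2
      (congrFun (congrArg Subtype.val hfg))).imp (fun h => ?_) fun h => ?_ <;>
    exact Subtype.ext (funext h)⟩
  have : IsDomain B := NoZeroDivisors.to_isDomain B
  have : IsDomain A := hr.isDomain r.toRingHom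
  let _ := r.toRingHom.toAlgebra
  have : FaithfulSMul A B := (faithfulSMul_iff_algebraMap_injective _ _).2 hr
  have : IsScalarTower k A B := IsScalarTower.of_algebraMap_eq fun _ => rfl
  let b := Module.finBasis k F
  let x : Fin (Module.finrank k F) → B := fun i =>
    ⟨fun u => b.coord i u, coordsIn_regularIn Subtype.val (b.coord i)⟩
  have hx0 : ∀ p, MvPolynomial.aeval (R := k) x p = (⟨fun u => MvPolynomial.aeval (R := k)
      (fun i v => b.coord i v) p (u : F), polyFunction_comp_mem_regularIn _
        ((mem_polyFunctionsOn_iff b).2 ⟨p, rfl⟩)⟩ : B) := by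
    intro p
    induction p using MvPolynomial.induction_on with
    | C a => rw [MvPolynomial.algHom_C]; ext; simp
    | add p q hp hq => rw [map_add, hp, hq]; ext; simp only [map_add]; rfl
    | mul_X p i hp => rw [map_mul, hp]; ext; simp only [map_mul, MvPolynomial.aeval_X]; rfl
  have hind : AlgebraicIndependent k x := by
    rw [AlgebraicIndependent, injective_iff_map_eq_zero]
    intro p hp
    rw [hx0] at hp
    refine aeval_coord_injective b ?_
    rw [map_zero]
    exact h.dense _ ((mem_polyFunctionsOn_iff b).2 ⟨p, rfl⟩)
      fun u hu => congrFun (congrArg Subtype.val hp) ⟨u, hu⟩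
  have hmemx : ∀ p (hp : p ∈ polyFunctionsOn k F),
      (⟨fun u => p u, polyFunction_comp_mem_regularIn _ hp⟩ : B) ∈
        Algebra.adjoin k (Set.range x) := by
    intro p hp
    obtain ⟨P, rfl⟩ := (mem_polyFunctionsOn_iff b).1 hp
    rw [← hx0, Algebra.adjoin_range_eq_range_aeval]
    exact ⟨P, rfl⟩
  have hx : IsTranscendenceBasis k x := by
    rw [isTranscendenceBasis_iff_algebraicIndependent_isAlgebraic]
    refine ⟨hind, ⟨?_⟩⟩
    rintro ⟨f, p, hp, q, hq, hpq⟩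
    refine isAlgebraic_of_mul_algebraMap_eq (p := ⟨_, hmemx p hp⟩) (q := ⟨_, hmemx q hq⟩)
      (fun h0 => ?_) ?_
    · obtain ⟨u, hu⟩ := h.dense.nonempty
      exact (hpq ⟨u, hu⟩).1 (congrFun (congrArg (Subtype.val ∘ Subtype.val) h0) ⟨u, hu⟩)
    · exact Subtype.ext (funext fun u => (hpq u).2)
  have : Algebra.IsAlgebraic A B := by
    rw [hx.isAlgebraic_iff]
    intro i
    obtain ⟨p, hp, q, hq, hpq⟩ := h.regular_inv (b.coord i)
    refine isAlgebraic_of_mul_algebraMap_eq (R := A)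
      (p := ⟨_, mem_polyFunctions_iff.2 ⟨p, hp, rfl⟩⟩)
      (q := ⟨_, mem_polyFunctions_iff.2 ⟨q, hq, rfl⟩⟩) (fun h0 => ?_) ?_
    · obtain ⟨u, hu⟩ := h.dense.nonempty
      exact (hpq ⟨u, hu⟩).1 (congrFun (congrArg Subtype.val h0) ⟨φ ⟨u, hu⟩, h.mem _⟩)
    · exact Subtype.ext (funext fun u => (hpq u).2)
  exact ringKrullDim_eq_of_isTranscendenceBasis hx

/-- A linear subspace is parametrized by itself. -/
theorem isChart_submodule [FiniteDimensional k E] (N : Submodule k E) :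
    IsChart k (Set.univ : Set N) (fun u => (u : E)) (N : Set E) where
  dense := isPolyDense_univ
  regular := (coordsIn_regularIn _).linear N.subtype
  regular_inv := by
    obtain ⟨π, hπ⟩ := N.subtype.exists_leftInverse_of_injective N.ker_subtype
    have : (fun u : (Set.univ : Set N) => (u : N)) =
        fun u : (Set.univ : Set N) => π ((u : N) : E) := by
      ext u
      exact congrArg Subtype.val (LinearMap.congr_fun hπ u.1).symm
    change CoordsIn _ fun u : (Set.univ : Set N) => (u : N)
    rw [this]
    exact (coordsIn_regularIn _).linear π
  mem u := u.1.2
  subset_closure v hv := subset_zariskiClosure _ ⟨⟨⟨v, hv⟩, trivial⟩, rfl⟩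

/-- Restriction of polynomial functions to a subset. -/
def polyFunctionsRestrict {S T : Set E} (h : S ⊆ T) :
    polyFunctions k T →ₐ[k] polyFunctions k S where
  toFun f := ⟨fun v => f.1 ⟨v, h v.2⟩, by
    obtain ⟨g, hg, hf⟩ := mem_polyFunctions_iff.1 f.2
    exact mem_polyFunctions_iff.2 ⟨g, hg, by rw [hf]⟩⟩
  map_one' := rfl
  map_mul' _ _ := rfl
  map_zero' := rfl
  map_add' _ _ := rfl
  commutes' _ := rfl

theorem polyFunctionsRestrict_surjective {S T : Set E} (h : S ⊆ T) :
    Function.Surjective (polyFunctionsRestrict (k := k) h).toRingHom := by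
  rintro ⟨f, hf⟩
  obtain ⟨g, hg, rfl⟩ := mem_polyFunctions_iff.1 hf
  exact ⟨⟨_, mem_polyFunctions_iff.2 ⟨g, hg, rfl⟩⟩, rfl⟩

theorem zariskiDim_mono {S T : Set E} (h : S ⊆ T) : zariskiDim k S ≤ zariskiDim k T :=
  ringKrullDim_le_of_surjective _ (polyFunctionsRestrict_surjective h)

/-- A subset of the same finite dimension is dense in an irreducible set. -/
theorem subset_zariskiClosure_of_zariskiDim_eq {S T : Set E} (h : S ⊆ T)
    (hT : ZariskiIrreducible k T) {n : ℕ}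
    (hS : zariskiDim k S = n) (hTn : zariskiDim k T = n) : T ⊆ zariskiClosure k S := by
  intro v hv
  rw [mem_zariskiClosure_iff]
  intro f hf hf0
  by_contra hne
  have hreg : (⟨fun v : T => f v, mem_polyFunctions_iff.2 ⟨f, hf, rfl⟩⟩ : polyFunctions k T) ∈
      nonZeroDivisors (polyFunctions k T) := by
    rw [mem_nonZeroDivisors_iff_right]
    rintro ⟨g, hg⟩ h0
    obtain ⟨g, hg', rfl⟩ := mem_polyFunctions_iff.1 hg
    rcases (zariskiIrreducible_iff.1 hT).2 g hg' f hf
      fun w hw => congrFun (congrArg Subtype.val h0) ⟨w, hw⟩ with h' | h'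
    · exact Subtype.ext (funext fun w => h' w w.2)
    · exact absurd (h' v hv) hne
  have := ringKrullDim_succ_le_of_surjective _ (polyFunctionsRestrict_surjective h) hreg
    (show (polyFunctionsRestrict h).toRingHom _ = 0 from
      Subtype.ext (funext fun v : S => hf0 v v.2))
  change zariskiDim k S + 1 ≤ zariskiDim k T at this
  rw [hS, hTn] at this
  exact absurd this (by norm_cast; omega)

end Chart

/-! ### The saturation of a subset of a centralizer -/

section Saturation

variable {k : Type*} [Field k] {n : ℕ}

theorem mem_glCentralizer {x y : Matrix (Fin n) (Fin n) k} :
    y ∈ glCentralizer x ↔ x * y = y * x := by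
  change ⁅x, y⁆ = 0 ↔ _
  rw [Ring.lie_def, sub_eq_zero]

theorem mem_conjOrbitPairs {x : Matrix (Fin n) (Fin n) k} {V : Set (Matrix (Fin n) (Fin n) k)}
    {z : Matrix (Fin n) (Fin n) k × Matrix (Fin n) (Fin n) k} : z ∈ conjOrbitPairs x V ↔
      ∃ s : Matrix (Fin n) (Fin n) k, s.det ≠ 0 ∧ ∃ v ∈ V, z = (s * x * s⁻¹, s * v * s⁻¹) := by
  constructor
  · rintro ⟨g, v, hv, rfl⟩
    exact ⟨g, g.det_ne_zero, v, hv, by rw [Matrix.coe_units_inv]⟩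
  · rintro ⟨s, hs, v, hv, rfl⟩
    exact ⟨Matrix.GeneralLinearGroup.mkOfDetNeZero s hs, v, hv, by
      rw [Matrix.coe_units_inv]; rfl⟩

theorem mem_conjOrbit {x y : Matrix (Fin n) (Fin n) k} : y ∈ conjOrbit x ↔
    ∃ s : Matrix (Fin n) (Fin n) k, s.det ≠ 0 ∧ y = s * x * s⁻¹ := by
  constructor
  · rintro ⟨g, rfl⟩
    exact ⟨g, g.det_ne_zero, by rw [Matrix.coe_units_inv]⟩
  · rintro ⟨s, hs, rfl⟩
    exact ⟨Matrix.GeneralLinearGroup.mkOfDetNeZero s hs, by rw [Matrix.coe_units_inv]; rfl⟩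

variable {X E F W : Type*} [AddCommGroup E] [Module k E] [AddCommGroup F] [Module k F]
  [AddCommGroup W] [Module k W]

theorem CoordsIn.linearMap_det {𝒜 : Subalgebra k (X → k)} [FiniteDimensional k W]
    {T : X → W →ₗ[k] W} (hT : CoordsIn 𝒜 T) : (fun x => LinearMap.det (T x)) ∈ 𝒜 := by
  let b := Module.finBasis k W
  have h := (hT.linear (LinearMap.toMatrix b b).toLinearMap).det
  have e : (fun x => LinearMap.det (T x)) =
      fun x => ((LinearMap.toMatrix b b).toLinearMap (T x)).det :=
    funext fun x => (LinearMap.det_toMatrix b (T x)).symm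
  rwa [e]

theorem coordsIn_id : CoordsIn (polyFunctionsOn k E) fun v : E => v :=
  fun φ => dual_mem_polyFunctionsOn φ

theorem CoordsIn.const_sub_linear {𝒜 : Subalgebra k (X → k)} {ψ : X → E} (h : CoordsIn 𝒜 ψ)
    (T₀ : W →ₗ[k] W) (T₁ : E →ₗ[k] W →ₗ[k] W) : CoordsIn 𝒜 fun x => T₀ - T₁ (ψ x) :=
  (coordsIn_const T₀).sub (CoordsIn.linear (F := W →ₗ[k] W) h T₁)

/-- A regular map that sends a dense set into a closed set sends its whole domain there. -/
theorem mem_zariskiClosure_of_isPolyDense {U V : Set F}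
    (hV : IsPolyDense k V) (hVU : V ⊆ U) {ψ : F → E}
    (hψ : CoordsIn (regularFunctions k U) fun u : U => ψ u)
    {S : Set E} (hVS : ∀ v ∈ V, ψ v ∈ zariskiClosure k S) {u : F} (hu : u ∈ U) :
    ψ u ∈ zariskiClosure k S := by
  rw [mem_zariskiClosure_iff]
  intro f hf h0
  obtain ⟨p, hp, q, hq, hpq⟩ := hψ.polyFunction_comp hf
  have : p = 0 := hV p hp fun v hv => by
    rw [← (hpq ⟨v, hVU hv⟩).2]
    exact mul_eq_zero_of_left (mem_zariskiClosure_iff.1 (hVS v hv) f hf h0) _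
  have h := hpq ⟨u, hu⟩
  rw [this] at h
  exact (mul_eq_zero.1 h.2).resolve_right h.1

theorem CoordsIn.conj {𝒜 : Subalgebra k (X → k)} (h𝒜 : InvClosed 𝒜)
    {s v : X → Matrix (Fin n) (Fin n) k} (hdet : ∀ x, (s x).det ≠ 0) (hs : CoordsIn 𝒜 s)
    (hv : CoordsIn 𝒜 v) : CoordsIn 𝒜 fun x => s x * v x * (s x)⁻¹ :=
  (hs.mul hv).mul (hs.inv h𝒜 hdet)

/-- For a generic invertible matrix `g` there is an invertible `w` in the centralizer of `e` such
that `g * w` lies in `1 + M`, where `M` is a complement of the centralizer. -/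
theorem isPolyDense_exists_mul_sub_one_mem [Infinite k] {e : Matrix (Fin n) (Fin n) k}
    {M : Submodule k (Matrix (Fin n) (Fin n) k)} (hM : IsCompl (glCentralizer e) M)
    {f : Matrix (Fin n) (Fin n) k → k} (hf : (fun g : {g : Matrix (Fin n) (Fin n) k | g.det ≠ 0} =>
      f g) ∈ regularFunctions k {g : Matrix (Fin n) (Fin n) k | g.det ≠ 0}) (hf1 : f 1 ≠ 0) :
    IsPolyDense k {g : Matrix (Fin n) (Fin n) k | g.det ≠ 0 ∧ f g ≠ 0 ∧
      ∃ w : Matrix (Fin n) (Fin n) k, w.det ≠ 0 ∧ e * w = w * e ∧ g * w - 1 ∈ M} := by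
  -- `P` is the projection to the centralizer along `M`
  let Z := glCentralizer e
  let P : Matrix (Fin n) (Fin n) k →ₗ[k] Z := Submodule.projectionOnto Z M hM
  let S : Matrix (Fin n) (Fin n) k →ₗ[k] Z →ₗ[k] Z :=
    LinearMap.mk₂ k (fun g w => P (g * w)) (by intros; simp [add_mul]) (by intros; simp)
      (by intros; simp [mul_add]) (by intros; simp)
  have hS : ∀ g w, S g w = P (g * w) := fun _ _ => rfl
  have hS1 : S 1 = LinearMap.id := by
    ext w : 1
    rw [hS, one_mul]
    exact Submodule.projectionOnto_apply_left hM w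
  have h1Z : (1 : Matrix (Fin n) (Fin n) k) ∈ Z := mem_glCentralizer.2 (by simp)
  let G₁ : Set (Matrix (Fin n) (Fin n) k) := {g | g.det * LinearMap.det (S g) ≠ 0}
  have hSdet : (fun g => LinearMap.det (S g)) ∈ polyFunctionsOn k (Matrix (Fin n) (Fin n) k) :=
    (coordsIn_id.linear S).linearMap_det
  have hG₁ : IsPolyDense k G₁ :=
    isPolyDense_ne_zero (mul_mem coordsIn_id.det hSdet) ⟨1, by simp [hS1]⟩
  have hw : ∀ g : G₁, ∃ w : Z, S g w = P 1 := fun g => by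
    have : IsUnit (S g) := (LinearMap.isUnit_iff_isUnit_det _).2
      (right_ne_zero_of_mul g.2).isUnit
    exact ((Module.End.isUnit_iff _).1 this).2 _
  choose w hw using hw
  have hid : CoordsIn (regularFunctions k G₁) fun g : G₁ => (g : Matrix (Fin n) (Fin n) k) :=
    coordsIn_regularIn _
  have hwreg : CoordsIn (regularFunctions k G₁) w :=
    CoordsIn.solve (invClosed_regularIn _) (hid.linear S) (coordsIn_const (P 1))
      (fun g => right_ne_zero_of_mul g.2) hw
  have hG₁det : ∀ g : G₁, (g : Matrix (Fin n) (Fin n) k).det ≠ 0 :=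
    fun g => left_ne_zero_of_mul g.2
  have hfG : (fun g : G₁ => f g) ∈ regularFunctions k G₁ :=
    CoordsIn.regular_comp (φ := Subtype.val) (f := fun g : {g : Matrix (Fin n) (Fin n) k |
      g.det ≠ 0} => f g) (ψ := fun g : G₁ => ⟨g, hG₁det g⟩) (invClosed_regularIn _) hid hf
  have h1G : (1 : Matrix (Fin n) (Fin n) k) ∈ G₁ := by simp [G₁, hS1]
  have hw1 : (w ⟨1, h1G⟩ : Matrix (Fin n) (Fin n) k) = 1 := by
    have h1 := hw ⟨1, h1G⟩
    change S 1 _ = _ at h1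
    rw [hS1, LinearMap.id_apply] at h1
    rw [h1]
    exact congrArg Subtype.val (Submodule.projectionOnto_apply_of_mem_left hM h1Z)
  have hG₂ := hG₁.ne_zero (f := (fun g : G₁ => (w g : Matrix (Fin n) (Fin n) k).det) *
      fun g : G₁ => f g) (mul_mem (hwreg.linear Z.subtype).det hfG)
    ⟨⟨1, h1G⟩, by simp [hw1, hf1]⟩
  intro p hp h0
  refine hG₂ p hp fun g ⟨hg, hgw⟩ => h0 g ⟨hG₁det ⟨g, hg⟩, right_ne_zero_of_mul hgw,
    w ⟨g, hg⟩, left_ne_zero_of_mul hgw, mem_glCentralizer.1 (w ⟨g, hg⟩).2, ?_⟩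
  rw [← Submodule.projectionOnto_apply_eq_zero_iff hM, map_sub, sub_eq_zero]
  exact hw ⟨g, hg⟩

/-- Let `V` be a set of matrices that is stable under conjugation by the centralizer of `e` in
`GL(n, k)`. A rational parametrization of `V` extends to one of `G · (e, V)`: on a dense set the
group element can be normalized to have the form `1 + m`, where `m` lies in a fixed linear
complement `M` of the centralizer of `e` in `gl(n, k)`; then `m` is the solution of a linear
system. -/
theorem exists_isChart_conjOrbitPairs [Infinite k] [FiniteDimensional k F]
    (e : Matrix (Fin n) (Fin n) k)
    {V : Set (Matrix (Fin n) (Fin n) k)}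
    (hV : ∀ w : Matrix (Fin n) (Fin n) k, w.det ≠ 0 → e * w = w * e → ∀ v ∈ V, w⁻¹ * v * w ∈ V)
    {U : Set F} {φ : U → Matrix (Fin n) (Fin n) k} (hφ : IsChart k U φ V)
    {M : Submodule k (Matrix (Fin n) (Fin n) k)} (hM : IsCompl (glCentralizer e) M) :
    ∃ (U' : Set (M × F)) (φ' : U' → Matrix (Fin n) (Fin n) k × Matrix (Fin n) (Fin n) k),
      IsChart k U' φ' (conjOrbitPairs e V) := by
  -- `Q` is a left inverse of `m ↦ m * e - e * m` on `M`
  obtain ⟨Q, hQ⟩ : ∃ Q : Matrix (Fin n) (Fin n) k →ₗ[k] M, ∀ m : M, Q (m * e - e * m) = m := by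
    let ad : M →ₗ[k] Matrix (Fin n) (Fin n) k :=
      (LinearMap.mulRight k e - LinearMap.mulLeft k e) ∘ₗ M.subtype
    have had : LinearMap.ker ad = ⊥ := by
      rw [LinearMap.ker_eq_bot']
      intro m hm
      have : (m : Matrix (Fin n) (Fin n) k) ∈ glCentralizer e ⊓ M :=
        ⟨mem_glCentralizer.2 (sub_eq_zero.1 hm).symm, m.2⟩
      rw [hM.inf_eq_bot] at this
      exact Subtype.ext this
    obtain ⟨Q, hQ⟩ := ad.exists_leftInverse_of_injective had
    exact ⟨Q, fun m => LinearMap.congr_fun hQ m⟩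
  let T₀ : M →ₗ[k] M := Q ∘ₗ LinearMap.mulRight k e ∘ₗ M.subtype
  let T₁ : Matrix (Fin n) (Fin n) k →ₗ[k] M →ₗ[k] M :=
    LinearMap.mk₂ k (fun x m => Q (x * m)) (by intros; simp [add_mul]) (by intros; simp)
      (by intros; simp [mul_add]) (by intros; simp)
  have hT₁ : ∀ x m, T₁ x m = Q (x * m) := fun _ _ => rfl
  have hT₀ : ∀ m, T₀ m = Q (m * e) := fun _ => rfl
  have hTe : T₀ - T₁ e = LinearMap.id := by
    ext m : 1
    rw [LinearMap.sub_apply, hT₀, hT₁, ← map_sub, hQ]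
    rfl
  -- `m` can be recovered from `x = (1 + m) * e * (1 + m)⁻¹`
  have hsolve : ∀ (x : Matrix (Fin n) (Fin n) k) (m : M), x * (1 + m) = (1 + m) * e →
      (T₀ - T₁ x) m = Q (x - e) := by
    intro x m h
    rw [LinearMap.sub_apply, hT₀, hT₁, ← map_sub]
    congr 1
    rw [mul_add, add_mul, mul_one, one_mul] at h
    rw [sub_eq_sub_iff_add_eq_add, add_comm, ← h, add_comm]
  let U₀ : Set (M × F) := {m : M | (1 + m : Matrix (Fin n) (Fin n) k).det ≠ 0} ×ˢ U
  have h1 : CoordsIn (polyFunctionsOn k M) fun m : M => (1 + m : Matrix (Fin n) (Fin n) k) :=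
    (coordsIn_const 1).add (coordsIn_id.linear M.subtype)
  have hU₀ : IsPolyDense k U₀ :=
    (isPolyDense_ne_zero h1.det ⟨0, by simp⟩).prod hφ.dense
  have hs₀ : ∀ {Y : Type _} {𝒜 : Subalgebra k (Y → k)} {m : Y → M}, CoordsIn 𝒜 m →
      CoordsIn 𝒜 fun y => (1 + m y : Matrix (Fin n) (Fin n) k) :=
    fun h => (coordsIn_const 1).add (h.linear M.subtype)
  let x₀ : M × F → Matrix (Fin n) (Fin n) k :=
    fun z => (1 + (z.1 : Matrix (Fin n) (Fin n) k)) * e * (1 + (z.1 : Matrix (Fin n) (Fin n) k))⁻¹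
  let U' : Set (M × F) := {z | ∃ hz : z ∈ U₀,
    (fun z : U₀ => LinearMap.det (T₀ - T₁ (x₀ z))) ⟨z, hz⟩ ≠ 0}
  have hU' : IsPolyDense k U' := by
    obtain ⟨u, hu⟩ := hφ.dense.nonempty
    refine hU₀.ne_zero (f := fun z : U₀ => LinearMap.det (T₀ - T₁ (x₀ z))) ?_
      ⟨⟨(0, u), by simp, hu⟩, ?_⟩
    · exact ((CoordsIn.conj (invClosed_regularIn _) (fun z : U₀ => z.2.1)
        (hs₀ ((coordsIn_regularIn _).linear (LinearMap.fst k M F)))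
        (coordsIn_const e)).const_sub_linear T₀ T₁).linearMap_det
    · simp [x₀, hTe]
  let s : U' → Matrix (Fin n) (Fin n) k := fun z => 1 + (z.1.1 : Matrix (Fin n) (Fin n) k)
  have hsdet : ∀ z, (s z).det ≠ 0 := fun z => z.2.1.1
  have hsu : ∀ z, IsUnit (s z).det := fun z => (hsdet z).isUnit
  let v : U' → Matrix (Fin n) (Fin n) k := fun z => φ ⟨z.1.2, z.2.1.2⟩
  let φ' : U' → Matrix (Fin n) (Fin n) k × Matrix (Fin n) (Fin n) k :=
    fun z => (s z * e * (s z)⁻¹, s z * v z * (s z)⁻¹)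
  refine ⟨U', φ', hU', ?_, ?_, fun z => mem_conjOrbitPairs.2 ⟨s z, hsdet z, v z, hφ.mem _, rfl⟩, ?_⟩
  · have hz : CoordsIn (regularFunctions k U') (Subtype.val : U' → M × F) := coordsIn_regularIn _
    have hs : CoordsIn (regularFunctions k U') s := hs₀ (hz.linear (LinearMap.fst k M F))
    have hv : CoordsIn (regularFunctions k U') v := fun l =>
      CoordsIn.regular_comp (ψ := fun z : U' => (⟨z.1.2, z.2.1.2⟩ : U)) (φ := Subtype.val)
        (invClosed_regularIn _) (hz.linear (LinearMap.snd k M F)) (hφ.regular l)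
    exact (CoordsIn.conj (invClosed_regularIn _) hsdet hs (coordsIn_const e)).prodMk
      (CoordsIn.conj (invClosed_regularIn _) hsdet hs hv)
  · have h𝒜 : InvClosed (regularIn (k := k) φ') := invClosed_regularIn _
    have hφ' : CoordsIn (regularIn (k := k) φ') φ' := coordsIn_regularIn _
    have hx : CoordsIn (regularIn (k := k) φ') fun z => s z * e * (s z)⁻¹ :=
      hφ'.linear (LinearMap.fst k _ _)
    have hy : CoordsIn (regularIn (k := k) φ') fun z => s z * v z * (s z)⁻¹ :=
      hφ'.linear (LinearMap.snd k _ _)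
    have hm : CoordsIn (regularIn (k := k) φ') fun z : U' => z.1.1 :=
      CoordsIn.solve h𝒜 (hx.const_sub_linear T₀ T₁) ((hx.sub (coordsIn_const e)).linear Q)
        (fun z => z.2.2) fun z =>
        hsolve _ _ (Matrix.nonsing_inv_mul_cancel_right _ _ (hsu z))
    have hs : CoordsIn (regularIn (k := k) φ') s := hs₀ hm
    have hv : CoordsIn (regularIn (k := k) φ') v := by
      have : v = fun z => (s z)⁻¹ * (s z * v z * (s z)⁻¹) * s z := by
        ext z : 1
        rw [mul_assoc, Matrix.nonsing_inv_mul_cancel_right _ _ (hsu z),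
          Matrix.nonsing_inv_mul_cancel_left _ _ (hsu z)]
      rw [this]
      exact ((hs.inv h𝒜 hsdet).mul hy).mul hs
    have hu : CoordsIn (regularIn (k := k) φ') fun z : U' => z.1.2 := fun l =>
      CoordsIn.regular_comp (ψ := fun z : U' => (⟨z.1.2, z.2.1.2⟩ : U)) (φ := φ) h𝒜 hv
        (hφ.regular_inv l)
    exact hm.prodMk hu
  · -- pairs normalized by an element `1 + m`, with `v` arbitrary
    have step : ∀ (m : M) (v : Matrix (Fin n) (Fin n) k), v ∈ V →
        (1 + m : Matrix (Fin n) (Fin n) k).det ≠ 0 →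
        LinearMap.det (T₀ - T₁ ((1 + m) * e * (1 + m : Matrix (Fin n) (Fin n) k)⁻¹)) ≠ 0 →
        ((1 + m) * e * (1 + m : Matrix (Fin n) (Fin n) k)⁻¹,
          (1 + m) * v * (1 + m : Matrix (Fin n) (Fin n) k)⁻¹) ∈
            zariskiClosure k (Set.range φ') := by
      intro m v hv hm hm'
      rw [mem_zariskiClosure_iff]
      intro f hf h0
      refine mem_zariskiClosure_iff.1 (hφ.subset_closure hv)
        (fun v => f ((1 + m) * e * (1 + m : Matrix (Fin n) (Fin n) k)⁻¹,
          (1 + m) * v * (1 + m : Matrix (Fin n) (Fin n) k)⁻¹)) ?_ ?_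
      · exact CoordsIn.polyFunction_comp ((coordsIn_const _).prodMk
          (((coordsIn_const _).mul coordsIn_id).mul (coordsIn_const _))) hf
      · rintro _ ⟨⟨u, hu⟩, rfl⟩
        exact h0 _ ⟨⟨(m, u), ⟨hm, hu⟩, hm'⟩, rfl⟩
    intro z hz
    obtain ⟨g, hg, v, hv, rfl⟩ := mem_conjOrbitPairs.1 hz
    have hid : CoordsIn (regularFunctions k {g : Matrix (Fin n) (Fin n) k | g.det ≠ 0})
        fun g => (g : Matrix (Fin n) (Fin n) k) := coordsIn_regularIn _
    have hconj : ∀ v : Matrix (Fin n) (Fin n) k,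
        CoordsIn (regularFunctions k {g : Matrix (Fin n) (Fin n) k | g.det ≠ 0})
          fun g => (g : Matrix (Fin n) (Fin n) k) * v * (g : Matrix (Fin n) (Fin n) k)⁻¹ :=
      fun v => CoordsIn.conj (invClosed_regularIn _) (fun g => g.2) hid (coordsIn_const v)
    have hreg : (fun g : {g : Matrix (Fin n) (Fin n) k | g.det ≠ 0} =>
        LinearMap.det (T₀ - T₁ ((g : Matrix (Fin n) (Fin n) k) * e *
          (g : Matrix (Fin n) (Fin n) k)⁻¹))) ∈
        regularFunctions k {g : Matrix (Fin n) (Fin n) k | g.det ≠ 0} :=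
      ((hconj e).const_sub_linear T₀ T₁).linearMap_det
    have hG₂ := isPolyDense_exists_mul_sub_one_mem hM
      (f := fun g => LinearMap.det (T₀ - T₁ (g * e * g⁻¹)))
      hreg (by simp [hTe])
    refine mem_zariskiClosure_of_isPolyDense (U := {g : Matrix (Fin n) (Fin n) k | g.det ≠ 0})
      (ψ := fun g => (g * e * g⁻¹, g * v * g⁻¹)) hG₂ (fun g hg => hg.1) ?_ ?_ hg
    · exact (hconj e).prodMk (hconj v)
    · rintro g ⟨hg, hgT, w', hwdet, hwc, hgM⟩
      have hgdet : IsUnit g.det := hg.isUnit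
      have hwu : IsUnit w'.det := hwdet.isUnit
      have hs : ∀ y, (g * w') * y * (g * w')⁻¹ = g * (w' * y * w'⁻¹) * g⁻¹ := fun y => by
        rw [Matrix.mul_inv_rev]
        simp only [mul_assoc]
      have hse : (g * w') * e * (g * w')⁻¹ = g * e * g⁻¹ := by
        rw [hs, ← hwc, Matrix.mul_nonsing_inv_cancel_right _ _ hwu]
      have hsv : (g * w') * (w'⁻¹ * v * w') * (g * w')⁻¹ = g * v * g⁻¹ := by
        rw [hs, mul_assoc w'⁻¹, Matrix.mul_nonsing_inv_cancel_left _ _ hwu,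
          Matrix.mul_nonsing_inv_cancel_right _ _ hwu]
      have key := step ⟨_, hgM⟩ (w'⁻¹ * v * w') (hV w' hwdet hwc v hv)
      simp only [add_sub_cancel] at key
      rw [hse, hsv] at key
      exact key (by rw [Matrix.det_mul]; exact (hgdet.mul hwu).ne_zero) hgT

/-- The dimension of `G · (e, V)`. -/
theorem conjOrbitPairs_irreducible_and_dim [Infinite k] [FiniteDimensional k F]
    (e : Matrix (Fin n) (Fin n) k) {V : Set (Matrix (Fin n) (Fin n) k)}
    (hV : ∀ w : Matrix (Fin n) (Fin n) k, w.det ≠ 0 → e * w = w * e → ∀ v ∈ V, w⁻¹ * v * w ∈ V)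
    {U : Set F} {φ : U → Matrix (Fin n) (Fin n) k} (hφ : IsChart k U φ V) {d : ℕ}
    (hd : Module.finrank k F + d = Module.finrank k (glCentralizer e)) :
    ZariskiIrreducible k (zariskiClosure k (conjOrbitPairs e V)) ∧
      ∀ N : ℕ, N + d = n * n → zariskiDim k (zariskiClosure k (conjOrbitPairs e V)) = N := by
  obtain ⟨M, hM⟩ := Submodule.exists_isCompl (glCentralizer e)
  obtain ⟨U', φ', h⟩ := exists_isChart_conjOrbitPairs e hV hφ hM
  refine ⟨h.closure.irreducible, fun N hN => ?_⟩
  have h1 := Submodule.finrank_add_eq_of_isCompl hM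
  rw [Module.finrank_matrix, Module.finrank_self, mul_one, Fintype.card_fin] at h1
  rw [h.closure.zariskiDim_eq, Module.finrank_prod]
  congr 2
  omega

end Saturation

/-! ### Jordan types -/

section Jordan

variable {k : Type*} [Field k] {n : ℕ}

theorem blockDiagonal'_nilpotentJordanBlock_apply (l : List ℕ)
    (s t : Σ i : Fin l.length, Fin (l.get i)) :
    Matrix.blockDiagonal' (fun i => nilpotentJordanBlock k (l.get i)) s t =
      if s.1 = t.1 ∧ (s.2 : ℕ) + 1 = t.2 then 1 else 0 := by
  obtain ⟨i, a⟩ := s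
  obtain ⟨j, c⟩ := t
  by_cases h : i = j
  · subst h
    simp [Matrix.blockDiagonal'_apply, nilpotentJordanBlock]
  · simp [Matrix.blockDiagonal'_apply, h]

/-- `x` shifts the vectors of the basis `b`: it maps the vector number `c + 1` of a block to the
vector number `c`, and the vector number `0` to zero. -/
def IsJordanBasis (x : Matrix (Fin n) (Fin n) k) {l : List ℕ}
    (b : Module.Basis (Σ i : Fin l.length, Fin (l.get i)) k (Fin n → k)) : Prop :=
  ∀ t, x.mulVec (b t) =
    if _h : (t.2 : ℕ) = 0 then 0 else b ⟨t.1, ⟨t.2 - 1, (Nat.sub_le _ _).trans_lt t.2.2⟩⟩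

theorem sum_blockDiagonal'_smul {V : Type*} [AddCommGroup V] [Module k V] {l : List ℕ}
    (b : (Σ i : Fin l.length, Fin (l.get i)) → V) (t : Σ i : Fin l.length, Fin (l.get i)) :
    ∑ s, Matrix.blockDiagonal' (fun i => nilpotentJordanBlock k (l.get i)) s t • b s =
      if _h : (t.2 : ℕ) = 0 then 0 else b ⟨t.1, ⟨t.2 - 1, (Nat.sub_le _ _).trans_lt t.2.2⟩⟩ := by
  simp only [blockDiagonal'_nilpotentJordanBlock_apply, ite_smul, one_smul, zero_smul]
  split_ifs with h
  · refine Finset.sum_eq_zero fun s _ => if_neg ?_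
    omega
  · rw [Finset.sum_eq_single ⟨t.1, ⟨t.2 - 1, (Nat.sub_le _ _).trans_lt t.2.2⟩⟩]
    · rw [if_pos]
      refine ⟨rfl, ?_⟩
      change (t.2 : ℕ) - 1 + 1 = _
      omega
    · rintro ⟨i, a⟩ - hs
      refine if_neg ?_
      rintro ⟨rfl, ha⟩
      refine hs ?_
      congr 1
      ext
      change (a : ℕ) = t.2 - 1
      simp only at ha
      omega
    · simp

theorem HasJordanType.exists_basis {x : Matrix (Fin n) (Fin n) k} {l : List ℕ}
    (h : HasJordanType x l) :
    ∃ b : Module.Basis (Σ i : Fin l.length, Fin (l.get i)) k (Fin n → k), IsJordanBasis x b := by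
  obtain ⟨σ, g, rfl⟩ := h
  let b := ((Pi.basisFun k (Fin n)).reindex σ.symm).map
    (Matrix.GeneralLinearGroup.toLin g).toLinearEquiv
  have hb : ∀ t, b t = (g : Matrix (Fin n) (Fin n) k).mulVec (Pi.single (σ t) 1) := fun t => by
    simp only [b, Module.Basis.map_apply, Module.Basis.reindex_apply, Pi.basisFun_apply,
      Equiv.symm_symm]
    rfl
  have hM : ∀ t, (Matrix.reindex σ σ (Matrix.blockDiagonal' fun i =>
      nilpotentJordanBlock k (l.get i))).mulVec (Pi.single (σ t) 1) =
      ∑ s, Matrix.blockDiagonal' (fun i => nilpotentJordanBlock k (l.get i)) s t •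
        Pi.single (σ s) 1 := fun t => by
    ext i
    rw [Matrix.mulVec_single_one, Finset.sum_apply, Finset.sum_eq_single (σ.symm i)]
    · simp
    · intro s _ hs
      have : i ≠ σ s := fun h => hs (by simp [h])
      simp [this]
    · simp
  refine ⟨b, fun t => ?_⟩
  rw [← sum_blockDiagonal'_smul (k := k) (⇑b) t, hb, Matrix.mulVec_mulVec, mul_assoc,
    ← Units.val_mul, inv_mul_cancel, Units.val_one, mul_one, ← Matrix.mulVec_mulVec, hM]
  simp only [hb]
  exact (map_sum (Matrix.mulVecLin g.1) _ _).trans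
    (Finset.sum_congr rfl fun s _ => (Matrix.mulVecLin g.1).map_smul _ _)

/-- Matrices with Jordan bases of the same type are conjugate. -/
theorem IsJordanBasis.mem_conjOrbit {x y : Matrix (Fin n) (Fin n) k} {l : List ℕ}
    {b c : Module.Basis (Σ i : Fin l.length, Fin (l.get i)) k (Fin n → k)}
    (hb : IsJordanBasis x b) (hc : IsJordanBasis y c) : y ∈ conjOrbit x := by
  let L : (Fin n → k) ≃ₗ[k] (Fin n → k) := b.equiv c (Equiv.refl _)
  have hLb : ∀ t, L (b t) = c t := fun t => by simp [L]
  have hL : ∀ v, y.mulVec (L v) = L (x.mulVec v) := by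
    intro v
    have : Matrix.toLin' y ∘ₗ L.toLinearMap = L.toLinearMap ∘ₗ Matrix.toLin' x := by
      refine b.ext fun t => ?_
      simp only [LinearMap.comp_apply, LinearEquiv.coe_coe, Matrix.toLin'_apply]
      rw [hLb, hb t, hc t]
      split_ifs
      · simp
      · rw [hLb]
    exact LinearMap.congr_fun this v
  let s := LinearMap.toMatrix' L.toLinearMap
  have hs : IsUnit s.det := by
    rw [LinearMap.det_toMatrix']
    exact LinearEquiv.isUnit_det' L
  refine _root_.mem_conjOrbit.2 ⟨s, hs.ne_zero, ?_⟩
  have : y * s = s * x := by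
    refine Matrix.toLin'.injective (LinearMap.ext fun v => ?_)
    simp [s, hL]
  rw [← this, Matrix.mul_nonsing_inv_cancel_right _ _ hs]

theorem IsJordanBasis.hasJordanType {x : Matrix (Fin n) (Fin n) k} {l : List ℕ}
    {b : Module.Basis (Σ i : Fin l.length, Fin (l.get i)) k (Fin n → k)}
    (hb : IsJordanBasis x b) : HasJordanType x l := by
  let σ : (Σ i : Fin l.length, Fin (l.get i)) ≃ Fin n := b.indexEquiv (Pi.basisFun k (Fin n))
  let y := Matrix.reindex σ σ (Matrix.blockDiagonal' fun i => nilpotentJordanBlock k (l.get i))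
  have hy : HasJordanType y l := ⟨σ, 1, by simp [y]⟩
  obtain ⟨c, hc⟩ := hy.exists_basis
  obtain ⟨g, hg⟩ := hc.mem_conjOrbit hb
  exact ⟨σ, g, hg⟩

theorem HasJordanType.mem_conjOrbit {x y : Matrix (Fin n) (Fin n) k} {l : List ℕ}
    (hx : HasJordanType x l) (hy : HasJordanType y l) : y ∈ conjOrbit x := by
  obtain ⟨b, hb⟩ := hx.exists_basis
  obtain ⟨c, hc⟩ := hy.exists_basis
  exact hb.mem_conjOrbit hc

theorem exists_hasJordanType (k : Type*) [Field k] (l : List ℕ) (h : l.sum = n) :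
    ∃ x : Matrix (Fin n) (Fin n) k, HasJordanType x l := by
  have : Fintype.card (Σ i : Fin l.length, Fin (l.get i)) = n := by
    simp [← h, Fin.sum_univ_getElem]
  let σ := Fintype.equivFinOfCardEq this
  exact ⟨_, σ, 1, rfl⟩

theorem IsJordanBasis.pow_mulVec {x : Matrix (Fin n) (Fin n) k} {l : List ℕ}
    {b : Module.Basis (Σ i : Fin l.length, Fin (l.get i)) k (Fin n → k)}
    (hb : IsJordanBasis x b) (m : ℕ) (t : Σ i : Fin l.length, Fin (l.get i)) :
    (x ^ m).mulVec (b t) =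
      if _h : (t.2 : ℕ) < m then 0 else b ⟨t.1, ⟨t.2 - m, (Nat.sub_le _ _).trans_lt t.2.2⟩⟩ := by
  induction m with
  | zero => simp
  | succ m ih =>
    rw [pow_succ', ← Matrix.mulVec_mulVec, ih]
    split_ifs with h1 h2 h2
    · simp
    · omega
    · rw [hb, dif_pos]
      change (t.2 : ℕ) - m = 0
      omega
    · rw [hb, dif_neg]
      · rfl
      · change ¬((t.2 : ℕ) - m = 0)
        omega

end Jordan

/-! ### Matrices of rank at most one and the orbit of type `7²` -/

section RankOne

variable {k : Type*} [Field k] {n : ℕ}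

/-- All `2 × 2` minors of `A` vanish, formulated without coordinates. -/
def RankLeOne (A : Matrix (Fin n) (Fin n) k) : Prop :=
  ∀ (φ₁ φ₂ : Module.Dual k (Fin n → k)) (v₁ v₂ : Fin n → k),
    φ₁ (A.mulVec v₁) * φ₂ (A.mulVec v₂) = φ₁ (A.mulVec v₂) * φ₂ (A.mulVec v₁)

theorem RankLeOne.conj {A s : Matrix (Fin n) (Fin n) k} (h : RankLeOne A) :
    RankLeOne (s * A * s⁻¹) := by
  intro φ₁ φ₂ v₁ v₂
  simpa [Matrix.mulVec_mulVec, mul_assoc] using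
    h (φ₁ ∘ₗ Matrix.mulVecLin s) (φ₂ ∘ₗ Matrix.mulVecLin s) (s⁻¹.mulVec v₁) (s⁻¹.mulVec v₂)

theorem conj_pow_of_det_ne_zero {s x : Matrix (Fin n) (Fin n) k} (hs : s.det ≠ 0) (m : ℕ) :
    (s * x * s⁻¹) ^ m = s * x ^ m * s⁻¹ := by
  have hu := hs.isUnit
  induction m with
  | zero => simp [Matrix.mul_nonsing_inv _ hu]
  | succ m ih =>
    rw [pow_succ, ih, pow_succ]
    simp only [mul_assoc]
    rw [Matrix.nonsing_inv_mul_cancel_left _ _ hu]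

/-- The function `x ↦ φ₁ (x ^ m v₁) * φ₂ (x ^ m v₂) - φ₁ (x ^ m v₂) * φ₂ (x ^ m v₁)`. -/
def powMinor (m : ℕ) (φ₁ φ₂ : Module.Dual k (Fin n → k)) (v₁ v₂ : Fin n → k)
    (x : Matrix (Fin n) (Fin n) k) : k :=
  φ₁ ((x ^ m).mulVec v₁) * φ₂ ((x ^ m).mulVec v₂) - φ₁ ((x ^ m).mulVec v₂) * φ₂ ((x ^ m).mulVec v₁)

theorem rankLeOne_pow_iff {m : ℕ} {x : Matrix (Fin n) (Fin n) k} :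
    RankLeOne (x ^ m) ↔ ∀ φ₁ φ₂ v₁ v₂, powMinor m φ₁ φ₂ v₁ v₂ x = 0 := by
  simp only [RankLeOne, powMinor, sub_eq_zero]

theorem powMinor_mem (m : ℕ) (φ₁ φ₂ : Module.Dual k (Fin n → k)) (v₁ v₂ : Fin n → k) :
    powMinor m φ₁ φ₂ v₁ v₂ ∈ polyFunctionsOn k (Matrix (Fin n) (Fin n) k) := by
  have h : ∀ (φ : Module.Dual k (Fin n → k)) (v : Fin n → k),
      (fun x : Matrix (Fin n) (Fin n) k => φ ((x ^ m).mulVec v)) ∈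
        polyFunctionsOn k (Matrix (Fin n) (Fin n) k) := fun φ v =>
    ((coordsIn_id (k := k) (E := Matrix (Fin n) (Fin n) k)).pow m)
      (φ ∘ₗ (Matrix.mulVecBilin k k).flip v)
  exact sub_mem (mul_mem (h _ _) (h _ _)) (mul_mem (h _ _) (h _ _))

theorem HasJordanType.pow_eq_zero {x : Matrix (Fin n) (Fin n) k} {l : List ℕ} {m : ℕ}
    (h : HasJordanType x l) (hl : ∀ a ∈ l, a ≤ m) : x ^ m = 0 := by
  obtain ⟨b, hb⟩ := h.exists_basis
  refine Matrix.toLin'.injective (b.ext fun t => ?_)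
  rw [Matrix.toLin'_apply, hb.pow_mulVec, dif_pos]
  · simp
  · exact t.2.2.trans_le (hl _ (List.get_mem _ _))

theorem HasJordanType.rankLeOne {x : Matrix (Fin n) (Fin n) k} (h : HasJordanType x [7, 5, 2]) :
    RankLeOne (x ^ 6) := by
  obtain ⟨b, hb⟩ := h.exists_basis
  have key : ∀ v, (x ^ 6).mulVec v = b.coord ⟨0, (6 : Fin 7)⟩ v • b ⟨0, (0 : Fin 7)⟩ := by
    intro v
    have : Matrix.toLin' (x ^ 6) = (b.coord ⟨0, (6 : Fin 7)⟩).smulRight (b ⟨0, (0 : Fin 7)⟩) := by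
      refine b.ext fun t => ?_
      rw [Matrix.toLin'_apply, hb.pow_mulVec, LinearMap.smulRight_apply, Module.Basis.coord_apply,
        Module.Basis.repr_self]
      by_cases ht : t = ⟨0, (6 : Fin 7)⟩
      · subst ht
        rw [Finsupp.single_eq_same, one_smul]
        rfl
      · rw [Finsupp.single_eq_of_ne' ht, zero_smul, dif_pos]
        obtain ⟨i, a⟩ := t
        match i, a, ht with
        | ⟨0, _⟩, a, ht =>
          have h7 : (a : ℕ) < 7 := a.2
          have h6 : (a : ℕ) ≠ 6 := fun h => ht (by congr 1; exact Fin.ext h)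
          exact lt_of_le_of_ne (Nat.le_of_lt_succ h7) h6
        | ⟨1, _⟩, a, _ => exact lt_trans (a.2 : (a : ℕ) < 5) (by norm_num)
        | ⟨2, _⟩, a, _ => exact lt_trans (a.2 : (a : ℕ) < 2) (by norm_num)
    exact LinearMap.congr_fun this v
  intro φ₁ φ₂ v₁ v₂
  simp only [key, map_smul, smul_eq_mul]
  ring

theorem get_seven_seven (i : Fin 2) : [7, 7].get i = 7 := by
  fin_cases i <;> rfl

/-- The index set of a Jordan basis of type `7²` is a product. -/
def sevenSevenEquiv : (Σ i : Fin [7, 7].length, Fin ([7, 7].get i)) ≃ Fin 2 × Fin 7 where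
  toFun s := (s.1, s.2.cast (get_seven_seven s.1))
  invFun p := ⟨p.1, p.2.cast (get_seven_seven p.1).symm⟩
  left_inv _ := rfl
  right_inv _ := rfl

/-- A basis of `k ^ n`, indexed by a product, which `x` shifts downwards in the second index. -/
def IsShiftBasis (x : Matrix (Fin n) (Fin n) k) {m r : ℕ}
    (b : Module.Basis (Fin r × Fin m) k (Fin n → k)) : Prop :=
  ∀ i (a : Fin m), x.mulVec (b (i, a)) =
    if _h : (a : ℕ) = 0 then 0 else b (i, ⟨a - 1, (Nat.sub_le _ _).trans_lt a.2⟩)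

theorem hasJordanType_seven_seven_iff {x : Matrix (Fin n) (Fin n) k} : HasJordanType x [7, 7] ↔
    ∃ b : Module.Basis (Fin 2 × Fin 7) k (Fin n → k), IsShiftBasis x b := by
  constructor
  · intro h
    obtain ⟨b, hb⟩ := h.exists_basis
    exact ⟨b.reindex sevenSevenEquiv, fun i a => by
      simp only [Module.Basis.reindex_apply]
      exact hb _⟩
  · rintro ⟨b, hb⟩
    refine IsJordanBasis.hasJordanType (b := b.reindex sevenSevenEquiv.symm) fun t => ?_
    simp only [Module.Basis.reindex_apply, Equiv.symm_symm]
    exact hb _ _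

theorem IsShiftBasis.pow_mulVec {x : Matrix (Fin n) (Fin n) k} {m r : ℕ}
    {b : Module.Basis (Fin r × Fin m) k (Fin n → k)} (hb : IsShiftBasis x b) (q : ℕ) (i : Fin r)
    (a : Fin m) : (x ^ q).mulVec (b (i, a)) =
      if _h : (a : ℕ) < q then 0 else b (i, ⟨a - q, (Nat.sub_le _ _).trans_lt a.2⟩) := by
  induction q with
  | zero => simp
  | succ q ih =>
    rw [pow_succ', ← Matrix.mulVec_mulVec, ih]
    split_ifs with h1 h2 h2
    · simp
    · omega
    · rw [hb, dif_pos]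
      change (a : ℕ) - q = 0
      omega
    · rw [hb, dif_neg]
      · rfl
      · change ¬((a : ℕ) - q = 0)
        omega

theorem HasJordanType.not_rankLeOne {x : Matrix (Fin n) (Fin n) k} (h : HasJordanType x [7, 7]) :
    ¬ RankLeOne (x ^ 6) := by
  obtain ⟨b, hb⟩ := hasJordanType_seven_seven_iff.1 h
  intro h
  have := h (b.coord (0, 0)) (b.coord (1, 0)) (b (0, 6)) (b (1, 6))
  simp [hb.pow_mulVec] at this

/-- In the restricted nullcone, the type `7²` is characterized by an open condition. -/
theorem hasJordanType_seven_seven_of_not_rankLeOne {x : Matrix (Fin 14) (Fin 14) k}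
    (hx : x ^ 7 = 0) (h : ¬ RankLeOne (x ^ 6)) : HasJordanType x [7, 7] := by
  simp only [RankLeOne, not_forall] at h
  obtain ⟨φ₁, φ₂, v₁, v₂, h⟩ := h
  let v : Fin 2 → Fin 14 → k := ![v₁, v₂]
  have hv : ∀ c : Fin 2 → k, ∑ i, c i • (x ^ 6).mulVec (v i) = 0 → ∀ i, c i = 0 := by
    intro c hc
    rw [Fin.sum_univ_two] at hc
    change c 0 • (x ^ 6).mulVec v₁ + c 1 • (x ^ 6).mulVec v₂ = 0 at hc
    have e1 := congrArg φ₁ hc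
    have e2 := congrArg φ₂ hc
    simp only [map_add, map_smul, smul_eq_mul, map_zero] at e1 e2
    rw [Fin.forall_fin_two]
    have h' := sub_ne_zero.2 h
    have e3 : c 0 * (φ₁ ((x ^ 6).mulVec v₁) * φ₂ ((x ^ 6).mulVec v₂) -
        φ₁ ((x ^ 6).mulVec v₂) * φ₂ ((x ^ 6).mulVec v₁)) = 0 := by
      linear_combination φ₂ ((x ^ 6).mulVec v₂) * e1 - φ₁ ((x ^ 6).mulVec v₂) * e2
    have e4 : c 1 * (φ₁ ((x ^ 6).mulVec v₁) * φ₂ ((x ^ 6).mulVec v₂) -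
        φ₁ ((x ^ 6).mulVec v₂) * φ₂ ((x ^ 6).mulVec v₁)) = 0 := by
      linear_combination φ₁ ((x ^ 6).mulVec v₁) * e2 - φ₂ ((x ^ 6).mulVec v₁) * e1
    exact ⟨(mul_eq_zero.1 e3).resolve_right h', (mul_eq_zero.1 e4).resolve_right h'⟩
  let u : Fin 2 × Fin 7 → Fin 14 → k := fun p => (x ^ (6 - (p.2 : ℕ))).mulVec (v p.1)
  have hpow : ∀ m, 7 ≤ m → x ^ m = 0 := fun m hm => pow_eq_zero_of_le hm hx
  have hu : LinearIndependent k u := by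
    rw [Fintype.linearIndependent_iff]
    intro c hc
    -- downward induction on the height, applying a power of `x` to isolate the top coefficients
    have key : ∀ m : ℕ, ∀ a : Fin 7, 7 ≤ m + (a : ℕ) → ∀ i, c (i, a) = 0 := by
      intro m
      induction m with
      | zero => intro a ha; omega
      | succ m ih =>
        intro a ha
        by_cases ha' : 7 ≤ m + (a : ℕ)
        · exact ih a ha'
        refine hv (fun i => c (i, a)) ?_
        have := congrArg (x ^ (a : ℕ)).mulVec hc
        rw [Matrix.mulVec_zero, Fintype.sum_prod_type, ← Matrix.mulVecLin_apply, map_sum] at this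
        rw [← this]
        refine Finset.sum_congr rfl fun i _ => ?_
        rw [map_sum, Finset.sum_eq_single a]
        · simp only [u, map_smul, Matrix.mulVecLin_apply, Matrix.mulVec_mulVec, ← pow_add]
          rw [Nat.add_sub_cancel' (Nat.le_of_lt_succ a.2)]
        · intro a' _ hne
          rw [map_smul, Matrix.mulVecLin_apply, Matrix.mulVec_mulVec, ← pow_add]
          rcases lt_or_gt_of_ne hne with hlt | hlt
          · have hlt' : (a' : ℕ) < a := hlt
            rw [hpow _ (by simp only; omega), Matrix.zero_mulVec, smul_zero]
          · rw [ih a' (by omega), zero_smul]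
        · simp
    rintro ⟨i, a⟩
    exact key 7 a (by omega) i
  let b := basisOfLinearIndependentOfCardEqFinrank hu (by simp)
  have hb : ∀ p, b p = u p := fun p => by simp [b]
  refine hasJordanType_seven_seven_iff.2 ⟨b, fun i a => ?_⟩
  rw [hb]
  simp only [u, Matrix.mulVec_mulVec, ← pow_succ']
  split_ifs with h0
  · rw [hpow _ (by omega), Matrix.zero_mulVec]
  · rw [hb]
    congr 2
    change 6 - (a : ℕ) + 1 = 6 - ((a : ℕ) - 1)
    omega

end RankOne

/-! ### The restricted nullcone is the closure of the orbit of type `7²` -/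

section Nullcone

variable {k : Type*} [Field k]

theorem Submodule.exists_finrank_eq_between {V : Type*} [AddCommGroup V] [Module k V]
    [FiniteDimensional k V] {A B : Submodule k V} (hAB : A ≤ B) {d : ℕ}
    (hA : Module.finrank k A ≤ d) (hB : d ≤ Module.finrank k B) :
    ∃ F : Submodule k V, A ≤ F ∧ F ≤ B ∧ Module.finrank k F = d := by
  induction d, hA using Nat.le_induction with
  | base => exact ⟨A, le_rfl, hAB, rfl⟩
  | succ d _ ih =>
    obtain ⟨F, hAF, hFB, hF⟩ := ih (by omega)
    obtain ⟨v, hvB, hvF⟩ := SetLike.exists_of_lt (hFB.lt_of_ne (by rintro rfl; omega))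
    refine ⟨F ⊔ k ∙ v, hAF.trans le_sup_left, sup_le hFB (by simpa using hvB), ?_⟩
    have hv0 : v ≠ 0 := by
      rintro rfl
      exact hvF F.zero_mem
    have h1 : F ⊓ (k ∙ v) = ⊥ := by
      rw [← disjoint_iff, Submodule.disjoint_span_singleton' hv0]
      exact hvF
    have h2 := Submodule.finrank_sup_add_finrank_inf_eq F (k ∙ v)
    rw [h1, finrank_bot, finrank_span_singleton hv0] at h2
    omega

/-- Rank-nullity for the restriction of `f` to the range of `f ^ i`. -/
theorem finrank_range_pow_eq {V : Type*} [AddCommGroup V] [Module k V]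
    [FiniteDimensional k V] (f : Module.End k V) (i : ℕ) :
    Module.finrank k (LinearMap.range (f ^ i)) = Module.finrank k (LinearMap.range (f ^ (i + 1))) +
      Module.finrank k (LinearMap.ker f ⊓ LinearMap.range (f ^ i) : Submodule k V) := by
  rw [← LinearMap.finrank_range_add_finrank_ker (f.domRestrict (LinearMap.range (f ^ i)))]
  congr 1
  · rw [LinearMap.range_domRestrict, pow_succ', Module.End.mul_eq_comp, LinearMap.range_comp]
  · have : Submodule.map (LinearMap.range (f ^ i)).subtype
        (f.domRestrict (LinearMap.range (f ^ i))).ker =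
        LinearMap.ker f ⊓ LinearMap.range (f ^ i) := by
      ext v
      simp only [Submodule.mem_map, LinearMap.mem_ker, LinearMap.domRestrict_apply,
        Submodule.subtype_apply, Subtype.exists, exists_and_left, exists_prop, Submodule.mem_inf]
      constructor
      · rintro ⟨w, hw, hw', rfl⟩
        exact ⟨hw, hw'⟩
      · rintro ⟨hw, hw'⟩
        exact ⟨v, hw, hw', rfl⟩
    rw [← this, Submodule.finrank_map_subtype_eq]

/-- An endomorphism `f` of a space of dimension `2 m` with `f ^ m = 0` is strictly block triangular
with blocks of size `2` in some basis. -/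
theorem exists_basis_strictly_triangular (m : ℕ) : ∀ {V : Type*} [AddCommGroup V] [Module k V]
    [FiniteDimensional k V], Module.finrank k V = 2 * m → ∀ f : Module.End k V, f ^ m = 0 →
    ∃ b : Module.Basis (Fin 2 × Fin m) k V, ∀ p q, q.2 ≤ p.2 → b.repr (f (b q)) p = 0 := by
  induction m with
  | zero =>
    intro V _ _ _ hV f _
    exact ⟨(Module.finBasis k V).reindex
      (Fintype.equivOfCardEq (by rw [Fintype.card_fin, hV]; simp)), fun p => p.2.elim0⟩
  | succ m ih =>
    intro V _ _ _ hV f hf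
    have hrange : LinearMap.range f ≤ LinearMap.ker (f ^ m) := by
      rintro _ ⟨v, rfl⟩
      rw [LinearMap.mem_ker, ← Module.End.mul_apply, ← pow_succ, hf, LinearMap.zero_apply]
    have h0 : Module.finrank k (LinearMap.range (f ^ 0)) = 2 * (m + 1) := by
      rw [pow_zero, Module.End.one_eq_id, LinearMap.range_id, finrank_top, hV]
    have hm1 : Module.finrank k (LinearMap.range (f ^ (m + 1))) = 0 := by
      rw [hf, LinearMap.range_zero, finrank_bot]
    -- the kernel of `f` has dimension at least `2`
    have hker : 2 ≤ Module.finrank k (LinearMap.ker f) := by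
      have : ∀ i, Module.finrank k (LinearMap.range (f ^ 0)) ≤
          Module.finrank k (LinearMap.range (f ^ i)) + i * Module.finrank k (LinearMap.ker f) := by
        intro i
        induction i with
        | zero => simp
        | succ i hi =>
          have h1 := finrank_range_pow_eq f i
          have h2 := Submodule.finrank_mono
            (inf_le_left : LinearMap.ker f ⊓ LinearMap.range (f ^ i) ≤ LinearMap.ker f)
          rw [add_mul, one_mul]
          omega
      have := this (m + 1)
      rw [h0, hm1] at this
      nlinarith
    -- the rank of `f ^ m` is at most `2`
    have hrank : Module.finrank k (LinearMap.range (f ^ m)) ≤ 2 := by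
      have : ∀ i ≤ m + 1, Module.finrank k (LinearMap.range (f ^ i)) +
          i * Module.finrank k (LinearMap.range (f ^ m)) ≤
            Module.finrank k (LinearMap.range (f ^ 0)) := by
        intro i
        induction i with
        | zero => simp
        | succ i hi =>
          intro him
          have h1 := finrank_range_pow_eq f i
          have h2 : LinearMap.range (f ^ m) ≤ LinearMap.ker f ⊓ LinearMap.range (f ^ i) := by
            refine le_inf ?_ ?_
            · rintro _ ⟨v, rfl⟩
              rw [LinearMap.mem_ker, ← Module.End.mul_apply, ← pow_succ', hf, LinearMap.zero_apply]
            · obtain ⟨j, rfl⟩ := Nat.exists_eq_add_of_le (Nat.le_of_succ_le_succ him)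
              rw [pow_add, Module.End.mul_eq_comp]
              exact LinearMap.range_comp_le_range _ _
          have h3 := Submodule.finrank_mono h2
          have h4 := hi (by omega)
          rw [add_mul, one_mul]
          omega
      have := this (m + 1) le_rfl
      rw [h0, hm1] at this
      nlinarith
    have hd1 := LinearMap.finrank_range_add_finrank_ker f
    have hd2 := LinearMap.finrank_range_add_finrank_ker (f ^ m)
    obtain ⟨F, hF1, hF2, hF⟩ := Submodule.exists_finrank_eq_between hrange (d := 2 * m)
      (by omega) (by omega)
    have hfF : ∀ v, f v ∈ F := fun v => hF1 ⟨v, rfl⟩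
    let g : Module.End k F := f.restrict fun v _ => hfF v
    have hg : ∀ i (v : F), ((g ^ i) v : V) = (f ^ i) v := by
      intro i
      induction i with
      | zero => simp
      | succ i hi =>
        intro v
        rw [pow_succ', pow_succ', Module.End.mul_apply, Module.End.mul_apply, ← hi]
        rfl
    obtain ⟨c, hc⟩ := ih hF g (by
      ext v
      rw [hg]
      exact hF2 v.2)
    obtain ⟨Q, hQ⟩ := F.exists_isCompl
    have hQd : Module.finrank k Q = 2 := by
      have := Submodule.finrank_add_eq_of_isCompl hQ
      omega
    let d := Module.finBasisOfFinrankEq k Q hQd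
    let b₀ := (c.prod d).map (Submodule.prodEquivOfIsCompl F Q hQ)
    let τ : (Fin 2 × Fin m) ⊕ Fin 2 → Fin 2 × Fin (m + 1) :=
      Sum.elim (fun p => (p.1, p.2.castSucc)) fun i => (i, Fin.last m)
    have hτ : Function.Bijective τ := by
      rw [Fintype.bijective_iff_surjective_and_card]
      refine ⟨?_, by simp; ring⟩
      rintro ⟨i, a⟩
      refine Fin.lastCases ⟨.inr i, rfl⟩ (fun a => ⟨.inl (i, a), rfl⟩) a
    have hb₀ : ∀ v (hv : v ∈ F) s, b₀.repr v s = (c.prod d).repr (⟨v, hv⟩, 0) s := by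
      intro v hv s
      simp only [b₀, Module.Basis.map_repr, LinearEquiv.trans_apply]
      congr 2
      exact Submodule.prodEquivOfIsCompl_symm_apply_left F Q hQ ⟨v, hv⟩
    refine ⟨b₀.reindex (Equiv.ofBijective τ hτ), fun p q hpq => ?_⟩
    obtain ⟨s, rfl⟩ := (Equiv.ofBijective τ hτ).surjective p
    obtain ⟨t, rfl⟩ := (Equiv.ofBijective τ hτ).surjective q
    simp only [Module.Basis.reindex_apply, Module.Basis.repr_reindex_apply, Equiv.symm_apply_apply]
    rw [hb₀ _ (hfF _)]
    rcases s with s | s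
    · rcases t with t | t
      · have : (⟨f (b₀ (.inl t)), hfF _⟩ : F) = g (c t) := by
          ext
          simp [b₀, g]
        rw [this, Module.Basis.prod_repr_inl]
        exact hc _ _ (by simpa [τ] using hpq)
      · exfalso
        simp [τ, Fin.le_def] at hpq
        omega
    · simp

variable {n : ℕ}

/-- If `y` lowers a height function on a basis by at least one, then `y ^ m` lowers it by at
least `m`. -/
theorem repr_pow_mulVec_eq_zero {ι : Type*} [Fintype ι] (b : Module.Basis ι k (Fin n → k))
    (h : ι → ℕ) {y : Matrix (Fin n) (Fin n) k}
    (hy : ∀ p q, h q < h p + 1 → b.repr (y.mulVec (b q)) p = 0) (m : ℕ) :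
    ∀ p q, h q < h p + m → b.repr ((y ^ m).mulVec (b q)) p = 0 := by
  induction m with
  | zero =>
    intro p q hpq
    rw [pow_zero, Matrix.one_mulVec, b.repr_self, Finsupp.single_eq_of_ne]
    rintro rfl
    exact lt_irrefl _ hpq
  | succ m ih =>
    intro p q hpq
    rw [pow_succ, ← Matrix.mulVec_mulVec, ← b.sum_repr (y.mulVec (b q)), ← Matrix.mulVecLin_apply,
      map_sum, map_sum, Finsupp.finsetSum_apply]
    refine Finset.sum_eq_zero fun r _ => ?_
    rw [map_smul, map_smul, Finsupp.smul_apply, Matrix.mulVecLin_apply, smul_eq_mul]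
    by_cases hr : h q < h r + 1
    · rw [hy _ _ hr, zero_mul]
    · rw [ih p r (by omega), mul_zero]

/-- A matrix that strictly lowers the height `h` of the vectors of a basis is nilpotent. -/
theorem pow_eq_zero_of_repr {ι : Type*} [Fintype ι] (b : Module.Basis ι k (Fin n → k))
    (h : ι → ℕ) {y : Matrix (Fin n) (Fin n) k}
    (hy : ∀ p q, h q < h p + 1 → b.repr (y.mulVec (b q)) p = 0) {m : ℕ} (hm : ∀ q, h q < m) :
    y ^ m = 0 := by
  refine Matrix.toLin'.injective (b.ext fun q => b.repr.injective (Finsupp.ext fun p => ?_))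
  rw [Matrix.toLin'_apply, repr_pow_mulVec_eq_zero b h hy m p q ((hm q).trans_le (by omega))]
  simp

/-- A linear subspace is contained in the closure of the non-vanishing locus of a polynomial
function that does not vanish on it. -/
theorem submodule_subset_zariskiClosure [Infinite k] {E : Type*} [AddCommGroup E] [Module k E]
    [FiniteDimensional k E] (N : Submodule k E) {f : E → k} (hf : f ∈ polyFunctionsOn k E) {w : E}
    (hw : w ∈ N) (hfw : f w ≠ 0) {S : Set E} (hS : ∀ v ∈ N, f v ≠ 0 → v ∈ S) :
    (N : Set E) ⊆ zariskiClosure k S := by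
  intro v hv
  have hN : CoordsIn (polyFunctionsOn k N) fun v : N => (v : E) := coordsIn_id.linear N.subtype
  have hd := isPolyDense_ne_zero (hN.polyFunction_comp hf) ⟨⟨w, hw⟩, hfw⟩
  rw [mem_zariskiClosure_iff]
  intro g hg h0
  exact congrFun (hd _ (hN.polyFunction_comp hg) fun u hu => h0 u (hS u u.2 hu)) ⟨v, hv⟩

theorem isClosed_pow_eq_zero (m : ℕ) : @IsClosed (Matrix (Fin n) (Fin n) k)
    (zariskiTopology k _) (restrictedNullcone k n m) := by
  rw [isClosed_zariski_iff]
  refine ⟨Set.range fun p : Fin n × Fin n => fun x : Matrix (Fin n) (Fin n) k =>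
    (x ^ m) p.1 p.2, ?_, ?_⟩
  · rintro _ ⟨p, rfl⟩
    exact coordsIn_matrix.1 ((coordsIn_id (k := k) (E := Matrix (Fin n) (Fin n) k)).pow m) p.1 p.2
  · ext x
    simp only [restrictedNullcone, Set.mem_ofPred_eq, ← Matrix.ext_iff, Matrix.zero_apply,
      Set.forall_mem_range, Prod.forall]

theorem conjOrbit_subset_restrictedNullcone {m : ℕ} {x : Matrix (Fin n) (Fin n) k}
    (hx : x ^ m = 0) : conjOrbit x ⊆ restrictedNullcone k n m := by
  intro y hy
  obtain ⟨s, hs, rfl⟩ := mem_conjOrbit.1 hy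
  change _ ^ m = 0
  rw [conj_pow_of_det_ne_zero hs, hx, mul_zero, zero_mul]

theorem zariskiClosure_conjOrbit_subset {m : ℕ} {x : Matrix (Fin n) (Fin n) k}
    (hx : x ^ m = 0) : zariskiClosure k (conjOrbit x) ⊆ restrictedNullcone k n m :=
  @closure_minimal _ (zariskiTopology k _) _ _ (conjOrbit_subset_restrictedNullcone hx)
    (isClosed_pow_eq_zero m)

/-- The strictly block triangular matrices in a suitable basis form a linear space that contains a
given `x` with `x ^ 7 = 0` and whose generic members have type `7²`. -/
theorem zariskiClosure_conjOrbit_seven_seven [Infinite k] {e : Matrix (Fin 14) (Fin 14) k}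
    (he : HasJordanType e [7, 7]) : zariskiClosure k (conjOrbit e) = restrictedNullcone k 14 7 := by
  refine (zariskiClosure_conjOrbit_subset (he.pow_eq_zero (by simp))).antisymm fun x hx => ?_
  obtain ⟨b, hb⟩ := exists_basis_strictly_triangular 7 (V := Fin 14 → k) (by simp)
    (Matrix.toLin' x) (by rw [← Matrix.toLin'_pow, show x ^ 7 = 0 from hx, map_zero])
  let N : Submodule k (Matrix (Fin 14) (Fin 14) k) :=
    { carrier := {y | ∀ p q, q.2 ≤ p.2 → b.repr (y.mulVec (b q)) p = 0}
      zero_mem' := by intro p q _; simp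
      add_mem' := by
        intro y z hy hz p q hpq
        rw [Matrix.add_mulVec, map_add, Finsupp.add_apply, hy p q hpq, hz p q hpq, add_zero]
      smul_mem' := by
        intro c y hy p q hpq
        rw [Matrix.smul_mulVec, map_smul, Finsupp.smul_apply, hy p q hpq, smul_zero] }
  have hN7 : ∀ y ∈ N, y ^ 7 = 0 := fun y hy =>
    pow_eq_zero_of_repr b (fun p => p.2) (fun p q hpq => hy p q (Nat.le_of_lt_succ hpq))
      fun q => q.2.2
  -- the shift of the basis is a member of type `7²`
  let w : Matrix (Fin 14) (Fin 14) k := LinearMap.toMatrix' (b.constr k fun p : Fin 2 × Fin 7 =>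
    if _h : (p.2 : ℕ) = 0 then 0 else b (p.1, ⟨p.2 - 1, (Nat.sub_le _ _).trans_lt p.2.2⟩))
  have hw : IsShiftBasis w b := fun i a => by
    rw [← Matrix.toLin'_apply, Matrix.toLin'_toMatrix', Module.Basis.constr_basis]
  have hwN : w ∈ N := by
    rintro p ⟨i, a⟩ hpq
    rw [hw]
    split_ifs with h0
    · simp
    · rw [b.repr_self, Finsupp.single_eq_of_ne]
      rintro rfl
      simp only [Fin.le_def] at hpq
      omega
  have hw7 := (hasJordanType_seven_seven_iff.2 ⟨b, hw⟩).not_rankLeOne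
  simp only [rankLeOne_pow_iff, not_forall] at hw7
  obtain ⟨φ₁, φ₂, v₁, v₂, hw7⟩ := hw7
  refine submodule_subset_zariskiClosure N (powMinor_mem 6 φ₁ φ₂ v₁ v₂) hwN hw7
    (fun y hy hy' => ?_) (fun p q hpq => hb p q hpq)
  exact he.mem_conjOrbit (hasJordanType_seven_seven_of_not_rankLeOne (hN7 y hy)
    fun h => hy' (rankLeOne_pow_iff.1 h _ _ _ _))

end Nullcone

/-! ### Irreducible components -/

section Components

variable {k : Type*} [Field k] {E : Type*} [AddCommGroup E] [Module k E]

theorem zariskiClosure_eq_self {S : Set E} (h : @IsClosed E (zariskiTopology k E) S) :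
    zariskiClosure k S = S :=
  @IsClosed.closure_eq E (zariskiTopology k E) S h

theorem isClosed_zariskiClosure (S : Set E) :
    @IsClosed E (zariskiTopology k E) (zariskiClosure k S) :=
  @isClosed_closure E (zariskiTopology k E) S

theorem zariskiClosure_minimal {S T : Set E} (h : S ⊆ T)
    (hT : @IsClosed E (zariskiTopology k E) T) : zariskiClosure k S ⊆ T :=
  @closure_minimal E (zariskiTopology k E) _ _ h hT

theorem ZariskiIrreducible.subset_or_subset {S A B : Set E} (h : ZariskiIrreducible k S)
    (hA : @IsClosed E (zariskiTopology k E) A) (hB : @IsClosed E (zariskiTopology k E) B)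
    (hS : S ⊆ A ∪ B) : S ⊆ A ∨ S ⊆ B :=
  (@isPreirreducible_iff_isClosed_union_isClosed E (zariskiTopology k E) S).1 h.2 A B hA hB hS

/-- If a set is the union of two irreducible closed sets, neither of which contains the other, then
these are its irreducible components. -/
theorem zariskiComponents_eq_pair {X A B : Set E} (hX : X = A ∪ B)
    (hA : @IsClosed E (zariskiTopology k E) A) (hB : @IsClosed E (zariskiTopology k E) B)
    (hA' : ZariskiIrreducible k A) (hB' : ZariskiIrreducible k B) (hAB : ¬ A ⊆ B) (hBA : ¬ B ⊆ A) :
    zariskiComponents k X = {A, B} := by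
  subst hX
  ext V
  constructor
  · intro hV
    have hV : Maximal (fun W => W ⊆ A ∪ B ∧ ZariskiIrreducible k W) V := hV
    rcases hV.prop.2.subset_or_subset hA hB hV.prop.1 with h | h
    · exact .inl (hV.eq_of_le ⟨Set.subset_union_left, hA'⟩ h)
    · exact .inr (hV.eq_of_le ⟨Set.subset_union_right, hB'⟩ h)
  · rintro (rfl | rfl)
    · refine ⟨⟨Set.subset_union_left, hA'⟩, fun W hW hVW => ?_⟩
      rcases hW.2.subset_or_subset hA hB hW.1 with h | h
      · exact h
      · exact absurd (hVW.trans h) hAB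
    · refine ⟨⟨Set.subset_union_right, hB'⟩, fun W hW hVW => ?_⟩
      rcases hW.2.subset_or_subset hA hB hW.1 with h | h
      · exact absurd (hVW.trans h) hBA
      · exact h

theorem ZariskiIrreducible.mem_zariskiComponents {X : Set E} (h : ZariskiIrreducible k X) :
    X ∈ zariskiComponents k X :=
  ⟨⟨le_rfl, h⟩, fun _ hW _ => hW.1⟩

/-- Every irreducible subset is contained in an irreducible component. -/
theorem ZariskiIrreducible.exists_subset_component {X S : Set E} (h : ZariskiIrreducible k S)
    (hS : S ⊆ X) : ∃ V ∈ zariskiComponents k X, S ⊆ V := by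
  let := zariskiTopology k E
  suffices hub : ∀ c ⊆ {W | W ⊆ X ∧ ZariskiIrreducible k W}, IsChain (· ⊆ ·) c → c.Nonempty →
      ⋃₀ c ∈ {W | W ⊆ X ∧ ZariskiIrreducible k W} by
    obtain ⟨V, hSV, hV⟩ := zorn_subset_nonempty {W | W ⊆ X ∧ ZariskiIrreducible k W}
      (fun c hc hcc hcne => ⟨⋃₀ c, hub c hc hcc hcne, fun W hW => Set.subset_sUnion_of_mem hW⟩)
      S ⟨hS, h⟩
    exact ⟨V, hV, hSV⟩
  intro c hc hcc hcne
  refine ⟨Set.sUnion_subset fun W hW => (hc hW).1, ?_, ?_⟩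
  · obtain ⟨W, hW⟩ := hcne
    obtain ⟨v, hv⟩ := (hc hW).2.1
    exact ⟨v, W, hW, hv⟩
  · intro A B hA hB ⟨a, ⟨W, hW, haW⟩, haA⟩ ⟨b, ⟨W', hW', hbW'⟩, hbB⟩
    obtain ⟨W'', hW'', h1, h2⟩ : ∃ W'' ∈ c, W ⊆ W'' ∧ W' ⊆ W'' := by
      rcases hcc.total hW hW' with h | h
      · exact ⟨W', hW', h, le_rfl⟩
      · exact ⟨W, hW, le_rfl, h⟩
    obtain ⟨x, hx, hxAB⟩ := (hc hW'').2.2 A B hA hB ⟨a, h1 haW, haA⟩ ⟨b, h2 hbW', hbB⟩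
    exact ⟨x, ⟨W'', hW'', hx⟩, hxAB⟩

end Components

/-! ### The centralizer of a matrix of type `7²` -/

section SevenSeven

open Polynomial

variable {k : Type*} [Field k] {n : ℕ}

theorem nilpotentJordanBlock_pow_zero_row {m : ℕ} (q : ℕ) (j : Fin (m + 1)) :
    (nilpotentJordanBlock k (m + 1) ^ q) 0 j = if q = j then 1 else 0 := by
  induction q generalizing j with
  | zero =>
    simp only [pow_zero, Matrix.one_apply, Fin.ext_iff, Fin.val_zero]
  | succ q ih =>
    simp only [pow_succ, Matrix.mul_apply, ih, ite_mul, one_mul, zero_mul]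
    simp only [nilpotentJordanBlock, Matrix.of_apply]
    by_cases h : q < m + 1
    · rw [Finset.sum_eq_single ⟨q, h⟩]
      · simp
      · intro c _ hc
        rw [if_neg]
        rintro rfl
        exact hc rfl
      · simp
    · rw [if_neg (by omega)]
      exact Finset.sum_eq_zero fun c _ => if_neg (by omega)

/-- The first row of a polynomial in the shift consists of the coefficients. -/
theorem aeval_nilpotentJordanBlock_zero_row {m : ℕ} (p : k[X]) (j : Fin (m + 1)) :
    aeval (nilpotentJordanBlock k (m + 1)) p 0 j = p.coeff j := by
  rw [aeval_eq_sum_range, Matrix.sum_apply]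
  simp only [Matrix.smul_apply, nilpotentJordanBlock_pow_zero_row, smul_eq_mul, mul_ite, mul_one,
    mul_zero]
  rw [Finset.sum_ite_eq']
  split_ifs with h
  · rfl
  · rw [coeff_eq_zero_of_natDegree_lt]
    simpa using h

/-- A matrix that commutes with the shift is determined by its first row. -/
theorem eq_of_commute_nilpotentJordanBlock {m : ℕ} {y z : Matrix (Fin (m + 1)) (Fin (m + 1)) k}
    (hy : Commute (nilpotentJordanBlock k (m + 1)) y)
    (hz : Commute (nilpotentJordanBlock k (m + 1)) z) (h : ∀ j, y 0 j = z 0 j) : y = z := by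
  have key : ∀ {y : Matrix (Fin (m + 1)) (Fin (m + 1)) k},
      Commute (nilpotentJordanBlock k (m + 1)) y → ∀ i j,
      y i j = ∑ c, y 0 c * (nilpotentJordanBlock k (m + 1) ^ (i : ℕ)) c j := by
    intro y hy i j
    rw [← Matrix.mul_apply, ← (hy.pow_left i).eq, Matrix.mul_apply]
    simp only [nilpotentJordanBlock_pow_zero_row, ite_mul, one_mul, zero_mul]
    rw [Finset.sum_eq_single i]
    · simp
    · intro c _ hc
      rw [if_neg fun h => hc (Fin.ext h.symm)]
    · simp
  ext i j
  rw [key hy, key hz]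
  simp [h]

theorem commute_aeval {R : Type*} [Ring R] [Algebra k R] (x : R) (p : k[X]) :
    Commute x (aeval x p) := by
  simpa using (Polynomial.commute_X p).map (aeval x)

theorem aeval_nilpotentJordanBlock_eq_zero_iff {m : ℕ} (p : k[X]) :
    aeval (nilpotentJordanBlock k (m + 1)) p = 0 ↔ X ^ (m + 1) ∣ p := by
  rw [X_pow_dvd_iff]
  constructor
  · intro h d hd
    have := aeval_nilpotentJordanBlock_zero_row p ⟨d, hd⟩
    rw [h] at this
    exact this.symm
  · intro h
    refine eq_of_commute_nilpotentJordanBlock (commute_aeval _ p) (Commute.zero_right _) fun j => ?_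
    rw [aeval_nilpotentJordanBlock_zero_row, h j j.2, Matrix.zero_apply]

theorem exists_aeval_eq_of_commute {m : ℕ} {y : Matrix (Fin (m + 1)) (Fin (m + 1)) k}
    (hy : Commute (nilpotentJordanBlock k (m + 1)) y) :
    ∃ p : k[X], aeval (nilpotentJordanBlock k (m + 1)) p = y := by
  refine ⟨∑ j : Fin (m + 1), C (y 0 j) * X ^ (j : ℕ),
    eq_of_commute_nilpotentJordanBlock (commute_aeval _ _) hy fun j => ?_⟩
  rw [aeval_nilpotentJordanBlock_zero_row, finsetSum_coeff]
  simp only [coeff_C_mul, coeff_X_pow, mul_ite, mul_one, mul_zero]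
  rw [Finset.sum_eq_single j]
  · simp
  · intro c _ hc
    rw [if_neg fun h => hc (Fin.ext h.symm)]
  · simp

/-- The centralizer of a matrix `e` of type `7²` is the ring of `2 × 2` matrices over
`k[X] / (X ^ 7)`, where `X` acts as `e`. -/
theorem HasJordanType.exists_algHom {e : Matrix (Fin n) (Fin n) k} (he : HasJordanType e [7, 7]) :
    ∃ Φ : Matrix (Fin 2) (Fin 2) k[X] →ₐ[k] Matrix (Fin n) (Fin n) k,
      Φ (Matrix.scalar _ X) = e ∧ (∀ y, e * y = y * e → ∃ P, Φ P = y) ∧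
      ∀ P, Φ P = 0 ↔ ∀ i j, X ^ 7 ∣ P i j := by
  obtain ⟨b, hb⟩ := hasJordanType_seven_seven_iff.1 he
  let J := nilpotentJordanBlock k 7
  let Ψ : Matrix (Fin n) (Fin n) k ≃ₐ[k] Matrix (Fin 2 × Fin 7) (Fin 2 × Fin 7) k :=
    Matrix.toLinAlgEquiv'.trans (LinearMap.toMatrixAlgEquiv b)
  let Θ := (Matrix.compAlgEquiv (Fin 2) (Fin 7) k k).trans Ψ.symm
  have hΘe : Θ (Matrix.scalar _ J) = e := by
    rw [AlgEquiv.trans_apply, AlgEquiv.symm_apply_eq]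
    ext ⟨i, a⟩ ⟨j, c⟩
    rw [AlgEquiv.trans_apply, LinearMap.toMatrixAlgEquiv_apply, Matrix.toLinAlgEquiv'_apply, hb]
    simp only [Matrix.compAlgEquiv_apply, Matrix.comp_apply, Matrix.scalar_apply,
      Matrix.diagonal_apply]
    by_cases hij : i = j
    · subst hij
      rw [if_pos rfl]
      simp only [J, nilpotentJordanBlock, Matrix.of_apply]
      split_ifs with h1 h2 h2
      · omega
      · have : (⟨c - 1, (Nat.sub_le _ _).trans_lt c.2⟩ : Fin 7) = a := Fin.ext (by
          change (c : ℕ) - 1 = a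
          omega)
        rw [this, b.repr_self, Finsupp.single_eq_same]
      · simp
      · rw [b.repr_self, Finsupp.single_eq_of_ne]
        intro h
        have : (a : ℕ) = c - 1 := congrArg (fun p : Fin 2 × Fin 7 => (p.2 : ℕ)) h
        omega
    · rw [if_neg hij]
      split_ifs with h1
      · simp
      · rw [b.repr_self, Finsupp.single_eq_of_ne]
        · rfl
        · intro h
          exact hij (congrArg Prod.fst h)
  refine ⟨Θ.toAlgHom.comp (aeval J).mapMatrix, ?_, ?_, ?_⟩
  · rw [← hΘe]
    change Θ _ = _
    congr 1
    ext i j : 1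
    by_cases hij : i = j
    · subst hij; simp
    · simp [hij]
  · intro y hy
    obtain ⟨A, rfl⟩ := Θ.surjective y
    have hA : Matrix.scalar _ J * A = A * Matrix.scalar _ J := by
      apply Θ.injective
      rw [map_mul, map_mul, hΘe, hy]
    have : ∀ i j, ∃ p : k[X], aeval J p = A i j := fun i j =>
      exists_aeval_eq_of_commute (by
        have := congrFun (congrFun hA i) j
        simp only [Matrix.scalar_apply, Matrix.diagonal_mul, Matrix.mul_diagonal] at this
        exact this)
    choose P hP using this
    refine ⟨Matrix.of P, ?_⟩
    change Θ _ = _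
    congr 1
    ext i j : 1
    simp [hP]
  · intro P
    change Θ _ = 0 ↔ _
    rw [map_eq_zero_iff _ Θ.injective, ← Matrix.ext_iff]
    simp [J, aeval_nilpotentJordanBlock_eq_zero_iff]

end SevenSeven

/-! ### The two components for type `7²` -/

section Components77

open Polynomial

variable {k : Type*} [Field k] {n : ℕ}

theorem finrank_degreeLT (m : ℕ) : Module.finrank k (degreeLT k m) = m := by
  rw [LinearEquiv.finrank_eq (degreeLTEquiv k m), Module.finrank_fin_fun]

instance (m : ℕ) : FiniteDimensional k (degreeLT k m) :=
  (degreeLTEquiv k m).symm.finiteDimensional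

theorem eq_zero_of_mem_degreeLT_of_dvd {m : ℕ} {p : k[X]} (hp : p ∈ degreeLT k m)
    (h : X ^ m ∣ p) : p = 0 := by
  rw [mem_degreeLT] at hp
  refine eq_zero_of_dvd_of_degree_lt h ?_
  rwa [degree_X_pow]

theorem modByMonic_mem_degreeLT (m : ℕ) (p : k[X]) : p %ₘ X ^ m ∈ degreeLT k m := by
  rw [mem_degreeLT, ← degree_X_pow (R := k) m]
  exact degree_modByMonic_lt p (monic_X_pow m)

theorem X_pow_dvd_sub_modByMonic (m : ℕ) (p : k[X]) : X ^ m ∣ p - p %ₘ X ^ m :=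
  ⟨p /ₘ X ^ m, by rw [sub_eq_iff_eq_add', modByMonic_add_div]⟩

/-- Data describing the centralizer of `e` as the ring of `2 × 2` matrices over `k[X] / (X ^ 7)`. -/
structure IsTruncatedMatrixRing (e : Matrix (Fin n) (Fin n) k)
    (Φ : Matrix (Fin 2) (Fin 2) k[X] →ₐ[k] Matrix (Fin n) (Fin n) k) : Prop where
  map_X : Φ (Matrix.scalar _ X) = e
  surj : ∀ y, e * y = y * e → ∃ P, Φ P = y
  eq_zero_iff : ∀ P, Φ P = 0 ↔ ∀ i j, X ^ 7 ∣ P i j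

variable {e : Matrix (Fin n) (Fin n) k}
  {Φ : Matrix (Fin 2) (Fin 2) k[X] →ₐ[k] Matrix (Fin n) (Fin n) k}

namespace IsTruncatedMatrixRing

variable (h : IsTruncatedMatrixRing e Φ)
include h

theorem commute (P : Matrix (Fin 2) (Fin 2) k[X]) : e * Φ P = Φ P * e := by
  rw [← h.map_X, ← map_mul, ← map_mul]
  congr 1
  exact Matrix.scalar_comm _ (fun _ => Commute.all _ _) _

theorem map_pow_mul (m : ℕ) (P : Matrix (Fin 2) (Fin 2) k[X]) :
    e ^ m * Φ P = Φ ((X ^ m : k[X]) • P) := by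
  rw [← h.map_X, ← map_pow, ← map_mul, ← map_pow]
  congr 1
  ext i j : 1
  simp

theorem eq_iff (P Q : Matrix (Fin 2) (Fin 2) k[X]) :
    Φ P = Φ Q ↔ ∀ i j, X ^ 7 ∣ P i j - Q i j := by
  rw [← sub_eq_zero, ← map_sub, h.eq_zero_iff]
  rfl

/-- The image under `Φ` of the multiples of `X ^ q` is parametrized by the matrices with entries of
degree less than `r`, where `q + r = 7`. -/
theorem finrank_shift {q r : ℕ} (hqr : q + r = 7)
    {N : Submodule k (Matrix (Fin n) (Fin n) k)}
    (hN : ∀ y, y ∈ N ↔ ∃ P, Φ ((X ^ q : k[X]) • P) = y) : Module.finrank k N = 4 * r := by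
  let L : Matrix (Fin 2) (Fin 2) (degreeLT k r) →ₗ[k] Matrix (Fin n) (Fin n) k :=
    { toFun := fun P => Φ ((X ^ q : k[X]) • P.map Subtype.val)
      map_add' := by
        intro P Q
        rw [← map_add, ← smul_add]
        rfl
      map_smul' := by
        intro c P
        rw [RingHom.id_apply, ← map_smul]
        congr 1
        ext i j : 1
        simp }
  have hL : LinearMap.ker L = ⊥ := by
    rw [LinearMap.ker_eq_bot']
    intro P hP
    ext i j : 2
    refine eq_zero_of_mem_degreeLT_of_dvd (P i j).2 ?_
    have h1 : X ^ 7 ∣ X ^ q * (P i j : k[X]) := (h.eq_zero_iff _).1 hP i j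
    rw [← hqr, pow_add] at h1
    exact (mul_dvd_mul_iff_left (pow_ne_zero _ X_ne_zero)).1 h1
  have hr : N = LinearMap.range L := by
    ext y
    rw [hN]
    constructor
    · rintro ⟨P, rfl⟩
      refine ⟨Matrix.of fun i j => ⟨P i j %ₘ X ^ r, modByMonic_mem_degreeLT _ _⟩, ?_⟩
      refine (h.eq_iff _ _).2 fun i j => ?_
      change X ^ 7 ∣ X ^ q * (P i j %ₘ X ^ r) - X ^ q * P i j
      rw [← mul_sub, ← hqr, pow_add]
      refine mul_dvd_mul_left _ ?_
      rw [dvd_sub_comm]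
      exact X_pow_dvd_sub_modByMonic r _
    · rintro ⟨P, rfl⟩
      exact ⟨_, rfl⟩
  rw [hr, LinearMap.finrank_range_of_inj (LinearMap.ker_eq_bot.1 hL), Module.finrank_matrix,
    finrank_degreeLT]
  simp

theorem finrank_glCentralizer : Module.finrank k (glCentralizer e) = 28 := by
  refine h.finrank_shift (q := 0) (r := 7) rfl fun y => ?_
  rw [mem_glCentralizer]
  constructor
  · intro hy
    obtain ⟨P, rfl⟩ := h.surj y hy
    exact ⟨P, by simp⟩
  · rintro ⟨P, rfl⟩
    exact h.commute _

end IsTruncatedMatrixRing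

/-- The matrices `y` in the centralizer of `e` with `e ^ 6 * y = 0`. For `e` of type `7²` these are
the multiples of `e` in the centralizer. -/
def sixthAnnihilator (e : Matrix (Fin n) (Fin n) k) : Submodule k (Matrix (Fin n) (Fin n) k) :=
  glCentralizer e ⊓ LinearMap.ker (LinearMap.mulLeft k (e ^ 6))

theorem mem_sixthAnnihilator {y : Matrix (Fin n) (Fin n) k} :
    y ∈ sixthAnnihilator e ↔ e * y = y * e ∧ e ^ 6 * y = 0 := by
  rw [sixthAnnihilator, Submodule.mem_inf, mem_glCentralizer]
  rfl

namespace IsTruncatedMatrixRing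

variable (h : IsTruncatedMatrixRing e Φ)
include h

theorem mem_sixthAnnihilator_iff (y : Matrix (Fin n) (Fin n) k) :
    y ∈ sixthAnnihilator e ↔ ∃ P, Φ ((X ^ 1 : k[X]) • P) = y := by
  rw [mem_sixthAnnihilator]
  constructor
  · rintro ⟨h1, h2⟩
    obtain ⟨P, rfl⟩ := h.surj y h1
    rw [h.map_pow_mul, h.eq_zero_iff] at h2
    have : ∀ i j, X ∣ P i j := fun i j => by
      have h3 : X ^ 6 * X ∣ X ^ 6 * P i j := h2 i j
      exact (mul_dvd_mul_iff_left (pow_ne_zero _ X_ne_zero)).1 h3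
    choose Q hQ using this
    refine ⟨Matrix.of Q, ?_⟩
    congr 1
    ext i j : 1
    simp [hQ i j]
  · rintro ⟨P, rfl⟩
    refine ⟨h.commute _, ?_⟩
    rw [h.map_pow_mul, h.eq_zero_iff]
    intro i j
    simp [← mul_assoc, ← pow_succ]

theorem finrank_sixthAnnihilator : Module.finrank k (sixthAnnihilator e) = 24 :=
  h.finrank_shift (q := 1) (r := 6) rfl h.mem_sixthAnnihilator_iff

theorem sixthAnnihilator_subset : (sixthAnnihilator e : Set (Matrix (Fin n) (Fin n) k)) ⊆
    nilCentralizer 7 e := by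
  intro y hy
  refine ⟨(mem_sixthAnnihilator.1 hy).1 |> mem_glCentralizer.2, ?_⟩
  obtain ⟨P, rfl⟩ := (h.mem_sixthAnnihilator_iff y).1 hy
  change _ ^ 7 = 0
  rw [← map_pow, _root_.smul_pow, h.eq_zero_iff]
  intro i j
  simp

end IsTruncatedMatrixRing

end Components77

/-! ### The generic part of the nilpotent centralizer for type `7²` -/

section GenericComponent

open Polynomial

variable {k : Type*} [Field k] {n : ℕ}

theorem exists_X_pow_dvd_mul_sub_one (m : ℕ) {b : k[X]} (hb : ¬ X ∣ b) :
    ∃ u, X ^ m ∣ b * u - 1 := by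
  obtain ⟨s, t, hst⟩ := ((irreducible_X.coprime_iff_not_dvd).2 hb).pow_left (m := m)
  exact ⟨t, -s, by linear_combination hst⟩

theorem X_pow_three_dvd_of_X_pow_seven_dvd {D : k[X]} (h : X ^ 7 ∣ D ^ 3) : X ^ 3 ∣ D := by
  obtain ⟨D₁, rfl⟩ : X ∣ D := prime_X.dvd_of_dvd_pow ((dvd_pow_self X (by norm_num)).trans h)
  have h1 : X ^ 4 ∣ D₁ ^ 3 := by
    rw [mul_pow, show (X : k[X]) ^ 7 = X ^ 3 * X ^ 4 by ring] at h
    exact (mul_dvd_mul_iff_left (pow_ne_zero _ X_ne_zero)).1 h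
  obtain ⟨D₂, rfl⟩ : X ∣ D₁ := prime_X.dvd_of_dvd_pow ((dvd_pow_self X (by norm_num)).trans h1)
  have h2 : X ^ 1 ∣ D₂ ^ 3 := by
    rw [mul_pow, show (X : k[X]) ^ 4 = X ^ 3 * X ^ 1 by ring] at h1
    exact (mul_dvd_mul_iff_left (pow_ne_zero _ X_ne_zero)).1 h1
  rw [pow_one] at h2
  obtain ⟨D₃, rfl⟩ : X ∣ D₂ := prime_X.dvd_of_dvd_pow h2
  exact ⟨D₃, by ring⟩

/-- The matrices `y` in the centralizer of `e` with `y ^ 7 = 0` and `e ^ 6 * y ≠ 0`. -/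
def genericNilCentralizer (e : Matrix (Fin n) (Fin n) k) : Set (Matrix (Fin n) (Fin n) k) :=
  {y | e * y = y * e ∧ y ^ 7 = 0 ∧ e ^ 6 * y ≠ 0}

variable {e : Matrix (Fin n) (Fin n) k}
  {Φ : Matrix (Fin 2) (Fin 2) k[X] →ₐ[k] Matrix (Fin n) (Fin n) k}

/-- The seventh power is additive on commuting elements in characteristic `7`, and the square of a
trace-free matrix is scalar. -/
theorem scalar_add_pow_seven [CharP k 7] (t a b c : k[X]) :
    (!![t + a, b; c, t - a] : Matrix (Fin 2) (Fin 2) k[X]) ^ 7 =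
      Matrix.scalar _ (t ^ 7) + (a ^ 2 + b * c) ^ 3 • !![a, b; c, -a] := by
  have : Fact (Nat.Prime 7) := ⟨by norm_num⟩
  have hZ : (!![a, b; c, -a] : Matrix (Fin 2) (Fin 2) k[X]) ^ 2 =
      Matrix.scalar _ (a ^ 2 + b * c) := by
    rw [pow_two, Matrix.mul_fin_two]
    ext i j : 1
    fin_cases i <;> fin_cases j <;> simp <;> ring
  have hT : (!![t + a, b; c, t - a] : Matrix (Fin 2) (Fin 2) k[X]) =
      Matrix.scalar _ t + !![a, b; c, -a] := by
    ext i j : 1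
    fin_cases i <;> fin_cases j <;> simp [sub_eq_add_neg]
  rw [hT, add_pow_char_of_commute 7 (Matrix.scalar_commute _ (fun _ => Commute.all _ _) _),
    ← map_pow, show (!![a, b; c, -a] : Matrix (Fin 2) (Fin 2) k[X]) ^ 7 =
      (!![a, b; c, -a] ^ 2) ^ 3 * !![a, b; c, -a] by rw [← pow_mul, ← pow_succ], hZ, ← map_pow]
  congr 1
  ext i j : 1
  simp

namespace IsTruncatedMatrixRing

variable (h : IsTruncatedMatrixRing e Φ)
include h

theorem map_scalar_inv {m : ℕ} (hm : 7 ≤ m) {b u : k[X]} (hu : X ^ m ∣ b * u - 1) :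
    Φ (Matrix.scalar _ b) * Φ (Matrix.scalar _ u) = 1 := by
  rw [← map_mul, ← map_one Φ, ← map_mul, h.eq_iff]
  intro i j
  fin_cases i <;> fin_cases j <;> simp [(pow_dvd_pow X hm).trans hu]

/-- The trace of `P` is a multiple of `X`, and the determinant of its trace-free part is a multiple
of `X ^ 3`. -/
theorem normal_form [CharP k 7] {P : Matrix (Fin 2) (Fin 2) k[X]}
    (hP : Φ P ∈ genericNilCentralizer e) :
    ∃ τ a d, P = !![X * τ + a, P 0 1; P 1 0, X * τ - a] ∧ X ^ 3 * d = a ^ 2 + P 0 1 * P 1 0 ∧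
      ¬ (X ∣ a ∧ X ∣ P 0 1 ∧ X ∣ P 1 0) := by
  have two : (2 : k) ≠ 0 := by
    intro h2
    have := (CharP.cast_eq_zero_iff k 7 2).1 (by exact_mod_cast h2)
    omega
  have hC : C (2⁻¹ : k) * 2 = 1 := by
    rw [show (2 : k[X]) = C 2 from rfl, ← C_mul, inv_mul_cancel₀ two, C_1]
  obtain ⟨-, h7, h6⟩ := hP
  obtain ⟨t, ht⟩ : ∃ t, t = C (2⁻¹ : k) * (P 0 0 + P 1 1) := ⟨_, rfl⟩
  obtain ⟨a, ha⟩ : ∃ a, a = C (2⁻¹ : k) * (P 0 0 - P 1 1) := ⟨_, rfl⟩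
  have hPeq : P = !![t + a, P 0 1; P 1 0, t - a] := by
    ext i j : 1
    fin_cases i <;> fin_cases j <;> simp
    · linear_combination -ht - ha - P 0 0 * hC
    · linear_combination -ht + ha - P 1 1 * hC
  obtain ⟨b, hb⟩ : ∃ b, b = P 0 1 := ⟨_, rfl⟩
  obtain ⟨c, hc⟩ : ∃ c, c = P 1 0 := ⟨_, rfl⟩
  rw [← hb, ← hc] at hPeq ⊢
  rw [hPeq, ← map_pow, scalar_add_pow_seven, h.eq_zero_iff] at h7
  have e00 : X ^ 7 ∣ t ^ 7 + (a ^ 2 + b * c) ^ 3 * a := by simpa using h7 0 0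
  have e01 : X ^ 7 ∣ (a ^ 2 + b * c) ^ 3 * b := by simpa using h7 0 1
  have e10 : X ^ 7 ∣ (a ^ 2 + b * c) ^ 3 * c := by simpa using h7 1 0
  have e11 : X ^ 7 ∣ t ^ 7 - (a ^ 2 + b * c) ^ 3 * a := by simpa [sub_eq_add_neg] using h7 1 1
  have ht7 : X ^ 7 ∣ t ^ 7 := by
    have := (dvd_add e00 e11).mul_left (C (2⁻¹ : k))
    rwa [show C (2⁻¹ : k) * (t ^ 7 + (a ^ 2 + b * c) ^ 3 * a +
      (t ^ 7 - (a ^ 2 + b * c) ^ 3 * a)) = t ^ 7 by linear_combination t ^ 7 * hC] at this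
  obtain ⟨τ, rfl⟩ : X ∣ t := prime_X.dvd_of_dvd_pow ((dvd_pow_self X (by norm_num)).trans ht7)
  have ea : X ^ 7 ∣ (a ^ 2 + b * c) ^ 3 * a := (dvd_add_right ht7).1 e00
  have hunit : ¬ (X ∣ a ∧ X ∣ b ∧ X ∣ c) := by
    rintro ⟨⟨a, rfl⟩, ⟨b, rfl⟩, ⟨c, rfl⟩⟩
    refine h6 ?_
    rw [hPeq, h.map_pow_mul, h.eq_zero_iff]
    have key : ∀ q : k[X], X ^ 7 ∣ X ^ 6 * (X * q) := fun q => ⟨q, by ring⟩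
    intro i j
    fin_cases i <;> fin_cases j <;> simp only [Matrix.smul_apply, smul_eq_mul, Fin.zero_eta,
      Fin.mk_one, Matrix.of_apply, Matrix.cons_val_zero, Matrix.cons_val_one, Matrix.cons_val',
      Matrix.cons_val_fin_one, ← mul_add, ← mul_sub, key]
  have hD : X ^ 7 ∣ (a ^ 2 + b * c) ^ 3 := by
    have aux : ∀ q : k[X], X ^ 7 ∣ (a ^ 2 + b * c) ^ 3 * q → ¬ X ∣ q →
        X ^ 7 ∣ (a ^ 2 + b * c) ^ 3 := fun q hq hX =>
      (((irreducible_X.coprime_iff_not_dvd).2 hX).pow_left).dvd_of_dvd_mul_right hq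
    by_cases h1 : X ∣ a
    · by_cases h2 : X ∣ b
      · exact aux c e10 fun h3 => hunit ⟨h1, h2, h3⟩
      · exact aux b e01 h2
    · exact aux a ea h1
  obtain ⟨d, hd⟩ := X_pow_three_dvd_of_X_pow_seven_dvd hD
  exact ⟨τ, a, d, hPeq, hd.symm, hunit⟩

end IsTruncatedMatrixRing

/-- The parametrization of the elements of the generic part of the nilpotent centralizer whose
upper right entry is a unit: the trace is divisible by `X`, the determinant of the trace-free part
is `-X ^ 3 * d`, and the lower left entry is determined by these data. -/
noncomputable def genericChart (Φ : Matrix (Fin 2) (Fin 2) k[X] →ₐ[k] Matrix (Fin n) (Fin n) k)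
    (a b d τ : k[X]) : Matrix (Fin n) (Fin n) k :=
  Φ !![X * τ + a, b; 0, X * τ - a] + Φ !![0, 0; 1, 0] *
    (Φ (Matrix.scalar _ (X ^ 3 * d)) - Φ (Matrix.scalar _ a) ^ 2) * (Φ (Matrix.scalar _ b))⁻¹

namespace IsTruncatedMatrixRing

variable (h : IsTruncatedMatrixRing e Φ)
include h

theorem genericChart_eq (a d τ : k[X]) {b u : k[X]} (hu : X ^ 7 ∣ b * u - 1) :
    genericChart Φ a b d τ = Φ !![X * τ + a, b; (X ^ 3 * d - a ^ 2) * u, X * τ - a] := by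
  rw [genericChart, Matrix.inv_eq_right_inv (h.map_scalar_inv le_rfl hu), ← map_pow Φ,
    ← map_pow (Matrix.scalar _), ← map_sub Φ, ← map_sub (Matrix.scalar _), ← map_mul, ← map_mul,
    ← map_add]
  congr 1
  ext i j : 1
  fin_cases i <;> fin_cases j <;> simp [Matrix.scalar_apply]

theorem genericChart_mem [CharP k 7] (a d τ : k[X]) {b : k[X]} (hb : ¬ X ∣ b) :
    genericChart Φ a b d τ ∈ genericNilCentralizer e := by
  obtain ⟨u, hu⟩ := exists_X_pow_dvd_mul_sub_one 7 hb
  rw [h.genericChart_eq a d τ hu]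
  refine ⟨h.commute _, ?_, fun h6 => hb ?_⟩
  · rw [← map_pow, scalar_add_pow_seven, h.eq_zero_iff]
    obtain ⟨w, hw⟩ := hu
    have h3 : X ^ 7 ∣ (a ^ 2 + b * ((X ^ 3 * d - a ^ 2) * u)) ^ 3 := by
      refine (pow_dvd_pow X (by norm_num : 7 ≤ 9)).trans
        ⟨(d + X ^ 4 * w * (X ^ 3 * d - a ^ 2)) ^ 3, ?_⟩
      rw [show b * ((X ^ 3 * d - a ^ 2) * u) = (X ^ 3 * d - a ^ 2) * (1 + X ^ 7 * w) by
        linear_combination (X ^ 3 * d - a ^ 2) * hw]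
      ring
    have ht : X ^ 7 ∣ (X * τ) ^ 7 := by rw [mul_pow]; exact dvd_mul_right _ _
    intro i j
    rw [Matrix.add_apply, Matrix.smul_apply, smul_eq_mul]
    refine dvd_add ?_ (h3.mul_right _)
    rw [Matrix.scalar_apply, Matrix.diagonal_apply]
    split_ifs
    · exact ht
    · exact dvd_zero _
  · rw [h.map_pow_mul, h.eq_zero_iff] at h6
    have h1 : X ^ 6 * X ∣ X ^ 6 * b := h6 0 1
    exact (mul_dvd_mul_iff_left (pow_ne_zero _ X_ne_zero)).1 h1

/-- Modulo `X ^ 7`, the lower left entry is determined by the determinant of the trace-free part and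
the other entries when the upper right entry is a unit. -/
theorem exists_eq_genericChart [CharP k 7] {P : Matrix (Fin 2) (Fin 2) k[X]}
    (hP : Φ P ∈ genericNilCentralizer e) (hb : ¬ X ∣ P 0 1) :
    ∃ a ∈ degreeLT k 7, ∃ b ∈ degreeLT k 7, ∃ d ∈ degreeLT k 4, ∃ τ ∈ degreeLT k 6,
      ¬ X ∣ b ∧ genericChart Φ a b d τ = Φ P := by
  obtain ⟨τ, a, d, hPeq, hd, -⟩ := h.normal_form hP
  obtain ⟨b, hb'⟩ : ∃ b, b = P 0 1 := ⟨_, rfl⟩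
  obtain ⟨c, hc'⟩ : ∃ c, c = P 1 0 := ⟨_, rfl⟩
  rw [← hb'] at hb
  rw [← hb', ← hc'] at hd hPeq
  obtain ⟨wa, hwa⟩ := X_pow_dvd_sub_modByMonic 7 a
  obtain ⟨wb, hwb⟩ := X_pow_dvd_sub_modByMonic 7 b
  obtain ⟨wd, hwd⟩ := X_pow_dvd_sub_modByMonic 4 d
  obtain ⟨wt, hwt⟩ := X_pow_dvd_sub_modByMonic 6 τ
  have hbX : ¬ X ∣ b %ₘ X ^ 7 := fun hX => hb <| by
    have := dvd_add hX ((dvd_pow_self X (by norm_num : 7 ≠ 0)).mul_right wb)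
    rwa [← hwb, add_sub_cancel] at this
  refine ⟨a %ₘ X ^ 7, modByMonic_mem_degreeLT _ _, b %ₘ X ^ 7, modByMonic_mem_degreeLT _ _,
    d %ₘ X ^ 4, modByMonic_mem_degreeLT _ _, τ %ₘ X ^ 6, modByMonic_mem_degreeLT _ _, hbX, ?_⟩
  obtain ⟨u, w, hw⟩ := exists_X_pow_dvd_mul_sub_one 7 hbX
  rw [h.genericChart_eq _ _ _ ⟨w, hw⟩, hPeq, h.eq_iff]
  generalize a %ₘ X ^ 7 = a' at *
  generalize b %ₘ X ^ 7 = b' at *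
  generalize d %ₘ X ^ 4 = d' at *
  generalize τ %ₘ X ^ 6 = τ' at *
  intro i j
  fin_cases i <;> fin_cases j
  · exact ⟨-wt - wa, by simp; linear_combination -X * hwt - hwa⟩
  · exact ⟨-wb, by simp; linear_combination -hwb⟩
  · refine ⟨c * w + c * wb * u + (-wd + 2 * a * wa - X ^ 7 * wa ^ 2) * u, ?_⟩
    obtain rfl : a' = a - X ^ 7 * wa := by linear_combination -hwa
    obtain rfl : d' = d - X ^ 4 * wd := by linear_combination -hwd
    obtain rfl : b' = b - X ^ 7 * wb := by linear_combination -hwb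
    simp
    linear_combination u * hd + c * hw
  · exact ⟨-wt + wa, by simp; linear_combination -X * hwt + hwa⟩

end IsTruncatedMatrixRing

end GenericComponent

/-! ### A chart of the generic part -/

section GenericComponentGeometry

open Polynomial

variable {k : Type*} [Field k] {n : ℕ}

variable {e : Matrix (Fin n) (Fin n) k}
  {Φ : Matrix (Fin 2) (Fin 2) k[X] →ₐ[k] Matrix (Fin n) (Fin n) k}

/-- The parameter space of `genericChart`: the tuples `(a, b, d, τ)` of truncated polynomials. -/
abbrev GenericParameters (k : Type*) [Field k] : Type _ :=
  degreeLT k 7 × degreeLT k 7 × degreeLT k 4 × degreeLT k 6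

theorem finrank_genericParameters : Module.finrank k (GenericParameters k) = 24 := by
  simp [GenericParameters, Module.finrank_prod, finrank_degreeLT]

/-- The parameters for which the upper right entry `b` is a unit. -/
def genericParameterSet (k : Type*) [Field k] : Set (GenericParameters k) :=
  {f | (f.2.1 : k[X]).coeff 0 ≠ 0}

theorem not_X_dvd_of_mem_genericParameterSet {f : GenericParameters k}
    (hf : f ∈ genericParameterSet k) : ¬ X ∣ (f.2.1 : k[X]) := by
  rwa [X_dvd_iff]

/-- The `k`-linear map sending `(a, b, τ, c)` to the matrix with trace `2 * X * τ`, diagonal part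
`a` and off-diagonal entries `b` and `c`. -/
noncomputable def normalFormLinear (k : Type*) [Field k] :
    k[X] × k[X] × k[X] × k[X] →ₗ[k] Matrix (Fin 2) (Fin 2) k[X] where
  toFun f := !![X * f.2.2.1 + f.1, f.2.1; f.2.2.2, X * f.2.2.1 - f.1]
  map_add' f g := by
    ext i j : 1
    fin_cases i <;> fin_cases j <;> simp <;> ring
  map_smul' c f := by
    ext i j : 1
    fin_cases i <;> fin_cases j <;> simp [smul_sub]

/-- The `k`-linear map `p ↦ Φ (p • 1)`. -/
noncomputable def scalarLinear
    (Φ : Matrix (Fin 2) (Fin 2) k[X] →ₐ[k] Matrix (Fin n) (Fin n) k) :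
    k[X] →ₗ[k] Matrix (Fin n) (Fin n) k :=
  (Φ.comp (Matrix.scalarAlgHom (Fin 2) k)).toLinearMap

theorem scalarLinear_apply (p : k[X]) : scalarLinear Φ p = Φ (Matrix.scalar _ p) := rfl

theorem proj_eq_of_eq_mk {α β γ δ : Type*} {z : α × β × γ × δ} {a : α} {b : β} {c : γ} {d : δ}
    (h : z = (a, b, c, d)) : z.1 = a ∧ z.2.1 = b ∧ z.2.2.1 = c := by
  subst h
  exact ⟨rfl, rfl, rfl⟩

namespace IsTruncatedMatrixRing

variable (h : IsTruncatedMatrixRing e Φ)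
include h

/-- The parameters `a`, `b`, `τ` and the lower left entry can be read off linearly. -/
theorem exists_normalForm_leftInverse [CharP k 7] :
    ∃ Λ : Matrix (Fin n) (Fin n) k →ₗ[k]
      degreeLT k 7 × degreeLT k 7 × degreeLT k 6 × degreeLT k 7,
      ∀ (a b : degreeLT k 7) (τ : degreeLT k 6) (c : degreeLT k 7),
        Λ (Φ !![X * (τ : k[X]) + (a : k[X]), (b : k[X]); (c : k[X]),
          X * (τ : k[X]) - (a : k[X])]) =
        (a, b, τ, c) := by
  have two : (2 : k) ≠ 0 := by
    intro h2
    have := (CharP.cast_eq_zero_iff k 7 2).1 (by exact_mod_cast h2)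
    omega
  have hC : C (2⁻¹ : k) * 2 = 1 := by
    rw [show (2 : k[X]) = C 2 from rfl, ← C_mul, inv_mul_cancel₀ two, C_1]
  let L : degreeLT k 7 × degreeLT k 7 × degreeLT k 6 × degreeLT k 7 →ₗ[k]
      Matrix (Fin n) (Fin n) k :=
    Φ.toLinearMap ∘ₗ normalFormLinear k ∘ₗ ((degreeLT k 7).subtype.prodMap
      ((degreeLT k 7).subtype.prodMap ((degreeLT k 6).subtype.prodMap (degreeLT k 7).subtype)))
  have hL : LinearMap.ker L = ⊥ := by
    rw [LinearMap.ker_eq_bot']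
    rintro ⟨a, b, τ, c⟩ h0
    have h1 := (h.eq_zero_iff _).1 h0
    have e00 : X ^ 7 ∣ X * (τ : k[X]) + (a : k[X]) := h1 0 0
    have e01 : X ^ 7 ∣ (b : k[X]) := h1 0 1
    have e10 : X ^ 7 ∣ (c : k[X]) := h1 1 0
    have e11 : X ^ 7 ∣ X * (τ : k[X]) - (a : k[X]) := h1 1 1
    have ea : X ^ 7 ∣ (a : k[X]) := by
      have := (dvd_sub e00 e11).mul_left (C (2⁻¹ : k))
      rwa [show C (2⁻¹ : k) * (X * (τ : k[X]) + (a : k[X]) -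
        (X * (τ : k[X]) - (a : k[X]))) = (a : k[X]) by
        linear_combination (a : k[X]) * hC] at this
    have et : X ^ 6 ∣ (τ : k[X]) := by
      have h2 : X * X ^ 6 ∣ X * (τ : k[X]) := by
        rw [← pow_succ']; exact (dvd_add_left ea).1 e00
      exact (mul_dvd_mul_iff_left X_ne_zero).1 h2
    have ha : a = 0 := Subtype.ext (eq_zero_of_mem_degreeLT_of_dvd a.2 ea)
    have hb : b = 0 := Subtype.ext (eq_zero_of_mem_degreeLT_of_dvd b.2 e01)
    have hc : c = 0 := Subtype.ext (eq_zero_of_mem_degreeLT_of_dvd c.2 e10)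
    have ht : τ = 0 := Subtype.ext (eq_zero_of_mem_degreeLT_of_dvd τ.2 et)
    rw [ha, hb, hc, ht]
    rfl
  obtain ⟨Λ, hΛ⟩ := L.exists_leftInverse_of_injective hL
  exact ⟨Λ, fun a b τ c => LinearMap.congr_fun hΛ (a, b, τ, c)⟩

/-- The parameter `d` can be read off linearly from `Φ (X ^ 3 * d)`. -/
theorem exists_discriminant_leftInverse :
    ∃ Λ : Matrix (Fin n) (Fin n) k →ₗ[k] degreeLT k 4,
      ∀ d : degreeLT k 4, Λ (Φ (Matrix.scalar _ (X ^ 3 * (d : k[X])))) = d := by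
  let L : degreeLT k 4 →ₗ[k] Matrix (Fin n) (Fin n) k :=
    scalarLinear Φ ∘ₗ LinearMap.mulLeft k (X ^ 3) ∘ₗ (degreeLT k 4).subtype
  have hL : LinearMap.ker L = ⊥ := by
    rw [LinearMap.ker_eq_bot']
    intro d h0
    have h1 : X ^ 7 ∣ X ^ 3 * (d : k[X]) := by simpa using (h.eq_zero_iff _).1 h0 0 0
    rw [show 7 = 3 + 4 from rfl, pow_add] at h1
    exact Subtype.ext (eq_zero_of_mem_degreeLT_of_dvd d.2
      ((mul_dvd_mul_iff_left (pow_ne_zero _ X_ne_zero)).1 h1))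
  obtain ⟨Λ, hΛ⟩ := L.exists_leftInverse_of_injective hL
  exact ⟨Λ, fun d => LinearMap.congr_fun hΛ d⟩

theorem det_scalar_ne_zero {b : k[X]} (hb : ¬ X ∣ b) : (Φ (Matrix.scalar _ b)).det ≠ 0 := by
  obtain ⟨u, hu⟩ := exists_X_pow_dvd_mul_sub_one 7 hb
  intro h0
  have := congrArg Matrix.det (h.map_scalar_inv le_rfl hu)
  rw [Matrix.det_mul, h0, zero_mul, Matrix.det_one] at this
  exact zero_ne_one this

theorem exists_genericChart_eq [CharP k 7] (f : genericParameterSet k) :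
    ∃ c : degreeLT k 7, genericChart Φ f.1.1 f.1.2.1 f.1.2.2.1 f.1.2.2.2 =
      Φ !![X * (f.1.2.2.2 : k[X]) + (f.1.1 : k[X]), (f.1.2.1 : k[X]);
        (c : k[X]), X * (f.1.2.2.2 : k[X]) - (f.1.1 : k[X])] ∧
      X ^ 7 ∣ (f.1.1 : k[X]) ^ 2 + (f.1.2.1 : k[X]) * (c : k[X]) - X ^ 3 * (f.1.2.2.1 : k[X]) := by
  obtain ⟨⟨a, b, d, τ⟩, hf⟩ := f
  obtain ⟨u, w, hw⟩ := exists_X_pow_dvd_mul_sub_one 7 (not_X_dvd_of_mem_genericParameterSet hf)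
  change (b : k[X]) * u - 1 = _ at hw
  obtain ⟨v, hv⟩ := X_pow_dvd_sub_modByMonic 7 ((X ^ 3 * (d : k[X]) - (a : k[X]) ^ 2) * u)
  refine ⟨⟨((X ^ 3 * (d : k[X]) - (a : k[X]) ^ 2) * u) %ₘ X ^ 7, modByMonic_mem_degreeLT _ _⟩,
    ?_, ?_⟩
  · refine (h.genericChart_eq _ _ _ ⟨w, hw⟩).trans ?_
    rw [h.eq_iff]
    intro i j
    fin_cases i <;> fin_cases j
    · simp
    · simp
    · exact ⟨v, hv⟩
    · simp
  · refine ⟨(X ^ 3 * (d : k[X]) - (a : k[X]) ^ 2) * w - (b : k[X]) * v, ?_⟩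
    change (a : k[X]) ^ 2 + (b : k[X]) * (((X ^ 3 * (d : k[X]) - (a : k[X]) ^ 2) * u) %ₘ X ^ 7) -
      X ^ 3 * (d : k[X]) = _
    linear_combination (X ^ 3 * (d : k[X]) - (a : k[X]) ^ 2) * hw - (b : k[X]) * hv

/-- The elements of the generic part whose upper right entry is a unit are dense in it. -/
theorem mem_closure_genericChart [Infinite k] [CharP k 7] :
    genericNilCentralizer e ⊆ zariskiClosure k (Set.range fun f : genericParameterSet k =>
      genericChart Φ f.1.1 f.1.2.1 f.1.2.2.1 f.1.2.2.2) := by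
  have key : ∀ P : Matrix (Fin 2) (Fin 2) k[X], Φ P ∈ genericNilCentralizer e → ¬ X ∣ P 0 1 →
      Φ P ∈ Set.range fun f : genericParameterSet k =>
        genericChart Φ f.1.1 f.1.2.1 f.1.2.2.1 f.1.2.2.2 := by
    intro P hP hb
    obtain ⟨a, ha, b, hb, d, hd, τ, hτ, hbX, hy⟩ := h.exists_eq_genericChart hP hb
    exact ⟨⟨(⟨a, ha⟩, ⟨b, hb⟩, ⟨d, hd⟩, ⟨τ, hτ⟩), by rwa [X_dvd_iff] at hbX⟩, hy⟩
  intro y hy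
  obtain ⟨P, rfl⟩ := h.surj y hy.1
  by_cases hb : X ∣ P 0 1
  swap
  · exact subset_zariskiClosure _ (key P hy hb)
  -- otherwise conjugate by the unipotent matrices `1 + s * E₀₁` and let `s` tend to `0`
  obtain ⟨τ, a, d, hPeq, hd, hunit⟩ := h.normal_form hy
  have ha : X ∣ a := by
    refine prime_X.dvd_of_dvd_pow (n := 2) ?_
    rw [← dvd_add_left (hb.mul_right (P 1 0)), ← hd]
    exact (dvd_pow_self X (by norm_num)).mul_right d
  have hc : ¬ X ∣ P 1 0 := fun hc => hunit ⟨ha, hb, hc⟩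
  let ψ : k → Matrix (Fin n) (Fin n) k := fun s =>
    (1 + s • Φ !![0, 1; 0, 0]) * Φ P * (1 + (-s) • Φ !![0, 1; 0, 0])
  have hψ : CoordsIn (regularFunctions k (Set.univ : Set k)) fun s : (Set.univ : Set k) => ψ s := by
    have hs : (fun s : (Set.univ : Set k) => (s : k)) ∈ regularFunctions k (Set.univ : Set k) :=
      coordsIn_scalar.1 (coordsIn_regularIn _)
    exact (((coordsIn_const _).add ((coordsIn_const _).smul hs)).mul (coordsIn_const _)).mul
      ((coordsIn_const _).add ((coordsIn_const _).smul (neg_mem hs)))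
  have hψs : ∀ s : k, ψ s = Φ (!![1, C s; 0, 1] * P * !![1, -C s; 0, 1]) := by
    intro s
    have hU : ∀ r : k, (1 + r • Φ !![0, 1; 0, 0]) = Φ !![1, C r; 0, 1] := fun r => by
      rw [← map_one Φ, ← map_smul Φ, ← map_add]
      refine congrArg Φ ?_
      ext i j : 1
      fin_cases i <;> fin_cases j <;> simp [smul_eq_C_mul]
    simp only [ψ]
    rw [hU, hU, C_neg, map_mul, map_mul]
  have hinv : ∀ s : k,
      (!![1, -C s; 0, 1] : Matrix (Fin 2) (Fin 2) k[X]) * !![1, C s; 0, 1] = 1 := by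
    intro s
    ext i j : 1
    fin_cases i <;> fin_cases j <;> simp
  have hψmem : ∀ s, ψ s ∈ genericNilCentralizer e := by
    intro s
    rw [hψs]
    refine ⟨h.commute _, ?_, fun h6 => hy.2.2 ?_⟩
    · have hconj : ∀ m : ℕ, (!![1, C s; 0, 1] * P * !![1, -C s; 0, 1]) ^ (m + 1) =
          !![1, C s; 0, 1] * P ^ (m + 1) * !![1, -C s; 0, 1] := by
        intro m
        induction m with
        | zero => simp
        | succ m ih =>
          rw [pow_succ, ih, pow_succ P (m + 1)]
          simp only [mul_assoc]
          rw [← mul_assoc !![1, -C s; 0, 1] !![1, C s; 0, 1], hinv, one_mul]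
      rw [← map_pow, hconj 6, map_mul, map_mul, map_pow, hy.2.1, mul_zero, zero_mul]
    · have h1 : P = !![1, -C s; 0, 1] * (!![1, C s; 0, 1] * P * !![1, -C s; 0, 1]) *
          !![1, C s; 0, 1] := by
        simp only [mul_assoc]
        rw [hinv, mul_one, ← mul_assoc, hinv, one_mul]
      rw [h1, map_mul, map_mul, ← mul_assoc, ← mul_assoc]
      have hcomm : Commute (e ^ 6) (Φ !![1, -C s; 0, 1]) :=
        Commute.pow_left (show Commute e _ from h.commute _) 6
      rw [hcomm.eq, mul_assoc (Φ _), h6, mul_zero, zero_mul]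
  have h0 : ψ 0 = Φ P := by simp [ψ]
  rw [← h0]
  refine mem_zariskiClosure_of_isPolyDense (V := {s : k | s ≠ 0})
    (isPolyDense_ne_zero (f := fun s : k => s)
      (dual_mem_polyFunctionsOn (LinearMap.id : k →ₗ[k] k)) ⟨1, one_ne_zero⟩)
    (Set.subset_univ _) hψ (fun s hs => ?_) trivial
  have hm := hψmem s
  rw [hψs] at hm ⊢
  refine subset_zariskiClosure _ (key _ hm ?_)
  have : (!![1, C s; 0, 1] * P * !![1, -C s; 0, 1]) 0 1 =
      P 0 1 + C s * (P 1 1 - P 0 0) - C s ^ 2 * P 1 0 := by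
    simp [Matrix.mul_apply, Matrix.vecMul, dotProduct, Fin.sum_univ_two]
    ring
  rw [this]
  have hPa : P 1 1 - P 0 0 = -2 * a := by
    rw [hPeq]; simp; ring
  rw [hPa]
  intro hX
  refine hc ?_
  have h2 : X ∣ C s ^ 2 * P 1 0 := by
    refine (dvd_sub_right ?_).1 hX
    exact dvd_add hb ((ha.mul_left _).mul_left _)
  rwa [← C_pow, (isUnit_C.2 (pow_ne_zero 2 hs).isUnit).dvd_mul_left] at h2

omit h in
theorem isPolyDense_genericParameterSet [Infinite k] : IsPolyDense k (genericParameterSet k) := by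
  let l : GenericParameters k →ₗ[k] k :=
    lcoeff k 0 ∘ₗ (degreeLT k 7).subtype ∘ₗ LinearMap.fst k _ _ ∘ₗ LinearMap.snd k _ _
  refine isPolyDense_ne_zero (f := fun f => l f) (dual_mem_polyFunctionsOn l)
    ⟨(0, ⟨1, ?_⟩, 0), ?_⟩
  · rw [mem_degreeLT, degree_one]
    exact_mod_cast (by norm_num : (0 : ℕ) < 7)
  · simp [l]

theorem coordsIn_genericChart : CoordsIn (regularFunctions k (genericParameterSet k))
    fun f : genericParameterSet k => genericChart Φ f.1.1 f.1.2.1 f.1.2.2.1 f.1.2.2.2 := by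
  have hval := coordsIn_regularIn (k := k)
    (fun f : genericParameterSet k => (f : GenericParameters k))
  have h1 := hval.linear (Φ.toLinearMap ∘ₗ normalFormLinear k ∘ₗ
    ((degreeLT k 7).subtype ∘ₗ LinearMap.fst k _ _).prod
      (((degreeLT k 7).subtype ∘ₗ LinearMap.fst k _ _ ∘ₗ LinearMap.snd k _ _).prod
        (((degreeLT k 6).subtype ∘ₗ LinearMap.snd k _ _ ∘ₗ LinearMap.snd k _ _ ∘ₗ
          LinearMap.snd k _ _).prod 0)))
  have ha := hval.linear (scalarLinear Φ ∘ₗ (degreeLT k 7).subtype ∘ₗ LinearMap.fst k _ _)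
  have hb := hval.linear (scalarLinear Φ ∘ₗ (degreeLT k 7).subtype ∘ₗ LinearMap.fst k _ _ ∘ₗ
    LinearMap.snd k _ _)
  have hd := hval.linear (scalarLinear Φ ∘ₗ LinearMap.mulLeft k (X ^ 3) ∘ₗ
    (degreeLT k 4).subtype ∘ₗ LinearMap.fst k _ _ ∘ₗ LinearMap.snd k _ _ ∘ₗ LinearMap.snd k _ _)
  exact h1.add (((coordsIn_const (Φ !![0, 0; 1, 0])).mul (hd.sub (ha.pow 2))).mul
    (hb.inv (invClosed_regularIn _) fun f =>
      h.det_scalar_ne_zero (not_X_dvd_of_mem_genericParameterSet f.2)))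

theorem sq_map_normalForm_sub {a b c d τ : k[X]} (hD : X ^ 7 ∣ a ^ 2 + b * c - X ^ 3 * d) :
    (Φ !![X * τ + a, b; c, X * τ - a] - Φ (Matrix.scalar _ (X * τ))) ^ 2 =
      Φ (Matrix.scalar _ (X ^ 3 * d)) := by
  have h1 : (!![X * τ + a, b; c, X * τ - a] : Matrix (Fin 2) (Fin 2) k[X]) -
      Matrix.scalar _ (X * τ) = !![a, b; c, -a] := by
    ext i j : 1
    fin_cases i <;> fin_cases j <;> simp
  rw [← map_sub, ← map_pow, h1, pow_two, Matrix.mul_fin_two, h.eq_iff]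
  obtain ⟨w, hw⟩ := hD
  intro i j
  fin_cases i <;> fin_cases j
  · exact ⟨w, by simp; linear_combination hw⟩
  · exact ⟨0, by simp; ring⟩
  · exact ⟨0, by simp; ring⟩
  · exact ⟨w, by simp; linear_combination hw⟩

theorem exists_genericChart_leftInverse [CharP k 7] :
    ∃ Λ : Matrix (Fin n) (Fin n) k →ₗ[k]
      degreeLT k 7 × degreeLT k 7 × degreeLT k 6 × degreeLT k 7,
      ∀ f : genericParameterSet k, ∃ c : degreeLT k 7,
        Λ (genericChart Φ f.1.1 f.1.2.1 f.1.2.2.1 f.1.2.2.2) =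
          (f.1.1, f.1.2.1, f.1.2.2.2, c) := by
  obtain ⟨Λ, hΛ⟩ := h.exists_normalForm_leftInverse
  refine ⟨Λ, fun f => ?_⟩
  obtain ⟨c, hc, -⟩ := h.exists_genericChart_eq f
  refine ⟨c, ?_⟩
  rw [hc]
  exact hΛ _ _ _ _

theorem coordsIn_genericChart_inv [CharP k 7] :
    CoordsIn (regularIn (k := k) fun f : genericParameterSet k =>
      genericChart Φ f.1.1 f.1.2.1 f.1.2.2.1 f.1.2.2.2)
      (Subtype.val : genericParameterSet k → GenericParameters k) := by
  obtain ⟨Λ, hΛ⟩ := h.exists_genericChart_leftInverse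
  obtain ⟨Λ', hΛ'⟩ := h.exists_discriminant_leftInverse
  have hφ := coordsIn_regularIn (k := k) (fun f : genericParameterSet k =>
    genericChart Φ f.1.1 f.1.2.1 f.1.2.2.1 f.1.2.2.2)
  generalize regularIn (k := k) (fun f : genericParameterSet k =>
    genericChart Φ f.1.1 f.1.2.1 f.1.2.2.1 f.1.2.2.2) = 𝒜 at hφ ⊢
  have hΛφ := hφ.linear Λ
  have h₁ : ∀ f : genericParameterSet k,
      (Λ (genericChart Φ f.1.1 f.1.2.1 f.1.2.2.1 f.1.2.2.2)).1 = f.1.1 := by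
    intro f
    obtain ⟨c, hc⟩ := hΛ f
    exact (proj_eq_of_eq_mk hc).1
  have h₂ : ∀ f : genericParameterSet k,
      (Λ (genericChart Φ f.1.1 f.1.2.1 f.1.2.2.1 f.1.2.2.2)).2.1 = f.1.2.1 := by
    intro f
    obtain ⟨c, hc⟩ := hΛ f
    exact (proj_eq_of_eq_mk hc).2.1
  have h₃ : ∀ f : genericParameterSet k,
      (Λ (genericChart Φ f.1.1 f.1.2.1 f.1.2.2.1 f.1.2.2.2)).2.2.1 = f.1.2.2.2 := by
    intro f
    obtain ⟨c, hc⟩ := hΛ f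
    exact (proj_eq_of_eq_mk hc).2.2
  have ha : CoordsIn 𝒜 fun f : genericParameterSet k => f.1.1 := by
    have h1 := hΛφ.linear (LinearMap.fst k _ _)
    simp only [LinearMap.fst_apply, h₁] at h1
    exact h1
  have hb : CoordsIn 𝒜 fun f : genericParameterSet k => f.1.2.1 := by
    have h1 := (hΛφ.linear (LinearMap.snd k _ _)).linear (LinearMap.fst k _ _)
    simp only [LinearMap.fst_apply, LinearMap.snd_apply, h₂] at h1
    exact h1
  have hτ : CoordsIn 𝒜 fun f : genericParameterSet k => f.1.2.2.2 := by
    have h1 := ((hΛφ.linear (LinearMap.snd k _ _)).linear (LinearMap.snd k _ _)).linear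
      (LinearMap.fst k _ _)
    simp only [LinearMap.fst_apply, LinearMap.snd_apply, h₃] at h1
    exact h1
  have hd : CoordsIn 𝒜 fun f : genericParameterSet k => f.1.2.2.1 := by
    have h1 := ((hφ.sub (hτ.linear (scalarLinear Φ ∘ₗ LinearMap.mulLeft k X ∘ₗ
      (degreeLT k 6).subtype))).pow 2).linear Λ'
    have h2 : ∀ f : genericParameterSet k,
        Λ' ((genericChart Φ f.1.1 f.1.2.1 f.1.2.2.1 f.1.2.2.2 -
          (scalarLinear Φ ∘ₗ LinearMap.mulLeft k X ∘ₗ (degreeLT k 6).subtype) f.1.2.2.2) ^ 2) =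
        f.1.2.2.1 := by
      intro f
      obtain ⟨c, hc, hD⟩ := h.exists_genericChart_eq f
      rw [LinearMap.comp_apply, LinearMap.comp_apply, LinearMap.mulLeft_apply,
        Submodule.subtype_apply, scalarLinear_apply, hc, h.sq_map_normalForm_sub hD, hΛ']
    simp only [h2] at h1
    exact h1
  exact ha.prodMk (hb.prodMk (hd.prodMk hτ))

theorem isChart_genericNilCentralizer [Infinite k] [CharP k 7] :
    IsChart k (genericParameterSet k)
      (fun f => genericChart Φ f.1.1 f.1.2.1 f.1.2.2.1 f.1.2.2.2) (genericNilCentralizer e) where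
  dense := isPolyDense_genericParameterSet
  regular := h.coordsIn_genericChart
  regular_inv := h.coordsIn_genericChart_inv
  mem f := h.genericChart_mem _ _ _ (not_X_dvd_of_mem_genericParameterSet f.2)
  subset_closure := h.mem_closure_genericChart

theorem zariskiDim_genericNilCentralizer [Infinite k] [CharP k 7] :
    zariskiDim k (zariskiClosure k (genericNilCentralizer e)) = 24 := by
  rw [h.isChart_genericNilCentralizer.closure.zariskiDim_eq, finrank_genericParameters]
  rfl

end IsTruncatedMatrixRing

end GenericComponentGeometry

/-! ### Commuting pairs whose first member has type `7²` -/

section ClosureMaps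

variable {k : Type*} [Field k] {E F : Type*} [AddCommGroup E] [Module k E] [AddCommGroup F]
  [Module k F]

theorem CoordsIn.mem_zariskiClosure {T : E → F} (h : CoordsIn (polyFunctionsOn k E) T) {S : Set E}
    {R : Set F} (hT : ∀ v ∈ S, T v ∈ zariskiClosure k R) {v : E} (hv : v ∈ zariskiClosure k S) :
    T v ∈ zariskiClosure k R := by
  rw [mem_zariskiClosure_iff] at hv ⊢
  exact fun f hf h0 => hv _ (h.polyFunction_comp hf) fun w hw =>
    mem_zariskiClosure_iff.1 (hT w hw) f hf h0

theorem mem_zariskiComponents_of_forall {X S : Set E} (hS : S ⊆ X) (hi : ZariskiIrreducible k S)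
    (h : ∀ W ⊆ X, ZariskiIrreducible k W → S ⊆ W → W ⊆ S) : S ∈ zariskiComponents k X :=
  ⟨⟨hS, hi⟩, fun W hW hle => h W hW.1 hW.2 hle⟩

theorem CoordsIn.isClosed_eq_zero {T : E → F} (h : CoordsIn (polyFunctionsOn k E) T) :
    @IsClosed E (zariskiTopology k E) {v | T v = 0} := by
  rw [isClosed_zariski_iff]
  refine ⟨Set.range fun (φ : Module.Dual k F) (v : E) => φ (T v), ?_, ?_⟩
  · rintro _ ⟨φ, rfl⟩
    exact h φ
  · ext v
    simp only [Set.mem_ofPred_eq, Set.forall_mem_range]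
    exact (Module.forall_dual_apply_eq_zero_iff k (T v)).symm

end ClosureMaps

section Pairs77

variable {k : Type*} [Field k] {n : ℕ} {e : Matrix (Fin n) (Fin n) k}

theorem isClosed_submodule (N : Submodule k (Matrix (Fin n) (Fin n) k)) :
    @IsClosed (Matrix (Fin n) (Fin n) k) (zariskiTopology k _)
      (N : Set (Matrix (Fin n) (Fin n) k)) := by
  convert (coordsIn_id (k := k) (E := Matrix (Fin n) (Fin n) k)).linear N.mkQ |>.isClosed_eq_zero
    using 1
  ext v
  simp

theorem isClosed_nilCentralizer (p : ℕ) (e : Matrix (Fin n) (Fin n) k) :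
    @IsClosed (Matrix (Fin n) (Fin n) k) (zariskiTopology k _) (nilCentralizer p e) :=
  @IsClosed.inter _ _ _ (zariskiTopology k _) (isClosed_submodule _)
    (isClosed_pow_eq_zero p)

theorem isClosed_restrictedCommutingVariety (p : ℕ) :
    @IsClosed (Matrix (Fin n) (Fin n) k × Matrix (Fin n) (Fin n) k) (zariskiTopology k _)
      (restrictedCommutingVariety k n p) := by
  have hid := coordsIn_id (k := k) (E := Matrix (Fin n) (Fin n) k × Matrix (Fin n) (Fin n) k)
  have h1 := hid.linear (LinearMap.fst k (Matrix (Fin n) (Fin n) k) (Matrix (Fin n) (Fin n) k))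
  have h2 := hid.linear (LinearMap.snd k (Matrix (Fin n) (Fin n) k) (Matrix (Fin n) (Fin n) k))
  exact @IsClosed.inter _ _ _ (zariskiTopology k _) (h1.pow p).isClosed_eq_zero
    (@IsClosed.inter _ _ _ (zariskiTopology k _) (h2.pow p).isClosed_eq_zero
      ((h1.mul h2).sub (h2.mul h1)).isClosed_eq_zero)

theorem conj_mul_conj {s a b : Matrix (Fin n) (Fin n) k} (hs : s.det ≠ 0) :
    s * a * s⁻¹ * (s * b * s⁻¹) = s * (a * b) * s⁻¹ := by
  simp only [mul_assoc]
  rw [Matrix.nonsing_inv_mul_cancel_left _ _ hs.isUnit]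

theorem zariskiClosure_conjOrbitPairs_subset {p : ℕ} (he : e ^ p = 0)
    {V : Set (Matrix (Fin n) (Fin n) k)}
    (hV : V ⊆ nilCentralizer p e) :
    zariskiClosure k (conjOrbitPairs e V) ⊆ restrictedCommutingVariety k n p := by
  refine zariskiClosure_minimal (fun z hz => ?_) (isClosed_restrictedCommutingVariety p)
  obtain ⟨s, hs, v, hv, rfl⟩ := mem_conjOrbitPairs.1 hz
  obtain ⟨h1, h2⟩ := hV hv
  refine ⟨?_, ?_, ?_⟩
  · change _ ^ p = 0
    rw [conj_pow_of_det_ne_zero hs, he, mul_zero, zero_mul]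
  · change _ ^ p = 0
    rw [conj_pow_of_det_ne_zero hs, show v ^ p = 0 from h2, mul_zero, zero_mul]
  · rw [Ring.lie_def, sub_eq_zero, conj_mul_conj hs, conj_mul_conj hs,
      mem_glCentralizer.1 h1]

theorem self_mem_conjOrbitPairs {V : Set (Matrix (Fin n) (Fin n) k)} {v : Matrix (Fin n) (Fin n) k}
    (hv : v ∈ V) :
    (e, v) ∈ conjOrbitPairs e V :=
  mem_conjOrbitPairs.2 ⟨1, by simp, v, hv, by simp⟩

theorem inv_commute {w : Matrix (Fin n) (Fin n) k} (hw : w.det ≠ 0) (hew : e * w = w * e) :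
    e * w⁻¹ = w⁻¹ * e := by
  have hu := hw.isUnit
  calc e * w⁻¹ = w⁻¹ * (w * e) * w⁻¹ := by rw [Matrix.nonsing_inv_mul_cancel_left _ _ hu]
    _ = w⁻¹ * e := by rw [← hew, ← mul_assoc, Matrix.mul_nonsing_inv_cancel_right _ _ hu]

theorem inv_conj_commute {w v : Matrix (Fin n) (Fin n) k} (hw : w.det ≠ 0) (hew : e * w = w * e)
    (hev : e * v = v * e) : e * (w⁻¹ * v * w) = w⁻¹ * v * w * e := by
  have h1 : Commute e w⁻¹ := inv_commute hw hew
  exact ((h1.mul_right hev).mul_right hew).eq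

theorem inv_conj_pow {w : Matrix (Fin n) (Fin n) k} (hw : w.det ≠ 0) (v : Matrix (Fin n) (Fin n) k)
    (m : ℕ) :
    (w⁻¹ * v * w) ^ m = w⁻¹ * v ^ m * w := by
  have hw' : w⁻¹.det ≠ 0 := by
    rw [Matrix.det_nonsing_inv]
    exact (hw.isUnit.ringInverse).ne_zero
  have := conj_pow_of_det_ne_zero hw' (x := v) m
  rwa [Matrix.nonsing_inv_nonsing_inv _ hw.isUnit] at this

theorem genericNilCentralizer_inv_conj_mem {w v : Matrix (Fin n) (Fin n) k} (hw : w.det ≠ 0)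
    (hew : e * w = w * e)
    (hv : v ∈ genericNilCentralizer e) : w⁻¹ * v * w ∈ genericNilCentralizer e := by
  refine ⟨inv_conj_commute hw hew hv.1, ?_, fun h0 => hv.2.2 ?_⟩
  · rw [inv_conj_pow hw, hv.2.1, mul_zero, zero_mul]
  · have h1 : e ^ 6 * w⁻¹ = w⁻¹ * e ^ 6 :=
      (Commute.pow_left (show Commute e w⁻¹ from inv_commute hw hew) 6).eq
    have hu := hw.isUnit
    rw [← mul_assoc, ← mul_assoc, h1] at h0
    have h2 : w * (w⁻¹ * e ^ 6 * v * w) * w⁻¹ = 0 := by rw [h0, mul_zero, zero_mul]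
    rwa [← mul_assoc, Matrix.mul_nonsing_inv_cancel_right _ _ hu, mul_assoc w⁻¹,
      Matrix.mul_nonsing_inv_cancel_left _ _ hu] at h2

theorem closure_genericNilCentralizer_inv_conj_mem {w v : Matrix (Fin n) (Fin n) k} (hw : w.det ≠ 0)
    (hew : e * w = w * e) (hv : v ∈ zariskiClosure k (genericNilCentralizer e)) :
    w⁻¹ * v * w ∈ zariskiClosure k (genericNilCentralizer e) :=
  CoordsIn.mem_zariskiClosure (T := fun v => w⁻¹ * v * w)
    (((coordsIn_const _).mul coordsIn_id).mul (coordsIn_const _))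
    (fun _ hv => subset_zariskiClosure _ (genericNilCentralizer_inv_conj_mem hw hew hv)) hv

theorem sixthAnnihilator_inv_conj_mem {w v : Matrix (Fin n) (Fin n) k} (hw : w.det ≠ 0)
    (hew : e * w = w * e)
    (hv : v ∈ sixthAnnihilator e) : w⁻¹ * v * w ∈ sixthAnnihilator e := by
  rw [mem_sixthAnnihilator] at *
  refine ⟨inv_conj_commute hw hew hv.1, ?_⟩
  have h1 : e ^ 6 * w⁻¹ = w⁻¹ * e ^ 6 :=
    (Commute.pow_left (show Commute e w⁻¹ from inv_commute hw hew) 6).eq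
  rw [← mul_assoc, ← mul_assoc, h1, mul_assoc _ _ v, hv.2, mul_zero, zero_mul]

theorem powMinor_fst_mem (m : ℕ) (φ₁ φ₂ : Module.Dual k (Fin n → k)) (v₁ v₂ : Fin n → k) :
    (fun z : Matrix (Fin n) (Fin n) k × Matrix (Fin n) (Fin n) k => powMinor m φ₁ φ₂ v₁ v₂ z.1) ∈
      polyFunctionsOn k (Matrix (Fin n) (Fin n) k × Matrix (Fin n) (Fin n) k) :=
  ((coordsIn_id (k := k) (E := Matrix (Fin n) (Fin n) k × Matrix (Fin n) (Fin n) k)).linear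
    (LinearMap.fst k _ _)).polyFunction_comp
    (powMinor_mem m φ₁ φ₂ v₁ v₂)

theorem mem_conjOrbitPairs_nilCentralizer {p : ℕ} {s y : Matrix (Fin n) (Fin n) k} (hs : s.det ≠ 0)
    (h : (s * e * s⁻¹, y) ∈ restrictedCommutingVariety k n p) :
    (s * e * s⁻¹, y) ∈ conjOrbitPairs e (nilCentralizer p e) := by
  obtain ⟨-, hy, hxy⟩ := h
  have hu := hs.isUnit
  have hys : s * (s⁻¹ * y * s) * s⁻¹ = y := by
    rw [mul_assoc s⁻¹, Matrix.mul_nonsing_inv_cancel_left _ _ hu,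
      Matrix.mul_nonsing_inv_cancel_right _ _ hu]
  refine mem_conjOrbitPairs.2 ⟨s, hs, s⁻¹ * y * s, ⟨mem_glCentralizer.2 ?_, ?_⟩, by rw [hys]⟩
  · have h1 : s * e * s⁻¹ * y = y * (s * e * s⁻¹) := by
      rw [← sub_eq_zero, ← Ring.lie_def]; exact hxy
    calc e * (s⁻¹ * y * s) = s⁻¹ * (s * e * s⁻¹ * y) * s := by
          simp only [mul_assoc]
          rw [Matrix.nonsing_inv_mul_cancel_left _ _ hu]
      _ = s⁻¹ * y * s * e := by
          rw [h1]
          simp only [mul_assoc]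
          rw [Matrix.nonsing_inv_mul _ hu, mul_one]
  · change _ ^ p = 0
    rw [inv_conj_pow hs, show y ^ p = 0 from hy, mul_zero, zero_mul]

theorem conjOrbitPairs_union (V₁ V₂ : Set (Matrix (Fin n) (Fin n) k)) :
    conjOrbitPairs e (V₁ ∪ V₂) ⊆
      zariskiClosure k (conjOrbitPairs e V₁) ∪ zariskiClosure k (conjOrbitPairs e V₂) := by
  intro z hz
  obtain ⟨s, hs, v, hv, rfl⟩ := mem_conjOrbitPairs.1 hz
  exact hv.imp (fun h => subset_zariskiClosure _ (mem_conjOrbitPairs.2 ⟨s, hs, v, h, rfl⟩))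
    (fun h => subset_zariskiClosure _ (mem_conjOrbitPairs.2 ⟨s, hs, v, h, rfl⟩))

/-- The function `x ^ 6 * y` vanishes on the pairs above the annihilator of `e ^ 6`, but not on the
pairs above the generic part of the nilpotent centralizer. -/
theorem not_closure_generic_pairs_subset (hne : (genericNilCentralizer e).Nonempty) :
    ¬ zariskiClosure k (conjOrbitPairs e (zariskiClosure k (genericNilCentralizer e))) ⊆
      zariskiClosure k (conjOrbitPairs e (sixthAnnihilator e)) := by
  intro hs
  obtain ⟨y, hy⟩ := hne
  have hid := coordsIn_id (k := k) (E := Matrix (Fin n) (Fin n) k × Matrix (Fin n) (Fin n) k)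
  have hT := ((hid.linear (LinearMap.fst k _ _)).pow 6).mul
    (hid.linear (LinearMap.snd k (Matrix (Fin n) (Fin n) k) (Matrix (Fin n) (Fin n) k)))
  have hsub : conjOrbitPairs e (sixthAnnihilator e : Set (Matrix (Fin n) (Fin n) k)) ⊆
      {z | LinearMap.fst k _ (Matrix (Fin n) (Fin n) k) z ^ 6 *
        LinearMap.snd k _ (Matrix (Fin n) (Fin n) k) z = 0} := by
    intro z hz
    obtain ⟨s, hs, v, hv, rfl⟩ := mem_conjOrbitPairs.1 hz
    rw [Set.mem_ofPred_eq, LinearMap.fst_apply, LinearMap.snd_apply, conj_pow_of_det_ne_zero hs,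
      conj_mul_conj hs, (mem_sixthAnnihilator.1 hv).2, mul_zero, zero_mul]
  have h1 := zariskiClosure_minimal hsub hT.isClosed_eq_zero (hs (subset_zariskiClosure _
    (self_mem_conjOrbitPairs (subset_zariskiClosure _ hy))))
  rw [Set.mem_ofPred_eq, LinearMap.fst_apply, LinearMap.snd_apply] at h1
  exact hy.2.2 h1

namespace IsTruncatedMatrixRing

open Polynomial

variable {Φ : Matrix (Fin 2) (Fin 2) k[X] →ₐ[k] Matrix (Fin n) (Fin n) k}
  (h : IsTruncatedMatrixRing e Φ)
include h

theorem nilCentralizer_eq_union : nilCentralizer 7 e =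
    zariskiClosure k (genericNilCentralizer e) ∪ sixthAnnihilator e := by
  refine Set.Subset.antisymm (fun y hy => ?_) (Set.union_subset ?_ h.sixthAnnihilator_subset)
  · have h1 := mem_glCentralizer.1 hy.1
    by_cases h6 : e ^ 6 * y = 0
    · exact .inr (mem_sixthAnnihilator.2 ⟨h1, h6⟩)
    · exact .inl (subset_zariskiClosure _ ⟨h1, hy.2, h6⟩)
  · exact zariskiClosure_minimal (fun y hy => ⟨mem_glCentralizer.2 hy.1, hy.2.1⟩)
      (isClosed_nilCentralizer 7 e)

theorem zariskiDim_sixthAnnihilator [Infinite k] :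
    zariskiDim k (sixthAnnihilator e : Set (Matrix (Fin n) (Fin n) k)) = 24 := by
  rw [(isChart_submodule _).zariskiDim_eq, h.finrank_sixthAnnihilator]
  rfl

theorem genericNilCentralizer_nonempty [Infinite k] [CharP k 7] :
    (genericNilCentralizer e).Nonempty := by
  obtain ⟨u, hu⟩ := h.isChart_genericNilCentralizer.dense.nonempty
  exact ⟨_, h.isChart_genericNilCentralizer.mem ⟨u, hu⟩⟩

theorem not_genericNilCentralizer_subset [Infinite k] [CharP k 7] :
    ¬ zariskiClosure k (genericNilCentralizer e) ⊆ sixthAnnihilator e := by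
  obtain ⟨y, hy⟩ := h.genericNilCentralizer_nonempty
  exact fun hs => hy.2.2 (mem_sixthAnnihilator.1 (hs (subset_zariskiClosure _ hy))).2

theorem not_sixthAnnihilator_subset [Infinite k] [CharP k 7] :
    ¬ (sixthAnnihilator e : Set (Matrix (Fin n) (Fin n) k)) ⊆
      zariskiClosure k (genericNilCentralizer e) := by
  intro hs
  have := subset_zariskiClosure_of_zariskiDim_eq hs
    h.isChart_genericNilCentralizer.closure.irreducible
    (n := 24) h.zariskiDim_sixthAnnihilator h.zariskiDim_genericNilCentralizer
  rw [zariskiClosure_eq_self (isClosed_submodule _)] at this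
  exact h.not_genericNilCentralizer_subset this

theorem zariskiComponents_nilCentralizer [Infinite k] [CharP k 7] :
    zariskiComponents k (nilCentralizer 7 e) =
      {zariskiClosure k (genericNilCentralizer e),
        (sixthAnnihilator e : Set (Matrix (Fin n) (Fin n) k))} :=
  zariskiComponents_eq_pair h.nilCentralizer_eq_union (isClosed_zariskiClosure _)
    (isClosed_submodule _) h.isChart_genericNilCentralizer.closure.irreducible
    (isChart_submodule _).irreducible h.not_genericNilCentralizer_subset
    h.not_sixthAnnihilator_subset

end IsTruncatedMatrixRing

end Pairs77

section Pairs77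

variable {k : Type*} [Field k] {e : Matrix (Fin 14) (Fin 14) k}

theorem HasJordanType.exists_isTruncatedMatrixRing (he : HasJordanType e [7, 7]) :
    ∃ Φ, IsTruncatedMatrixRing e Φ := by
  obtain ⟨Φ, h1, h2, h3⟩ := he.exists_algHom
  exact ⟨Φ, h1, h2, h3⟩

/-- The union of the two closures of pairs over the components contains every irreducible set of
commuting pairs that meets the fibre over the orbit of type `7²`. -/
theorem HasJordanType.subset_or_subset_of_fst_eq {V₁ V₂ : Set (Matrix (Fin 14) (Fin 14) k)}
    (he : HasJordanType e [7, 7]) (hV : nilCentralizer 7 e = V₁ ∪ V₂)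
    {W : Set (Matrix (Fin 14) (Fin 14) k × Matrix (Fin 14) (Fin 14) k)}
    (hW : ZariskiIrreducible k W) (hWC : W ⊆ restrictedCommutingVariety k 14 7)
    {v : Matrix (Fin 14) (Fin 14) k} (hv : (e, v) ∈ W) :
    W ⊆ zariskiClosure k (conjOrbitPairs e V₁) ∨ W ⊆ zariskiClosure k (conjOrbitPairs e V₂) := by
  have h6 := he.not_rankLeOne
  simp only [rankLeOne_pow_iff, not_forall] at h6
  obtain ⟨φ₁, φ₂, v₁, v₂, h6⟩ := h6
  have hf := powMinor_fst_mem 6 φ₁ φ₂ v₁ v₂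
  have hcl := @IsClosed.union _ _ _ (zariskiTopology k _)
    (isClosed_zariskiClosure (k := k) (conjOrbitPairs e V₁))
    (isClosed_zariskiClosure (k := k) (conjOrbitPairs e V₂))
  have hcov : W ⊆ {z | powMinor 6 φ₁ φ₂ v₁ v₂ z.1 = 0} ∪
      (zariskiClosure k (conjOrbitPairs e V₁) ∪ zariskiClosure k (conjOrbitPairs e V₂)) := by
    rintro ⟨x, y⟩ hz
    by_cases h0 : powMinor 6 φ₁ φ₂ v₁ v₂ x = 0
    · exact .inl h0
    have hx' := hasJordanType_seven_seven_of_not_rankLeOne (hWC hz).1 fun h =>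
      h0 (rankLeOne_pow_iff.1 h _ _ _ _)
    obtain ⟨s, hs, rfl⟩ := _root_.mem_conjOrbit.1 (he.mem_conjOrbit hx')
    have := mem_conjOrbitPairs_nilCentralizer hs (hWC hz)
    rw [hV] at this
    exact .inr (conjOrbitPairs_union V₁ V₂ this)
  rcases hW.subset_or_subset (isClosed_zeroSet hf) hcl hcov with h | h
  · exact absurd (h hv) h6
  · exact hW.subset_or_subset (isClosed_zariskiClosure _) (isClosed_zariskiClosure _) h

/-- The geometry of the nilpotent centralizer of a matrix of type `7²` and of the commuting pairs
above it. -/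
theorem HasJordanType.components_seven_seven [Infinite k] [CharP k 7]
    (he : HasJordanType e [7, 7]) :
    ∃ V₁ V₂ : Set (Matrix (Fin 14) (Fin 14) k), V₁ ≠ V₂ ∧
      zariskiComponents k (nilCentralizer 7 e) = {V₁, V₂} ∧
      zariskiDim k V₁ + 4 = (Module.finrank k (glCentralizer e) : WithBot ℕ∞) ∧
      zariskiDim k V₂ + 4 = (Module.finrank k (glCentralizer e) : WithBot ℕ∞) ∧
      zariskiClosure k (conjOrbitPairs e V₁) ≠ zariskiClosure k (conjOrbitPairs e V₂) ∧
      zariskiClosure k (conjOrbitPairs e V₁) ∈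
        zariskiComponents k (restrictedCommutingVariety k 14 7) ∧
      zariskiClosure k (conjOrbitPairs e V₂) ∈
        zariskiComponents k (restrictedCommutingVariety k 14 7) ∧
      zariskiDim k (zariskiClosure k (conjOrbitPairs e V₁)) = 192 ∧
      zariskiDim k (zariskiClosure k (conjOrbitPairs e V₂)) = 192 := by
  obtain ⟨Φ, h⟩ := he.exists_isTruncatedMatrixRing
  have he7 : e ^ 7 = 0 := he.pow_eq_zero (by simp)
  have hU := h.nilCentralizer_eq_union
  have hC := h.finrank_glCentralizer
  obtain ⟨i₁, d₁⟩ := conjOrbitPairs_irreducible_and_dim e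
    (fun w hw hew v hv => closure_genericNilCentralizer_inv_conj_mem hw hew hv)
    h.isChart_genericNilCentralizer.closure (d := 4) (by rw [finrank_genericParameters, hC])
  obtain ⟨i₂, d₂⟩ := conjOrbitPairs_irreducible_and_dim e
    (fun w hw hew v hv => sixthAnnihilator_inv_conj_mem hw hew hv)
    (isChart_submodule (sixthAnnihilator e)) (d := 4) (by rw [h.finrank_sixthAnnihilator, hC])
  have d₁ := d₁ 192 (by norm_num)
  have d₂ := d₂ 192 (by norm_num)
  have n₁ := not_closure_generic_pairs_subset h.genericNilCentralizer_nonempty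
  have n₂ : ¬ zariskiClosure k (conjOrbitPairs e (sixthAnnihilator e)) ⊆
      zariskiClosure k (conjOrbitPairs e (zariskiClosure k (genericNilCentralizer e))) := by
    intro hs
    have := subset_zariskiClosure_of_zariskiDim_eq hs i₁ d₂ d₁
    rw [zariskiClosure_eq_self (isClosed_zariskiClosure _)] at this
    exact n₁ this
  obtain ⟨y₁, hy₁⟩ := h.genericNilCentralizer_nonempty
  refine ⟨zariskiClosure k (genericNilCentralizer e), sixthAnnihilator e,
    fun h12 => h.not_genericNilCentralizer_subset h12.le, h.zariskiComponents_nilCentralizer,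
    ?_, ?_, fun h12 => n₁ h12.le,
    mem_zariskiComponents_of_forall
      (zariskiClosure_conjOrbitPairs_subset he7 (hU ▸ Set.subset_union_left)) i₁
      fun W hWC hW hle => ?_,
    mem_zariskiComponents_of_forall
      (zariskiClosure_conjOrbitPairs_subset he7 (hU ▸ Set.subset_union_right)) i₂
      fun W hWC hW hle => ?_, d₁, d₂⟩
  · rw [h.zariskiDim_genericNilCentralizer, hC]
    rfl
  · rw [h.zariskiDim_sixthAnnihilator, hC]
    rfl
  · rcases he.subset_or_subset_of_fst_eq hU hW hWC (hle (subset_zariskiClosure _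
      (self_mem_conjOrbitPairs (subset_zariskiClosure _ hy₁)))) with h1 | h1
    · exact h1
    · exact absurd (hle.trans h1) n₁
  · rcases he.subset_or_subset_of_fst_eq hU hW hWC (hle (subset_zariskiClosure _
      (self_mem_conjOrbitPairs (sixthAnnihilator e).zero_mem))) with h1 | h1
    · exact absurd (hle.trans h1) n₂
    · exact h1

end Pairs77

/-! ### Jordan types whose parts differ by at least two -/

section Weights

variable {k : Type*} [Field k] {n : ℕ} {l : List ℕ}

/-- The weight of a vector of a Jordan basis: the vector `e ^ h v` has weight `h + i` if `v` is the
generator of the block number `i`. -/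
def jordanWeight (t : Σ i : Fin l.length, Fin (l.get i)) : ℕ :=
  l.get t.1 - 1 - t.2 + t.1

/-- The successive parts of `l` drop by at least two. -/
def HasGaps (l : List ℕ) : Prop :=
  ∀ i j : Fin l.length, i < j → l.get j + j < l.get i + i

variable {e : Matrix (Fin n) (Fin n) k}
  {b : Module.Basis (Σ i : Fin l.length, Fin (l.get i)) k (Fin n → k)}

theorem IsJordanBasis.repr_pow_mulVec (hb : IsJordanBasis e b) (m : ℕ) (u : Fin n → k)
    (s : Σ i : Fin l.length, Fin (l.get i)) :
    b.repr ((e ^ m).mulVec u) s =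
      if h : (s.2 : ℕ) + m < l.get s.1 then b.repr u ⟨s.1, ⟨s.2 + m, h⟩⟩ else 0 := by
  let L₁ : (Fin n → k) →ₗ[k] k := b.coord s ∘ₗ Matrix.mulVecLin (e ^ m)
  let L₂ : (Fin n → k) →ₗ[k] k :=
    if h : (s.2 : ℕ) + m < l.get s.1 then b.coord ⟨s.1, ⟨s.2 + m, h⟩⟩ else 0
  have hL : L₁ = L₂ := by
    refine b.ext fun t => ?_
    change b.repr ((e ^ m).mulVec (b t)) s = _
    rw [hb.pow_mulVec]
    simp only [L₂]
    obtain ⟨i, a⟩ := s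
    obtain ⟨j, c⟩ := t
    by_cases hij : i = j
    · subst hij
      split_ifs with h1 h2 h2
      · rw [Module.Basis.coord_apply, b.repr_self, Finsupp.single_eq_of_ne]
        · simp
        · intro h
          have h3 := congrArg Fin.val (eq_of_heq (Sigma.mk.inj h).2)
          simp only at h1 h3
          omega
      · simp
      · rw [Module.Basis.coord_apply, b.repr_self, b.repr_self, Finsupp.single_apply,
          Finsupp.single_apply]
        congr 1
        simp only [Sigma.mk.injEq, heq_eq_eq, true_and, Fin.ext_iff]
        simp only at h1
        rw [eq_iff_iff]
        omega
      · rw [b.repr_self, Finsupp.single_eq_of_ne]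
        · simp
        · intro h
          have h3 := congrArg Fin.val (eq_of_heq (Sigma.mk.inj h).2)
          have := c.2
          simp only at h1 h2 h3
          omega
    · have hne : ∀ c' a', (⟨i, a'⟩ : Σ i : Fin l.length, Fin (l.get i)) ≠ ⟨j, c'⟩ := fun _ _ h =>
        hij (Sigma.mk.inj h).1
      split_ifs with h1 h2 h2
      · rw [Module.Basis.coord_apply, b.repr_self, Finsupp.single_eq_of_ne (hne _ _)]
        simp
      · simp
      · rw [Module.Basis.coord_apply, b.repr_self, b.repr_self, Finsupp.single_eq_of_ne (hne _ _),
          Finsupp.single_eq_of_ne (hne _ _)]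
      · rw [b.repr_self, Finsupp.single_eq_of_ne (hne _ _)]
        simp
  have := LinearMap.congr_fun hL u
  change b.repr ((e ^ m).mulVec u) s = _ at this
  rw [this]
  simp only [L₂]
  split_ifs <;> rfl

theorem mulVec_pow_comm {y : Matrix (Fin n) (Fin n) k} (hy : e * y = y * e) (m : ℕ)
    (u : Fin n → k) : (e ^ m).mulVec (y.mulVec u) = y.mulVec ((e ^ m).mulVec u) := by
  rw [Matrix.mulVec_mulVec, Matrix.mulVec_mulVec,
    (Commute.pow_left (show Commute e y from hy) m).eq]

/-- The matrix entries of an element of the centralizer vanish unless the weight increases or the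
entry is on the diagonal. -/
theorem IsJordanBasis.repr_mulVec_eq_zero (hb : IsJordanBasis e b) (hl : HasGaps l)
    {y : Matrix (Fin n) (Fin n) k} (hy : e * y = y * e)
    {s t : Σ i : Fin l.length, Fin (l.get i)} (hst : s ≠ t) (hw : jordanWeight s ≤ jordanWeight t) :
    b.repr (y.mulVec (b t)) s = 0 := by
  obtain ⟨i, a⟩ := s
  obtain ⟨j, c⟩ := t
  have ha := a.2
  have hc := c.2
  -- `e ^ a` kills the vector `b (j, c)` if `c < a`
  by_cases h1 : (c : ℕ) < a
  · have h2 := hb.repr_pow_mulVec a (y.mulVec (b ⟨j, c⟩)) ⟨i, ⟨0, by omega⟩⟩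
    rw [mulVec_pow_comm hy, hb.pow_mulVec, dif_pos h1, Matrix.mulVec_zero, map_zero,
      dif_pos (by simp)] at h2
    simpa using h2.symm
  -- `b (j, c)` lies in the image of `e ^ (l j - 1 - c)`
  by_cases h2 : (a : ℕ) + (l.get j - 1 - c) < l.get i
  swap
  · have h3 : b ⟨j, c⟩ = (e ^ (l.get j - 1 - c)).mulVec (b ⟨j, ⟨l.get j - 1, by omega⟩⟩) := by
      rw [hb.pow_mulVec, dif_neg]
      · congr 2
        ext
        change (c : ℕ) = l.get j - 1 - (l.get j - 1 - c)
        omega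
      · change ¬ (l.get j - 1 < l.get j - 1 - (c : ℕ))
        omega
    rw [h3, ← mulVec_pow_comm hy, hb.repr_pow_mulVec, dif_neg h2]
  exfalso
  simp only [jordanWeight] at hw
  rcases lt_trichotomy i j with h3 | h3 | h3
  · have := hl i j h3
    omega
  · subst h3
    refine hst ?_
    congr 1
    ext
    omega
  · have := hl j i h3
    have h4 : (j : ℕ) < i := h3
    omega

theorem IsJordanBasis.repr_mulVec_self (hb : IsJordanBasis e b)
    {y : Matrix (Fin n) (Fin n) k} (hy : e * y = y * e)
    (i : Fin l.length) (a : Fin (l.get i)) (h0 : 0 < l.get i) :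
    b.repr (y.mulVec (b ⟨i, a⟩)) ⟨i, a⟩ =
      b.repr (y.mulVec (b ⟨i, ⟨0, h0⟩⟩)) ⟨i, ⟨0, h0⟩⟩ := by
  have h2 := hb.repr_pow_mulVec a (y.mulVec (b ⟨i, a⟩)) ⟨i, ⟨0, h0⟩⟩
  rw [mulVec_pow_comm hy, hb.pow_mulVec, dif_neg (lt_irrefl _), dif_pos (by simp)] at h2
  simpa using h2.symm

variable (b) in
/-- The diagonal entries of `y`, one for each Jordan block. -/
noncomputable def diagonalEntries (h0 : ∀ i : Fin l.length, 0 < l.get i) :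
    Matrix (Fin n) (Fin n) k →ₗ[k] (Fin l.length → k) :=
  LinearMap.pi fun i => b.coord ⟨i, ⟨0, h0 i⟩⟩ ∘ₗ
    (Matrix.mulVecBilin k k).flip (b ⟨i, ⟨0, h0 i⟩⟩)

theorem diagonalEntries_apply (h0 : ∀ i : Fin l.length, 0 < l.get i)
    (y : Matrix (Fin n) (Fin n) k) (i : Fin l.length) :
    diagonalEntries b h0 y i = b.repr (y.mulVec (b ⟨i, ⟨0, h0 i⟩⟩)) ⟨i, ⟨0, h0 i⟩⟩ := rfl

theorem IsJordanBasis.diagonalEntries_mul (hb : IsJordanBasis e b) (hl : HasGaps l)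
    (h0 : ∀ i : Fin l.length, 0 < l.get i) {y z : Matrix (Fin n) (Fin n) k}
    (hy : e * y = y * e) (hz : e * z = z * e) :
    diagonalEntries b h0 (y * z) = diagonalEntries b h0 y * diagonalEntries b h0 z := by
  ext i
  rw [Pi.mul_apply]
  simp only [diagonalEntries_apply]
  generalize (⟨i, ⟨0, h0 i⟩⟩ : Σ i : Fin l.length, Fin (l.get i)) = t
  have h1 : b.repr ((y * z).mulVec (b t)) t =
      ∑ s, b.repr (z.mulVec (b t)) s * b.repr (y.mulVec (b s)) t := by
    rw [← Matrix.mulVec_mulVec]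
    conv_lhs => rw [← b.sum_repr (z.mulVec (b t))]
    change b.coord t (Matrix.mulVecLin y _) = _
    simp only [map_sum, map_smul, smul_eq_mul]
    rfl
  rw [h1, Finset.sum_eq_single t, mul_comm]
  · intro s _ hst
    rcases le_total (jordanWeight s) (jordanWeight t) with h | h
    · rw [hb.repr_mulVec_eq_zero hl hz hst h, zero_mul]
    · rw [hb.repr_mulVec_eq_zero hl hy hst.symm h, mul_zero]
  · simp

theorem IsJordanBasis.diagonalEntries_pow (hb : IsJordanBasis e b) (hl : HasGaps l)
    (h0 : ∀ i : Fin l.length, 0 < l.get i) {y : Matrix (Fin n) (Fin n) k}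
    (hy : e * y = y * e) (m : ℕ) :
    diagonalEntries b h0 (y ^ (m + 1)) = diagonalEntries b h0 y ^ (m + 1) := by
  induction m with
  | zero => simp
  | succ m ih =>
    rw [pow_succ, hb.diagonalEntries_mul hl h0 (Commute.pow_right (show Commute e y from hy) _).eq
      hy, ih, pow_succ _ (m + 1)]

variable (e b) in
/-- The elements of the centralizer with zero diagonal. -/
noncomputable def strictCentralizer (h0 : ∀ i : Fin l.length, 0 < l.get i) :
    Submodule k (Matrix (Fin n) (Fin n) k) :=
  (LinearMap.ker ((diagonalEntries b h0).domRestrict (glCentralizer e))).map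
    (glCentralizer e).subtype

theorem mem_strictCentralizer {h0 : ∀ i : Fin l.length, 0 < l.get i}
    {y : Matrix (Fin n) (Fin n) k} :
    y ∈ strictCentralizer e b h0 ↔ e * y = y * e ∧ diagonalEntries b h0 y = 0 := by
  rw [← mem_glCentralizer]
  constructor
  · rintro ⟨z, hz, rfl⟩
    exact ⟨z.2, hz⟩
  · rintro ⟨h1, h2⟩
    exact ⟨⟨y, h1⟩, h2, rfl⟩

theorem IsJordanBasis.finrank_strictCentralizer (hb : IsJordanBasis e b)
    (h0 : ∀ i : Fin l.length, 0 < l.get i) :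
    Module.finrank k (strictCentralizer e b h0) + l.length =
      Module.finrank k (glCentralizer e) := by
  have hsurj : LinearMap.range ((diagonalEntries b h0).domRestrict (glCentralizer e)) = ⊤ := by
    rw [LinearMap.range_eq_top]
    intro c
    -- the matrix that acts as the scalar `c i` on the block number `i`
    let y : Matrix (Fin n) (Fin n) k := LinearMap.toMatrix' (b.constr k fun t => c t.1 • b t)
    have hy : ∀ t, y.mulVec (b t) = c t.1 • b t := fun t => by
      rw [← Matrix.toLin'_apply, Matrix.toLin'_toMatrix', Module.Basis.constr_basis]
    refine ⟨⟨y, mem_glCentralizer.2 (Matrix.toLin'.injective (b.ext fun t => ?_))⟩, ?_⟩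
    · rw [Matrix.toLin'_apply, Matrix.toLin'_apply, ← Matrix.mulVec_mulVec, ← Matrix.mulVec_mulVec,
        hy, Matrix.mulVec_smul, hb t]
      split_ifs
      · simp
      · rw [hy]
    · ext i
      change diagonalEntries b h0 y i = c i
      rw [diagonalEntries_apply, hy]
      simp
  have h1 := LinearMap.finrank_range_add_finrank_ker
    ((diagonalEntries b h0).domRestrict (glCentralizer e))
  rw [hsurj, finrank_top, Module.finrank_fin_fun] at h1
  rw [strictCentralizer, Submodule.finrank_map_subtype_eq, ← h1, add_comm]

/-- The nilpotent centralizer is a linear space. -/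
theorem IsJordanBasis.nilCentralizer_eq (hb : IsJordanBasis e b) (hl : HasGaps l)
    (h0 : ∀ i : Fin l.length, 0 < l.get i) {p : ℕ} (hp0 : p ≠ 0)
    (hp : ∀ i : Fin l.length, l.get i + i ≤ p) :
    nilCentralizer p e = strictCentralizer e b h0 := by
  ext y
  rw [SetLike.mem_coe, mem_strictCentralizer]
  constructor
  · rintro ⟨h1, h2⟩
    have h1 := mem_glCentralizer.1 h1
    refine ⟨h1, ?_⟩
    obtain ⟨m, rfl⟩ := Nat.exists_eq_succ_of_ne_zero hp0
    have h3 := hb.diagonalEntries_pow hl h0 h1 m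
    rw [show y ^ (m + 1) = 0 from h2, map_zero] at h3
    exact eq_zero_of_pow_eq_zero h3.symm
  · rintro ⟨h1, h2⟩
    refine ⟨mem_glCentralizer.2 h1, pow_eq_zero_of_repr b (fun t => p - 1 - jordanWeight t)
      (fun s t hst => ?_) fun t => by omega⟩
    by_cases h3 : s = t
    · subst h3
      rw [hb.repr_mulVec_self h1 _ _ (h0 _)]
      exact congrFun h2 s.1
    · refine hb.repr_mulVec_eq_zero hl h1 h3 ?_
      have h4 : jordanWeight t < p := by
        have := hp t.1
        have := t.2.2
        simp only [jordanWeight]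
        omega
      have h5 : jordanWeight s < p := by
        have := hp s.1
        have := s.2.2
        simp only [jordanWeight]
        omega
      omega

end Weights

/-! ### Generic elements of the nilpotent centralizer -/

section GenericConjugate

variable {k : Type*} [Field k] {n : ℕ} {l : List ℕ}
  {e : Matrix (Fin n) (Fin n) k}
  {b : Module.Basis (Σ i : Fin l.length, Fin (l.get i)) k (Fin n → k)}

/-- The vectors `y ^ h u i` with `h < l i`, indexed like a Jordan basis of type `l`. -/
def chainVectors (l : List ℕ) (y : Matrix (Fin n) (Fin n) k) (u : Fin l.length → Fin n → k)
    (t : Σ i : Fin l.length, Fin (l.get i)) : Fin n → k :=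
  (y ^ (l.get t.1 - 1 - t.2)).mulVec (u t.1)

/-- Chains that are killed by the prescribed powers and span the space form a Jordan basis. -/
theorem hasJordanType_of_chainVectors
    (b : Module.Basis (Σ i : Fin l.length, Fin (l.get i)) k (Fin n → k))
    {y : Matrix (Fin n) (Fin n) k} {u : Fin l.length → Fin n → k}
    (hu : ∀ i, (y ^ l.get i).mulVec (u i) = 0)
    (hspan : ⊤ ≤ Submodule.span k (Set.range (chainVectors l y u))) : HasJordanType y l := by
  have hcard : Fintype.card (Σ i : Fin l.length, Fin (l.get i)) = Module.finrank k (Fin n → k) :=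
    (Module.finrank_eq_card_basis b).symm
  let c := basisOfTopLeSpanOfCardEqFinrank (chainVectors l y u) hspan hcard
  have hc : ∀ t, c t = chainVectors l y u t := fun t => by simp [c]
  refine IsJordanBasis.hasJordanType (b := c) fun t => ?_
  obtain ⟨i, a⟩ := t
  have ha := a.2
  simp only [hc, chainVectors]
  rw [Matrix.mulVec_mulVec, ← pow_succ']
  split_ifs with h0
  · rw [show l.get i - 1 - (a : ℕ) + 1 = l.get i by omega, hu]
  · congr 2
    omega

/-- The span of the chains is stable under `y` when the chains are killed by the prescribed
powers. -/
theorem mulVec_mem_span_chainVectors {y : Matrix (Fin n) (Fin n) k} {u : Fin l.length → Fin n → k}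
    (hu : ∀ i, (y ^ l.get i).mulVec (u i) = 0) {v : Fin n → k}
    (hv : v ∈ Submodule.span k (Set.range (chainVectors l y u))) :
    y.mulVec v ∈ Submodule.span k (Set.range (chainVectors l y u)) := by
  suffices h : Submodule.span k (Set.range (chainVectors l y u)) ≤
      (Submodule.span k (Set.range (chainVectors l y u))).comap (Matrix.mulVecLin y) from h hv
  rw [Submodule.span_le]
  rintro _ ⟨⟨i, a⟩, rfl⟩
  have ha := a.2
  change y.mulVec (chainVectors l y u ⟨i, a⟩) ∈ Submodule.span k _
  have h1 : y.mulVec (chainVectors l y u ⟨i, a⟩) = (y ^ (l.get i - 1 - a + 1)).mulVec (u i) := by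
    rw [chainVectors, Matrix.mulVec_mulVec, ← pow_succ']
  rw [h1]
  by_cases h0 : (a : ℕ) = 0
  · rw [show l.get i - 1 - (a : ℕ) + 1 = l.get i by omega, hu]
    exact Submodule.zero_mem _
  · refine Submodule.subset_span ⟨⟨i, ⟨a - 1, by omega⟩⟩, ?_⟩
    simp only [chainVectors]
    congr 2
    omega

variable (b) in
/-- The vectors all of whose coordinates of weight less than `m` vanish. -/
noncomputable def weightFiltration (m : ℕ) : Submodule k (Fin n → k) where
  carrier := {v | ∀ s, jordanWeight s < m → b.repr v s = 0}
  zero_mem' := by intro s _; simp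
  add_mem' := by
    intro v w hv hw s hs
    rw [map_add, Finsupp.add_apply, hv s hs, hw s hs, add_zero]
  smul_mem' := by
    intro c v hv s hs
    rw [map_smul, Finsupp.smul_apply, hv s hs, smul_zero]

theorem basis_mem_weightFiltration {s : Σ i : Fin l.length, Fin (l.get i)} {m : ℕ}
    (h : m ≤ jordanWeight s) : b s ∈ weightFiltration b m := by
  intro t ht
  rw [b.repr_self, Finsupp.single_eq_of_ne]
  rintro rfl
  omega

theorem weightFiltration_eq_span (m : ℕ) : weightFiltration b m =
    Submodule.span k (Set.range fun s : {s : Σ i : Fin l.length, Fin (l.get i) //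
      m ≤ jordanWeight s} => b s.1) := by
  refine le_antisymm (fun v hv => ?_) (Submodule.span_le.2 ?_)
  · rw [← b.sum_repr v]
    refine Submodule.sum_mem _ fun s _ => ?_
    by_cases hs : m ≤ jordanWeight s
    · exact Submodule.smul_mem _ _ (Submodule.subset_span ⟨⟨s, hs⟩, rfl⟩)
    · rw [hv s (not_le.1 hs), zero_smul]
      exact Submodule.zero_mem _
  · rintro _ ⟨s, rfl⟩
    exact basis_mem_weightFiltration s.2

/-- A second basis whose members have at least the same weights defines the same filtration. -/
theorem weightFiltration_eq_span_of_linearIndependent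
    {B : (Σ i : Fin l.length, Fin (l.get i)) → Fin n → k} (hB : LinearIndependent k B)
    (hw : ∀ s, B s ∈ weightFiltration b (jordanWeight s)) (m : ℕ) :
    weightFiltration b m =
      Submodule.span k (Set.range fun s : {s : Σ i : Fin l.length, Fin (l.get i) //
        m ≤ jordanWeight s} => B s.1) := by
  symm
  refine Submodule.eq_of_le_of_finrank_eq (Submodule.span_le.2 ?_) ?_
  · rintro _ ⟨s, rfl⟩ t ht
    exact hw s t (ht.trans_le s.2)
  · rw [weightFiltration_eq_span, finrank_span_eq_card, finrank_span_eq_card]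
    · exact b.linearIndependent.comp _ Subtype.val_injective
    · exact hB.comp _ Subtype.val_injective

theorem mulVec_mem_weightFiltration (hb : IsJordanBasis e b) (hl : HasGaps l)
    {h0 : ∀ i : Fin l.length, 0 < l.get i} {y : Matrix (Fin n) (Fin n) k}
    (hy : y ∈ strictCentralizer e b h0) {m : ℕ} {v : Fin n → k} (hv : v ∈ weightFiltration b m) :
    y.mulVec v ∈ weightFiltration b (m + 1) := by
  obtain ⟨h1, h2⟩ := mem_strictCentralizer.1 hy
  rw [weightFiltration_eq_span] at hv
  suffices h : Submodule.span k (Set.range fun s : {s : Σ i : Fin l.length, Fin (l.get i) //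
      m ≤ jordanWeight s} => b s.1) ≤
      (weightFiltration b (m + 1)).comap (Matrix.mulVecLin y) from h hv
  rw [Submodule.span_le]
  rintro _ ⟨⟨t, ht⟩, rfl⟩ s hs
  change b.repr (y.mulVec (b t)) s = 0
  by_cases h3 : s = t
  · subst h3
    rw [hb.repr_mulVec_self h1 _ _ (h0 _)]
    exact congrFun h2 s.1
  · exact hb.repr_mulVec_eq_zero hl h1 h3 (by omega)

theorem pow_mulVec_mem_weightFiltration (hb : IsJordanBasis e b) (hl : HasGaps l)
    {h0 : ∀ i : Fin l.length, 0 < l.get i} {y : Matrix (Fin n) (Fin n) k}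
    (hy : y ∈ strictCentralizer e b h0) (r : ℕ) {m : ℕ} {v : Fin n → k}
    (hv : v ∈ weightFiltration b m) : (y ^ r).mulVec v ∈ weightFiltration b (r + m) := by
  induction r with
  | zero => simpa using hv
  | succ r ih =>
    rw [pow_succ', ← Matrix.mulVec_mulVec, add_right_comm]
    exact mulVec_mem_weightFiltration hb hl hy ih

variable (b) in
/-- The generators of the Jordan blocks. -/
noncomputable def jordanGenerator (h0 : ∀ i : Fin l.length, 0 < l.get i) (i : Fin l.length) :
    Fin n → k :=
  b ⟨i, ⟨l.get i - 1, Nat.sub_one_lt (h0 i).ne'⟩⟩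

theorem jordanGenerator_mem (h0 : ∀ i : Fin l.length, 0 < l.get i) (i : Fin l.length) :
    jordanGenerator b h0 i ∈ weightFiltration b i :=
  basis_mem_weightFiltration (by simp [jordanWeight])

/-- An element of the nilpotent centralizer whose chains through the generators of the Jordan blocks
of `e` are independent has the same Jordan type as `e`: the generators can be corrected by multiples
of the generators of longer blocks so that they are killed by the right powers. -/
theorem hasJordanType_of_linearIndependent (hb : IsJordanBasis e b) (hl : HasGaps l)
    {h0 : ∀ i : Fin l.length, 0 < l.get i} {y : Matrix (Fin n) (Fin n) k}
    (hy : y ∈ strictCentralizer e b h0)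
    (hB : LinearIndependent k (chainVectors l y (jordanGenerator b h0))) : HasJordanType y l := by
  let v := jordanGenerator b h0
  have hw : ∀ s, chainVectors l y v s ∈ weightFiltration b (jordanWeight s) := fun s =>
    pow_mulVec_mem_weightFiltration hb hl hy _ (jordanGenerator_mem h0 s.1)
  -- the span of the chains through the generators of the blocks before the block number `j`
  let T : Fin l.length → Submodule k (Fin n → k) := fun j =>
    Submodule.span k {x | ∃ i < j, ∃ r : ℕ, x = (y ^ r).mulVec (v i)}
  have hT : ∀ j, ∃ x ∈ T j, (y ^ l.get j).mulVec x = (y ^ l.get j).mulVec (v j) := by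
    intro j
    have h1 : (y ^ l.get j).mulVec (v j) ∈ weightFiltration b (l.get j + j) :=
      pow_mulVec_mem_weightFiltration hb hl hy _ (jordanGenerator_mem h0 j)
    rw [weightFiltration_eq_span_of_linearIndependent hB hw] at h1
    suffices h : Submodule.span k (Set.range fun s : {s : Σ i : Fin l.length, Fin (l.get i) //
        l.get j + j ≤ jordanWeight s} => chainVectors l y v s.1) ≤
        (T j).map (Matrix.mulVecLin (y ^ l.get j)) from h h1
    rw [Submodule.span_le]
    rintro _ ⟨⟨⟨i, a⟩, hs⟩, rfl⟩
    have ha := a.2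
    simp only [jordanWeight] at hs
    have hij : i < j := by
      by_contra hij
      rcases (not_lt.1 hij).eq_or_lt with h | h
      · subst h
        omega
      · have := hl j i h
        omega
    have hij' : (i : ℕ) < j := hij
    refine ⟨(y ^ (l.get i - 1 - a - l.get j)).mulVec (v i),
      Submodule.subset_span ⟨i, hij, _, rfl⟩, ?_⟩
    change (y ^ l.get j).mulVec _ = _
    rw [Matrix.mulVec_mulVec, ← pow_add]
    simp only [chainVectors]
    congr 2
    omega
  choose x hxT hx using hT
  let u : Fin l.length → Fin n → k := fun j => v j - x j
  have hu : ∀ j, (y ^ l.get j).mulVec (u j) = 0 := fun j => by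
    rw [Matrix.mulVec_sub, hx, sub_self]
  let S := Submodule.span k (Set.range (chainVectors l y u))
  have hS : ∀ r : ℕ, ∀ z ∈ S, (y ^ r).mulVec z ∈ S := by
    intro r
    induction r with
    | zero => intro z hz; simpa using hz
    | succ r ih =>
      intro z hz
      rw [pow_succ', ← Matrix.mulVec_mulVec]
      exact mulVec_mem_span_chainVectors hu (ih z hz)
  have huS : ∀ j, u j ∈ S := fun j => by
    refine Submodule.subset_span ⟨⟨j, ⟨l.get j - 1, Nat.sub_one_lt (h0 j).ne'⟩⟩, ?_⟩
    simp [chainVectors]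
  have hvS : ∀ j, v j ∈ S := by
    intro j
    induction j using WellFoundedLT.induction with
    | _ j ih =>
      have hTS : T j ≤ S := by
        rw [Submodule.span_le]
        rintro _ ⟨i, hi, r, rfl⟩
        exact hS r _ (ih i hi)
      have := S.add_mem (huS j) (hTS (hxT j))
      simpa [u] using this
  refine hasJordanType_of_chainVectors b hu ?_
  have hcard : Fintype.card (Σ i : Fin l.length, Fin (l.get i)) = Module.finrank k (Fin n → k) :=
    (Module.finrank_eq_card_basis b).symm
  rw [← hB.span_eq_top_of_card_eq_finrank' hcard, Submodule.span_le]
  rintro _ ⟨s, rfl⟩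
  exact hS _ _ (hvS s.1)

/-- The nilpotent centralizer lies in the closure of the orbit. -/
theorem strictCentralizer_subset_zariskiClosure [Infinite k] (hb : IsJordanBasis e b)
    (hl : HasGaps l) (h0 : ∀ i : Fin l.length, 0 < l.get i) :
    (strictCentralizer e b h0 : Set (Matrix (Fin n) (Fin n) k)) ⊆
      zariskiClosure k (conjOrbit e) := by
  classical
  have hdet : (fun y : Matrix (Fin n) (Fin n) k => (b.toMatrix
      (chainVectors l y (jordanGenerator b h0))).det) ∈
        polyFunctionsOn k (Matrix (Fin n) (Fin n) k) := by
    refine CoordsIn.det (coordsIn_matrix.2 fun s t => ?_)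
    exact ((coordsIn_id (k := k) (E := Matrix (Fin n) (Fin n) k)).pow _)
      (b.coord s ∘ₗ (Matrix.mulVecBilin k k).flip (jordanGenerator b h0 t.1))
  have he : chainVectors l e (jordanGenerator b h0) = b := by
    ext1 t
    obtain ⟨i, a⟩ := t
    have ha := a.2
    rw [chainVectors, jordanGenerator, hb.pow_mulVec, dif_neg]
    · congr 2
      ext
      change l.get i - 1 - (l.get i - 1 - (a : ℕ)) = a
      omega
    · change ¬ (l.get i - 1 < l.get i - 1 - (a : ℕ))
      omega
  have heN : e ∈ strictCentralizer e b h0 := by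
    refine mem_strictCentralizer.2 ⟨rfl, ?_⟩
    ext i
    rw [diagonalEntries_apply, hb, dif_pos rfl]
    simp
  refine submodule_subset_zariskiClosure _ hdet heN ?_ fun y hy hne => ?_
  · rw [he, Module.Basis.toMatrix_self, Matrix.det_one]
    exact one_ne_zero
  · refine hb.hasJordanType.mem_conjOrbit (hasJordanType_of_linearIndependent hb hl hy ?_)
    exact ((b.is_basis_iff_det).2 (by rw [Module.Basis.det_apply]; exact hne.isUnit)).1

end GenericConjugate

/-! ### Commuting pairs whose first member has type `7.5.2` -/

section Pairs752

variable {k : Type*} [Field k] {n : ℕ}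

theorem nilCentralizer_inv_conj_mem {p : ℕ} {e w v : Matrix (Fin n) (Fin n) k} (hw : w.det ≠ 0)
    (hew : e * w = w * e) (hv : v ∈ nilCentralizer p e) : w⁻¹ * v * w ∈ nilCentralizer p e := by
  refine ⟨mem_glCentralizer.2 (inv_conj_commute hw hew (mem_glCentralizer.1 hv.1)), ?_⟩
  change _ ^ p = 0
  rw [inv_conj_pow hw, show v ^ p = 0 from hv.2, mul_zero, zero_mul]

/-- The nilpotent centralizer of a matrix whose Jordan type has gaps: it is a linear space, and it
lies in the closure of the orbit. -/
theorem HasJordanType.nilCentralizer_of_hasGaps [Infinite k] {l : List ℕ} (hl : HasGaps l)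
    (h0 : ∀ i : Fin l.length, 0 < l.get i) {p : ℕ} (hp0 : p ≠ 0)
    (hp : ∀ i : Fin l.length, l.get i + i ≤ p) {e : Matrix (Fin n) (Fin n) k}
    (he : HasJordanType e l) :
    ZariskiIrreducible k (nilCentralizer p e) ∧
      zariskiDim k (nilCentralizer p e) + l.length =
        (Module.finrank k (glCentralizer e) : WithBot ℕ∞) ∧
      ZariskiIrreducible k (zariskiClosure k (conjOrbitPairs e (nilCentralizer p e))) ∧
      (∀ N : ℕ, N + l.length = n * n →
        zariskiDim k (zariskiClosure k (conjOrbitPairs e (nilCentralizer p e))) = N) ∧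
      nilCentralizer p e ⊆ zariskiClosure k (conjOrbit e) := by
  obtain ⟨b, hb⟩ := he.exists_basis
  have hN := hb.nilCentralizer_eq hl h0 hp0 hp
  have hd := hb.finrank_strictCentralizer h0
  have hchart := isChart_submodule (strictCentralizer e b h0)
  have hpairs := conjOrbitPairs_irreducible_and_dim e (fun w hw hew v hv => by
    rw [← hN] at hv ⊢
    exact nilCentralizer_inv_conj_mem hw hew hv) hchart hd
  rw [hN]
  refine ⟨hchart.irreducible, ?_, hpairs.1, hpairs.2,
    strictCentralizer_subset_zariskiClosure hb hl h0⟩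
  rw [hchart.zariskiDim_eq, ← hd]
  rfl

theorem irreducible_of_mem_zariskiComponents {E : Type*} [AddCommGroup E] [Module k E]
    {X V : Set E} (hV : V ∈ zariskiComponents k X) : ZariskiIrreducible k V :=
  hV.1.2

theorem not_dim_le : ¬ (193 : WithBot ℕ∞) ≤ 192 := by
  exact_mod_cast (by norm_num : ¬ (193 : ℕ) ≤ 192)

theorem hasGaps_seven_five_two : HasGaps [7, 5, 2] := by
  unfold HasGaps
  decide

theorem rankLeOne_of_mem_closure_pairs {e : Matrix (Fin n) (Fin n) k} {m : ℕ}
    (he : RankLeOne (e ^ m)) {V : Set (Matrix (Fin n) (Fin n) k)}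
    {z : Matrix (Fin n) (Fin n) k × Matrix (Fin n) (Fin n) k}
    (hz : z ∈ zariskiClosure k (conjOrbitPairs e V)) : RankLeOne (z.1 ^ m) := by
  rw [rankLeOne_pow_iff]
  intro φ₁ φ₂ v₁ v₂
  refine mem_zariskiClosure_iff.1 hz _ (powMinor_fst_mem m φ₁ φ₂ v₁ v₂) fun w hw => ?_
  obtain ⟨s, hs, v, -, rfl⟩ := mem_conjOrbitPairs.1 hw
  refine rankLeOne_pow_iff.1 ?_ _ _ _ _
  rw [conj_pow_of_det_ne_zero hs]
  exact he.conj

theorem rankLeOne_of_mem_closure_conjOrbit {e : Matrix (Fin n) (Fin n) k} {m : ℕ}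
    (he : RankLeOne (e ^ m)) {x : Matrix (Fin n) (Fin n) k}
    (hx : x ∈ zariskiClosure k (conjOrbit e)) : RankLeOne (x ^ m) := by
  rw [rankLeOne_pow_iff]
  intro φ₁ φ₂ v₁ v₂
  refine mem_zariskiClosure_iff.1 hx _ (powMinor_mem m φ₁ φ₂ v₁ v₂) fun w hw => ?_
  obtain ⟨s, hs, rfl⟩ := mem_conjOrbit.1 hw
  refine rankLeOne_pow_iff.1 ?_ _ _ _ _
  rw [conj_pow_of_det_ne_zero hs]
  exact he.conj

variable {e e' : Matrix (Fin 14) (Fin 14) k}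

theorem HasJordanType.nilCentralizer_seven_five_two [Infinite k]
    (he' : HasJordanType e' [7, 5, 2]) :
    ZariskiIrreducible k (nilCentralizer 7 e') ∧
      zariskiDim k (nilCentralizer 7 e') + 3 =
        (Module.finrank k (glCentralizer e') : WithBot ℕ∞) ∧
      zariskiClosure k (conjOrbitPairs e' (nilCentralizer 7 e')) ⊆
        restrictedCommutingVariety k 14 7 ∧
      ZariskiIrreducible k (zariskiClosure k (conjOrbitPairs e' (nilCentralizer 7 e'))) ∧
      zariskiDim k (zariskiClosure k (conjOrbitPairs e' (nilCentralizer 7 e'))) = 193 ∧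
      nilCentralizer 7 e' ⊆ zariskiClosure k (conjOrbit e') := by
  obtain ⟨h1, h2, h3, h4, h5⟩ := he'.nilCentralizer_of_hasGaps hasGaps_seven_five_two (by decide)
    (p := 7) (by norm_num) (by decide)
  exact ⟨h1, h2, zariskiClosure_conjOrbitPairs_subset (he'.pow_eq_zero (by simp)) le_rfl, h3,
    h4 193 (by norm_num), h5⟩

theorem HasJordanType.zariskiDim_of_mem_components [Infinite k] [CharP k 7]
    (he : HasJordanType e [7, 7]) {V : Set (Matrix (Fin 14) (Fin 14) k)}
    (hV : V ∈ zariskiComponents k (nilCentralizer 7 e)) :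
    zariskiDim k (zariskiClosure k (conjOrbitPairs e V)) = 192 := by
  obtain ⟨V₁, V₂, -, hcomp, -, -, -, -, -, d₁, d₂⟩ := he.components_seven_seven
  rw [hcomp] at hV
  rcases hV with rfl | rfl
  · exact d₁
  · exact d₂

theorem HasJordanType.not_subset_pairs [Infinite k] [CharP k 7]
    (he' : HasJordanType e' [7, 5, 2]) (he : HasJordanType e [7, 7])
    {V : Set (Matrix (Fin 14) (Fin 14) k)}
    (hV : V ∈ zariskiComponents k (nilCentralizer 7 e)) :
    ¬ zariskiClosure k (conjOrbitPairs e V) ⊆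
        zariskiClosure k (conjOrbitPairs e' (nilCentralizer 7 e')) ∧
      ¬ zariskiClosure k (conjOrbitPairs e' (nilCentralizer 7 e')) ⊆
        zariskiClosure k (conjOrbitPairs e V) := by
  constructor
  · intro h
    obtain ⟨v, hv⟩ := (irreducible_of_mem_zariskiComponents hV).1
    have h1 := h (subset_zariskiClosure _ (self_mem_conjOrbitPairs hv))
    have h2 : RankLeOne ((e, v).1 ^ 6) := rankLeOne_of_mem_closure_pairs he'.rankLeOne h1
    exact he.not_rankLeOne h2
  · intro h
    have h1 := zariskiDim_mono (k := k) h
    rw [he.zariskiDim_of_mem_components hV,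
      he'.nilCentralizer_seven_five_two.2.2.2.2.1] at h1
    exact not_dim_le h1

/-- The set of pairs above the orbit of type `7.5.2` has larger dimension than the components above
the orbit of type `7²`. -/
theorem not_equidimensional [Infinite k] [CharP k 7] (he' : HasJordanType e' [7, 5, 2])
    (he : HasJordanType e [7, 7]) : ¬ Equidimensional k (restrictedCommutingVariety k 14 7) := by
  intro heq
  obtain ⟨V₁, V₂, -, -, -, -, -, hC, -, d₁, _⟩ := he.components_seven_seven
  obtain ⟨-, -, hsub, hirr, hdim, -⟩ := he'.nilCentralizer_seven_five_two
  obtain ⟨W, hW, hYW⟩ := hirr.exists_subset_component hsub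
  have h1 := zariskiDim_mono (k := k) hYW
  rw [hdim, ← heq _ hC W hW, d₁] at h1
  exact not_dim_le h1

theorem HasJordanType.zariskiClosure_conjOrbit_ne (he' : HasJordanType e' [7, 5, 2])
    (he : HasJordanType e [7, 7]) :
    zariskiClosure k (conjOrbit e') ≠ restrictedNullcone k 14 7 := by
  intro h
  have h1 : e ∈ restrictedNullcone k 14 7 := he.pow_eq_zero (by simp)
  rw [← h] at h1
  exact he.not_rankLeOne (rankLeOne_of_mem_closure_conjOrbit he'.rankLeOne h1)

end Pairs752

theorem mainTheorem3 (k : Type*) [Field k] [IsAlgClosed k] [CharP k 7] :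
    -- the nilpotent elements `e` of type `7²`
    (∀ e : Matrix (Fin 14) (Fin 14) k, HasJordanType e [7, 7] →
      zariskiClosure k (conjOrbit e) = restrictedNullcone k 14 7 ∧
      ∃ V₁ V₂ : Set (Matrix (Fin 14) (Fin 14) k), V₁ ≠ V₂ ∧
        zariskiComponents k (nilCentralizer 7 e) = {V₁, V₂} ∧
        zariskiDim k V₁ + 4 = (Module.finrank k (glCentralizer e) : WithBot ℕ∞) ∧
        zariskiDim k V₂ + 4 = (Module.finrank k (glCentralizer e) : WithBot ℕ∞) ∧
        zariskiClosure k (conjOrbitPairs e V₁) ≠ zariskiClosure k (conjOrbitPairs e V₂) ∧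
        zariskiClosure k (conjOrbitPairs e V₁) ∈
          zariskiComponents k (restrictedCommutingVariety k 14 7) ∧
        zariskiClosure k (conjOrbitPairs e V₂) ∈
          zariskiComponents k (restrictedCommutingVariety k 14 7) ∧
        zariskiDim k (zariskiClosure k (conjOrbitPairs e V₁)) = 192 ∧
        zariskiDim k (zariskiClosure k (conjOrbitPairs e V₂)) = 192) ∧
    -- the nilpotent elements `e'` of type `7.5.2`
    (∀ e' : Matrix (Fin 14) (Fin 14) k, HasJordanType e' [7, 5, 2] →
      ZariskiIrreducible k (nilCentralizer 7 e') ∧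
      zariskiDim k (nilCentralizer 7 e') + 3 =
        (Module.finrank k (glCentralizer e') : WithBot ℕ∞) ∧
      zariskiClosure k (conjOrbitPairs e' (nilCentralizer 7 e')) ⊆
        restrictedCommutingVariety k 14 7 ∧
      ZariskiIrreducible k (zariskiClosure k (conjOrbitPairs e' (nilCentralizer 7 e'))) ∧
      zariskiDim k (zariskiClosure k (conjOrbitPairs e' (nilCentralizer 7 e'))) = 193 ∧
      ∀ e : Matrix (Fin 14) (Fin 14) k, HasJordanType e [7, 7] →
        ∀ V ∈ zariskiComponents k (nilCentralizer 7 e),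
          ¬ zariskiClosure k (conjOrbitPairs e V) ⊆
            zariskiClosure k (conjOrbitPairs e' (nilCentralizer 7 e')) ∧
          ¬ zariskiClosure k (conjOrbitPairs e' (nilCentralizer 7 e')) ⊆
            zariskiClosure k (conjOrbitPairs e V)) ∧
    -- the restricted nilpotent commuting variety is not equidimensional
    ¬ Equidimensional k (restrictedCommutingVariety k 14 7) ∧
    -- the criterion `V ⊆ closure (G · x) ↔ closure (G · x) = N₁` fails
    (∃ x ∈ restrictedNullcone k 14 7, ∃ V ∈ zariskiComponents k (nilCentralizer 7 x),
      V ⊆ zariskiClosure k (conjOrbit x) ∧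
      zariskiClosure k (conjOrbit x) ≠ restrictedNullcone k 14 7) := by
  have : Infinite k := IsAlgClosed.instInfinite
  obtain ⟨e₀, he₀⟩ := exists_hasJordanType (n := 14) k [7, 7] rfl
  obtain ⟨e₁, he₁⟩ := exists_hasJordanType (n := 14) k [7, 5, 2] rfl
  refine ⟨fun e he => ⟨zariskiClosure_conjOrbit_seven_seven he, he.components_seven_seven⟩,
    fun e' he' => ?_, not_equidimensional he₁ he₀, e₁, he₁.pow_eq_zero (by simp),
    nilCentralizer 7 e₁, he₁.nilCentralizer_seven_five_two.1.mem_zariskiComponents,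
    he₁.nilCentralizer_seven_five_two.2.2.2.2.2, he₁.zariskiClosure_conjOrbit_ne he₀⟩
  obtain ⟨h1, h2, h3, h4, h5, -⟩ := he'.nilCentralizer_seven_five_two
  exact ⟨h1, h2, h3, h4, h5, fun e he V hV => he'.not_subset_pairs he hV⟩
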